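/- Let $K$ be an algebraically closed field of characteristic zero, let $M\ge 4$, and write $\mathbb P=\mathbb P^M_K$. For a form $f(x_0,\dots,x_M)$ of degree $2(M-1)$ let $W=\{f=0\}\subset\mathbb P$, and let $\sigma\colon V\to\mathbb P$ be the double cover branched over $W$, that is, $V=\{y^2=f(x_0,\dots,x_M)\}\subset\mathbb P(1,\dots,1,M-1)$. For a linear subspace $P\subset\mathbb P$ of codimension two let $V_P$ be the blow up of $V$ along the closed subvariety $\sigma^{-1}(P)$ (with its reduced structure). A singular point of a variety is called a quadratic point of rank $r$ if it is a hypersurface singularity with local equation $0=w_2(u_1,\dots,u_N)+(\text{terms of order}\ge 3)$, where $u_1,\dots,u_N$ are local parameters of the smooth ambient germ and $w_2\ne 0$ is a quadratic form of rank $r$. Then for a generic hypersurface $W$ of degree $2(M-1)$ (that is, for all $f$ in some nonempty Zariski open subset of the space of forms of degree $2(M-1)$) the hypersurface $W$ is smooth, and the following holds for every linear subspace $P\subset\mathbb P$ of codimension two: (i) if $M\ge 6$, every singular point of $V_P$ is an isolated singular point and a quadratic point of rank $\ge 4$; (ii) (for all $M\ge 4$) every singular point of $V_P$ is an isolated singular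 point and a quadratic point of rank $\ge 3$; (iii) if $M\ge 6$, every singular point of $\sigma^{-1}(P)$ is an isolated singular point and a quadratic point of rank $\ge 2$. -/

import Mathlib

open AlgebraicGeometry Polynomial

universe u

noncomputable section

namespace FanoDouble

/-! ### Genericity and smoothness of forms -/

/-- A property `p` of forms of degree `d` in `n` variables over `K` *holds for a generic form*:
it holds on a nonempty principal Zariski open subset `{Φ ≠ 0}` of the affine space of all
forms of degree `d`, where `Φ` is a polynomial in the coefficients of the form. (Nonempty open
subsets of the projective space of hypersurfaces of degree `d` correspond to nonempty open cones
in that affine space, and every nonempty open subset contains a nonempty principal one.) -/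
def HoldsForGenericForm (K : Type u) [Field K] (n d : ℕ)
    (p : MvPolynomial (Fin n) K → Prop) : Prop :=
  ∃ Φ : MvPolynomial (Fin n →₀ ℕ) K,
    (∃ f : MvPolynomial (Fin n) K, f.IsHomogeneous d ∧
      MvPolynomial.eval (fun m => f.coeff m) Φ ≠ 0) ∧
    ∀ f : MvPolynomial (Fin n) K, f.IsHomogeneous d →
      MvPolynomial.eval (fun m => f.coeff m) Φ ≠ 0 → p f

/-- The hypersurface `{f = 0}` in projective space is smooth (Jacobian criterion). -/
def IsSmoothHypersurface {K : Type u} [Field K] {n : ℕ} (f : MvPolynomial (Fin n) K) : Prop :=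
  ∀ x : Fin n → K, x ≠ 0 → MvPolynomial.eval x f = 0 →
    ∃ j, MvPolynomial.eval x (MvPolynomial.pderiv j f) ≠ 0

/-! ### The double space and the preimage of a linear subspace

The double space `V = {y² = f(x₀, …, x_M)} ⊂ ℙ(1, …, 1, M - 1)` does not contain the point
`(0 : … : 0 : 1)`, so it is covered by the open affine subsets `V_i = V ∩ {x_i ≠ 0}`. As `x_i` has
weight one, `V_i` is the affine variety `{y² = f(x), x_i = 1}`. -/

section DoubleSpace

variable {K : Type u} [Field K] {n : ℕ}

/-- The ideal of `V_i = {y² = f(x), x_i = 1}` in the polynomial ring in the variables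
`x_j = X (some j)` and `y = X none`. -/
def chartIdeal (f : MvPolynomial (Fin n) K) (i : Fin n) :
    Ideal (MvPolynomial (Option (Fin n)) K) :=
  Ideal.span {MvPolynomial.X (some i) - 1,
    MvPolynomial.X none ^ 2 - MvPolynomial.rename some f}

/-- The coordinate ring of the open affine subset `V_i = V ∩ {x_i ≠ 0}` of the double space
branched over `{f = 0}`. -/
abbrev ChartRing (f : MvPolynomial (Fin n) K) (i : Fin n) : Type u :=
  MvPolynomial (Option (Fin n)) K ⧸ chartIdeal f i

/-- The ideal of the closed subset `σ⁻¹(P) ∩ V_i` of `V_i`, taken with its reduced structure: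
the radical of the ideal generated by all the linear forms in `x₀, …, x_M` that vanish on `P`.
Here the linear subspace of the projective space is given as a linear subspace `P` of `Kⁿ`. -/
def preimageIdeal (f : MvPolynomial (Fin n) K) (P : Submodule K (Fin n → K)) (i : Fin n) :
    Ideal (ChartRing f i) :=
  (Ideal.span {l : ChartRing f i | ∃ a : Fin n → K, (∀ v ∈ P, ∑ j, a j * v j = 0) ∧
    l = Ideal.Quotient.mk (chartIdeal f i)
      (∑ j, MvPolynomial.C (a j) * MvPolynomial.X (some j))}).radical

/-- The open affine subset `σ⁻¹(P) ∩ V_i` of the variety `σ⁻¹(P)`. -/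
def preimageChart (f : MvPolynomial (Fin n) K) (P : Submodule K (Fin n → K)) (i : Fin n) :
    Scheme.{u} :=
  Spec (CommRingCat.of (ChartRing f i ⧸ preimageIdeal f P i))

end DoubleSpace

/-! ### Blow ups -/

section BlowUp

variable {A : Type u} [CommRing A]

/-- The degree `k` part `I ^ k • t ^ k` of the Rees algebra `⨁ₖ I ^ k • t ^ k ⊂ A[t]`. -/
def reesGrading (I : Ideal A) (k : ℕ) : Submodule A (reesAlgebra I) :=
  (LinearMap.range (monomial k : A →ₗ[A] A[X])).comap (reesAlgebra I).val.toLinearMap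

theorem mem_reesGrading {I : Ideal A} {k : ℕ} {x : reesAlgebra I} :
    x ∈ reesGrading I k ↔ ∃ a, monomial k a = (x : A[X]) := Iff.rfl

/-- The homogeneous component of degree `k` of an element of the Rees algebra. -/
def reesComponent (I : Ideal A) (x : reesAlgebra I) (k : ℕ) : reesGrading I k :=
  ⟨⟨monomial k ((x : A[X]).coeff k), reesAlgebra.monomial_mem.2 (x.2 k)⟩, _, rfl⟩

instance reesGradedMonoid (I : Ideal A) : SetLike.GradedMonoid (reesGrading I) where
  one_mem := ⟨1, rfl⟩
  mul_mem := by
    rintro i j x y ⟨a, ha⟩ ⟨b, hb⟩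
    refine ⟨a * b, ?_⟩
    have ha' : monomial i a = (x : A[X]) := ha
    have hb' : monomial j b = (y : A[X]) := hb
    change monomial (i + j) (a * b) = (x : A[X]) * (y : A[X])
    rw [← ha', ← hb', monomial_mul_monomial]

theorem coeff_of_mem_reesGrading {I : Ideal A} {k : ℕ} {x : reesAlgebra I}
    (hx : x ∈ reesGrading I k) (m : ℕ) :
    (x : A[X]).coeff m = if k = m then (x : A[X]).coeff k else 0 := by
  obtain ⟨a, ha⟩ := mem_reesGrading.1 hx
  rw [← ha, coeff_monomial, coeff_monomial]
  simp

instance reesDecomposition (I : Ideal A) : DirectSum.Decomposition (reesGrading I) where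
  decompose' x := DFinsupp.mk (x : A[X]).support fun k => reesComponent I x k
  left_inv x := by
    classical
    apply Subtype.ext
    rw [DirectSum.coeAddMonoidHom_eq_dfinsuppSum]
    refine Eq.trans ?_ ((x : A[X]).sum_monomial_eq)
    rw [DFinsupp.sum, Polynomial.sum, AddSubmonoidClass.coe_finsetSum]
    refine Finset.sum_subset_zero_on_sdiff (fun k hk => ?_) (fun k hk => ?_) (fun k hk => ?_)
    · exact DFinsupp.support_mk_subset hk
    · obtain ⟨h1, h2⟩ := Finset.mem_sdiff.1 hk
      have h3 := DFinsupp.notMem_support_iff.1 h2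
      rw [DFinsupp.mk_apply, dif_pos h1] at h3
      exact congrArg (fun z : reesGrading I k => ((z : reesAlgebra I) : A[X])) h3
    · have h1 := DFinsupp.support_mk_subset hk
      rw [DFinsupp.mk_apply, dif_pos h1]
      rfl
  right_inv x := by
    classical
    have key : ∀ k, (((x k : reesGrading I k) : reesAlgebra I) : A[X]) =
        monomial k (((DirectSum.coeAddMonoidHom (reesGrading I) x : reesAlgebra I) : A[X]).coeff
          k) := by
      intro k
      induction x using DirectSum.induction_on with
      | zero => simp
      | of i y =>
        rw [DirectSum.coeAddMonoidHom_of, coeff_of_mem_reesGrading y.2 k]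
        by_cases h : i = k
        · subst h
          rw [DirectSum.of_eq_same, if_pos rfl]
          obtain ⟨a, ha⟩ := mem_reesGrading.1 y.2
          rw [← ha, coeff_monomial, if_pos rfl]
        · rw [if_neg h, DirectSum.of_eq_of_ne _ _ _ (Ne.symm h)]
          simp
      | add a b ha hb =>
        rw [DirectSum.add_apply, map_add]
        push_cast
        rw [ha, hb, coeff_add, map_add]
    refine DFinsupp.ext fun k => Subtype.ext (Subtype.ext ?_)
    rw [key k, DFinsupp.mk_apply]
    split_ifs with h
    · rfl
    · rw [notMem_support_iff.1 h]
      simp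

instance reesGradedAlgebra (I : Ideal A) : GradedAlgebra (reesGrading I) where

/-- The blow up of the affine scheme `Spec A` along the closed subscheme defined by the ideal `I`:
the scheme `Proj (⨁ₖ I ^ k)`. -/
def blowUp (I : Ideal A) : Scheme.{u} := Proj (reesGrading I)

end BlowUp

/-- The part over `V_i` of the blow up `V_P` of the double space `V` along `σ⁻¹(P)`. The open
subschemes obtained for the various `i` cover `V_P`. -/
def blowUpChart {K : Type u} [Field K] {n : ℕ} (f : MvPolynomial (Fin n) K)
    (P : Submodule K (Fin n → K)) (i : Fin n) : Scheme.{u} :=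
  blowUp (preimageIdeal f P i)

/-! ### Quadratic singular points -/

/-- The local ring `O` is that of a *quadratic singular point of rank `r`*, that is, of a
hypersurface singularity with local equation `0 = w₂(u₁, …, u_N) + (terms of order ≥ 3)`, where
the quadratic form `w₂ ≠ 0` is of rank `r`: the ring `O` is a quotient `Q ⧸ (h)` of a regular local
ring `Q` with a regular system of parameters `u₁, …, u_N`, and `h = ∑ cᵢⱼ uᵢ uⱼ` modulo the cube
of the maximal ideal, where `c` is a symmetric matrix which has rank `r` over the residue field. -/
def IsQuadraticSingularity (O : Type u) [CommRing O] (r : ℕ) : Prop :=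
  ∃ (Q : Type u) (_ : CommRing Q) (_ : IsRegularLocalRing Q) (N : ℕ) (v : Fin N → Q)
    (c : Matrix (Fin N) (Fin N) Q) (h : Q),
    (N : WithBot ℕ∞) = ringKrullDim Q ∧
    Ideal.span (Set.range v) = IsLocalRing.maximalIdeal Q ∧
    c.IsSymm ∧
    h - ∑ i, ∑ j, c i j * v i * v j ∈ IsLocalRing.maximalIdeal Q ^ 3 ∧
    (c.map (IsLocalRing.residue Q)).rank = r ∧ r ≠ 0 ∧
    Nonempty (O ≃+* Q ⧸ Ideal.span {h})

/-- `x` is a singular point of the variety (scheme of finite type over an algebraically closed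
field) `X`: it is a closed point, and its local ring is not regular. -/
def IsSingularPoint (X : Scheme.{u}) (x : X) : Prop :=
  IsClosed ({x} : Set X) ∧ ¬ IsRegularLocalRing (X.presheaf.stalk x)

/-- Every singular point of `X` is an isolated quadratic singular point of rank `≥ r`. -/
def SingularPointsIsolatedQuadratic (X : Scheme.{u}) (r : ℕ) : Prop :=
  ∀ x : X, IsSingularPoint X x →
    (∃ U : Set X, IsOpen U ∧ x ∈ U ∧ ∀ y ∈ U, IsSingularPoint X y → y = x) ∧
    ∃ k, r ≤ k ∧ IsQuadraticSingularity (X.presheaf.stalk x) k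

end FanoDouble

end

/-!
Fix a form `f` of degree `d` and a linear subspace `P` of codimension two. In affine coordinates
`a` on the chart `x_i = 1` of `P`, the variety `σ⁻¹(P)` is the double cover `y ^ 2 = g(a)` of
affine space, where `g` is the restriction of `f` to `P` (`AdaptedBasis.slice`). If `l₀`, `l₁` are
linear equations of `P`, the chart of the blow up `V_P` on which `l₀ = u` and `l₁ = u t` is also a
double cover of affine space, with `g(a, u, t) = f(o + ∑ aₖ bₖ + u (c₀ + t c₁))` for vectors `bₖ`
along `P` and vectors `c₀`, `c₁` transversal to it (`AdaptedBasis.blowSlice`). By the Jacobian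
criterion and Taylor expansion, singular points of such a hypersurface are critical points of the
equation, and a nonvanishing minor of size `r` of the Hessian matrix shows that they are quadratic
of rank `≥ r`.

If the hypersurface `f = 0` is smooth, the critical points of `y ^ 2 - g(a, u, t)` lie on `y = 0`,
`u = 0` over the singular points of `f|_P`, and `t` is determined by the point of `P`
(`AdaptedBasis.critical_blowSlice`). The Hessian matrix has a nonzero entry from `y ^ 2`, an
invertible block in `u` and `t`, off which the row of `t` is zero, and the Hessian matrix of
`f|_P`. So if `f|_P` has finitely many singular points, then the singular points of `V_P` are
isolated of rank `≥ 3`; if moreover the Hessian form of `f|_P` does not vanish at them, then the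
rank is `≥ 4`, and the singular points of `σ⁻¹(P)` are isolated of rank `≥ 2`.

It remains to show that a generic `f` satisfies these conditions for all `P`. All this follows
from one principle (`holdsGenerically_of_functionals`): if a family of linear functionals on forms
depends polynomially on fewer parameters than it has members, then for generic `f` the functionals
do not all vanish on `f`, at any value of the parameters where they are independent. Indeed, by
Cramer's rule the forms killed by such functionals are the values of polynomials in fewer
variables than a form has coefficients, and these polynomials are algebraically dependent.

* Smoothness: the partial derivatives at a point of projective space.
* Hessian forms: for `M ≥ 6` the `M (M - 1) / 2` second derivatives along `P` at a point of `P`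
  outnumber the `3 M - 4` parameters of `P` and of the point.
* Finiteness of the singular locus of `f|_P`: if it is infinite, it meets every hyperplane of `P`
  (`finite_of_forall_eq_zero`). So there are `M` singular points on members of a fixed finite set
  of hyperplanes, none of them on the hyperplanes of the later points
  (`exists_successive_points`). Such a configuration has `M ^ 2 - M - 2` parameters, and it
  imposes `M ^ 2 - M - 1` independent conditions on the differentials of `f`
  (`eq_zero_of_sum_gradAt_eq_zero`), which one sees on products of linear forms; this is where the
  degree `2 (M - 1)` enters.
-/

noncomputable section

namespace FanoDouble

/-! ### Points of affine space and Taylor expansions -/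

section PointIdeal

variable {K : Type u} [Field K] {ρ : Type}

/-- The maximal ideal of the point `a` of affine space. -/
abbrev pointIdeal (a : ρ → K) : Ideal (MvPolynomial ρ K) :=
  MvPolynomial.vanishingIdeal K {a}

theorem mem_pointIdeal {a : ρ → K} {p : MvPolynomial ρ K} :
    p ∈ pointIdeal a ↔ MvPolynomial.eval a p = 0 := by
  rw [pointIdeal, MvPolynomial.mem_vanishingIdeal_singleton_iff, MvPolynomial.aeval_eq_eval]

theorem X_sub_C_mem_pointIdeal (a : ρ → K) (i : ρ) :
    (MvPolynomial.X i - MvPolynomial.C (a i) : MvPolynomial ρ K) ∈ pointIdeal a := by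
  simp

/-- The Taylor expansion of order two of a polynomial at the point `a`. -/
theorem taylor_two [Fintype ρ] [CharZero K] (a : ρ → K) (F : MvPolynomial ρ K) :
    F - (MvPolynomial.C (MvPolynomial.eval a F)
      + ∑ i, MvPolynomial.C (MvPolynomial.eval a (MvPolynomial.pderiv i F)) *
          (MvPolynomial.X i - MvPolynomial.C (a i))
      + ∑ i, ∑ j, MvPolynomial.C
          (2⁻¹ * MvPolynomial.eval a (MvPolynomial.pderiv i (MvPolynomial.pderiv j F))) *
          (MvPolynomial.X i - MvPolynomial.C (a i)) * (MvPolynomial.X j - MvPolynomial.C (a j)))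
      ∈ pointIdeal a ^ 3 := by
  classical
  induction F using MvPolynomial.induction_on with
  | C c => simp
  | add p q hp hq =>
    convert! add_mem hp hq using 1
    simp only [map_add, mul_add, add_mul, Finset.sum_add_distrib]
    ring
  | mul_X p k hp =>
    set ξ : ρ → MvPolynomial ρ K := fun i => MvPolynomial.X i - MvPolynomial.C (a i) with hξ
    have hX : (MvPolynomial.X k : MvPolynomial ρ K) = ξ k + MvPolynomial.C (a k) := by simp [hξ]
    let δ : ρ → K := fun i => (Pi.single i 1 : ρ → K) k
    have h1 : (∑ i, ∑ j, MvPolynomial.C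
          (2⁻¹ * MvPolynomial.eval a (MvPolynomial.pderiv i (MvPolynomial.pderiv j p))) *
          ξ i * ξ j) * ξ k ∈ pointIdeal a ^ 3 := by
      rw [pow_succ, pow_two]
      refine Ideal.mul_mem_mul (sum_mem fun i _ => sum_mem fun j _ => ?_)
        (X_sub_C_mem_pointIdeal a k)
      rw [mul_assoc]
      exact Ideal.mul_mem_left _ _
        (Ideal.mul_mem_mul (X_sub_C_mem_pointIdeal a i) (X_sub_C_mem_pointIdeal a j))
    have h2 := Ideal.mul_mem_right (MvPolynomial.X k : MvPolynomial ρ K) _ hp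
    convert! add_mem h2 h1 using 1
    have hd : ∀ (q : MvPolynomial ρ K) i, MvPolynomial.pderiv i (q * MvPolynomial.X k) =
        MvPolynomial.pderiv i q * MvPolynomial.X k + q * MvPolynomial.C (δ i) := by
      intro q i
      rw [MvPolynomial.pderiv_mul, MvPolynomial.pderiv_X]
      congr 2
      by_cases h : k = i
      · subst h; simp [δ]
      · simp [δ, Pi.single_apply, h]
    have hdd : ∀ i j, MvPolynomial.eval a (MvPolynomial.pderiv i
        (MvPolynomial.pderiv j (p * MvPolynomial.X k))) =
        MvPolynomial.eval a (MvPolynomial.pderiv i (MvPolynomial.pderiv j p)) * a k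
        + MvPolynomial.eval a (MvPolynomial.pderiv j p) * δ i
        + MvPolynomial.eval a (MvPolynomial.pderiv i p) * δ j := by
      intro i j
      rw [hd p j, map_add, hd _ i, MvPolynomial.pderiv_mul]
      simp [δ]
    have hs1 : ∀ (c : ρ → K), ∑ i, MvPolynomial.C (c i * δ i) * ξ i
        = MvPolynomial.C (c k) * ξ k := by
      intro c
      rw [Finset.sum_eq_single k]
      · simp [δ]
      · intro b _ hb; simp [δ, Pi.single_apply, Ne.symm hb]
      · simp
    have e1 : ∑ i, MvPolynomial.C (MvPolynomial.eval a
          (MvPolynomial.pderiv i (p * MvPolynomial.X k))) * ξ i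
        = (∑ i, MvPolynomial.C (MvPolynomial.eval a (MvPolynomial.pderiv i p)) * ξ i)
            * MvPolynomial.C (a k)
          + MvPolynomial.C (MvPolynomial.eval a p) * ξ k := by
      rw [← hs1 (fun _ => MvPolynomial.eval a p), Finset.sum_mul, ← Finset.sum_add_distrib]
      refine Finset.sum_congr rfl fun i _ => ?_
      rw [hd]
      simp only [map_add, map_mul, MvPolynomial.eval_X, MvPolynomial.eval_C]
      ring
    have e2 : ∑ i, ∑ j, MvPolynomial.C (2⁻¹ * MvPolynomial.eval a (MvPolynomial.pderiv i
          (MvPolynomial.pderiv j (p * MvPolynomial.X k)))) * ξ i * ξ j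
        = (∑ i, ∑ j, MvPolynomial.C
          (2⁻¹ * MvPolynomial.eval a (MvPolynomial.pderiv i (MvPolynomial.pderiv j p))) *
          ξ i * ξ j) * MvPolynomial.C (a k)
          + (∑ i, MvPolynomial.C (MvPolynomial.eval a (MvPolynomial.pderiv i p)) * ξ i) * ξ k := by
      have hA : ∑ i, ∑ j, MvPolynomial.C (2⁻¹ * (MvPolynomial.eval a (MvPolynomial.pderiv j p)
            * δ i)) * ξ i * ξ j = MvPolynomial.C 2⁻¹ *
          ((∑ i, MvPolynomial.C (MvPolynomial.eval a (MvPolynomial.pderiv i p)) * ξ i) * ξ k) := by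
        rw [Finset.sum_comm, Finset.sum_mul, Finset.mul_sum]
        refine Finset.sum_congr rfl fun j _ => ?_
        rw [← Finset.sum_mul]
        have := hs1 (fun _ => 2⁻¹ * MvPolynomial.eval a (MvPolynomial.pderiv j p))
        simp only [mul_assoc] at this ⊢
        rw [this]
        simp only [map_mul]
        ring
      have hB : ∑ i, ∑ j, MvPolynomial.C (2⁻¹ * (MvPolynomial.eval a (MvPolynomial.pderiv i p)
            * δ j)) * ξ i * ξ j = MvPolynomial.C 2⁻¹ *
          ((∑ i, MvPolynomial.C (MvPolynomial.eval a (MvPolynomial.pderiv i p)) * ξ i) * ξ k) := by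
        rw [← hA, Finset.sum_comm]
        refine Finset.sum_congr rfl fun j _ => Finset.sum_congr rfl fun i _ => ?_
        ring
      have h22 : (MvPolynomial.C 2⁻¹ + MvPolynomial.C 2⁻¹ : MvPolynomial ρ K) = 1 := by
        rw [← MvPolynomial.C_add]
        norm_num
      rw [← one_mul ((∑ i, MvPolynomial.C (MvPolynomial.eval a (MvPolynomial.pderiv i p)) * ξ i)
        * ξ k), ← h22, add_mul]
      nth_rewrite 1 [← hA]
      rw [← hB, Finset.sum_mul, ← add_assoc, ← Finset.sum_add_distrib, ← Finset.sum_add_distrib]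
      refine Finset.sum_congr rfl fun i _ => ?_
      rw [Finset.sum_mul, ← Finset.sum_add_distrib, ← Finset.sum_add_distrib]
      refine Finset.sum_congr rfl fun j _ => ?_
      rw [hdd]
      simp only [map_add, map_mul]
      ring
    rw [e1, e2, hX]
    simp only [map_mul, map_add, MvPolynomial.eval_X, MvPolynomial.eval_C, hξ, map_sub]
    ring

theorem pointIdeal_eq_span (a : ρ → K) : pointIdeal a =
    Ideal.span (Set.range fun i =>
      (MvPolynomial.X i - MvPolynomial.C (a i) : MvPolynomial ρ K)) := by
  apply le_antisymm
  · intro p hp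
    rw [mem_pointIdeal] at hp
    suffices h : ∀ q : MvPolynomial ρ K, q - MvPolynomial.C (MvPolynomial.eval a q) ∈
        Ideal.span (Set.range fun i =>
          (MvPolynomial.X i - MvPolynomial.C (a i) : MvPolynomial ρ K)) by
      simpa [hp] using h p
    intro q
    induction q using MvPolynomial.induction_on with
    | C c => simp
    | add p q hp hq =>
      convert! add_mem hp hq using 1
      simp only [map_add]; ring
    | mul_X p k hp =>
      convert! add_mem (Ideal.mul_mem_right (MvPolynomial.X k : MvPolynomial ρ K) _ hp)
        (Ideal.mul_mem_left _ (MvPolynomial.C (MvPolynomial.eval a p))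
          (Ideal.subset_span ⟨k, rfl⟩)) using 1
      simp only [map_mul, MvPolynomial.eval_X]; ring
  · rw [Ideal.span_le]
    rintro _ ⟨i, rfl⟩
    exact X_sub_C_mem_pointIdeal a i

/-- All points of affine space have the same height, because translations are automorphisms. -/
theorem height_pointIdeal [Fintype ρ] [IsAlgClosed K] (a : ρ → K) :
    (pointIdeal a).height = Fintype.card ρ := by
  have key : ∀ b : ρ → K, (pointIdeal b).height = (pointIdeal a).height := by
    intro b
    let τ : (ρ → K) → MvPolynomial ρ K →ₐ[K] MvPolynomial ρ K := fun c =>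
      MvPolynomial.aeval fun i => MvPolynomial.X i + MvPolynomial.C (c i)
    have hτ : ∀ c, (τ c).comp (τ (-c)) = AlgHom.id K _ := by
      intro c
      ext i : 1
      simp [τ]
    let e : MvPolynomial ρ K ≃ₐ[K] MvPolynomial ρ K :=
      AlgEquiv.ofAlgHom (τ (b - a)) (τ (-(b - a))) (hτ _) (by simpa using hτ (-(b - a)))
    rw [← RingEquiv.height_comap e.toRingEquiv (pointIdeal a)]
    congr 1
    ext p
    rw [Ideal.mem_comap, mem_pointIdeal, mem_pointIdeal]
    have : ((MvPolynomial.aeval a : MvPolynomial ρ K →ₐ[K] K).comp (τ (b - a))) =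
        MvPolynomial.aeval b := by
      ext i : 1
      simp [τ]
    have h := DFunLike.congr_fun this p
    simp only [AlgHom.comp_apply, MvPolynomial.aeval_eq_eval] at h
    change MvPolynomial.eval b p = 0 ↔ MvPolynomial.eval a (τ (b - a) p) = 0
    rw [h]
  have hdim : ringKrullDim (MvPolynomial ρ K) = Fintype.card ρ := by
    simp [Nat.card_eq_fintype_card]
  apply le_antisymm
  · have h := Ideal.height_le_ringKrullDim_of_isPrime (I := pointIdeal a)
    rw [hdim] at h
    exact_mod_cast h
  · have h : ringKrullDim (MvPolynomial ρ K) ≤ (((pointIdeal a).height : ℕ∞) : WithBot ℕ∞) := by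
      rw [ringKrullDim_le_iff_isMaximal_height_le]
      intro m hm
      obtain ⟨b, rfl⟩ := MvPolynomial.eq_vanishingIdeal_singleton_of_isMaximal K hm
      exact_mod_cast (key b).le
    rw [hdim] at h
    exact_mod_cast h

end PointIdeal

/-! ### Local rings of hypersurfaces -/

section LocalRings

/-- A regular local ring stays regular modulo an element of order one. -/
theorem isRegularLocalRing_quotient_of_order_one {Q : Type u} [CommRing Q] [IsRegularLocalRing Q]
    {ρ : Type} [Fintype ρ] (v : ρ → Q)
    (hv : Ideal.span (Set.range v) = IsLocalRing.maximalIdeal Q)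
    (hdim : ringKrullDim Q = (Fintype.card ρ : ℕ)) (h : Q) (c : ρ → Q)
    (hh : h - ∑ i, c i * v i ∈ IsLocalRing.maximalIdeal Q ^ 2) {k : ρ} (hk : IsUnit (c k)) :
    IsRegularLocalRing (Q ⧸ Ideal.span {h}) := by
  classical
  set m := IsLocalRing.maximalIdeal Q with hm
  have hvm : ∀ i, v i ∈ m := fun i => hv ▸ Ideal.subset_span ⟨i, rfl⟩
  have hhm : h ∈ m := by
    have h1 : ∑ i, c i * v i ∈ m := sum_mem fun i _ => Ideal.mul_mem_left _ _ (hvm i)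
    simpa using add_mem (Ideal.pow_le_self two_ne_zero hh) h1
  have hspan : Ideal.span {h} ≠ ⊤ := fun htop => by
    have : Ideal.span {h} ≤ m := by simpa [Ideal.span_le] using hhm
    exact (IsLocalRing.maximalIdeal.isMaximal Q).ne_top (top_le_iff.1 (htop ▸ this))
  have : Nontrivial (Q ⧸ Ideal.span {h}) := Ideal.Quotient.nontrivial_iff.2 hspan
  have : IsLocalRing (Q ⧸ Ideal.span {h}) :=
    IsLocalRing.of_surjective' (Ideal.Quotient.mk _) Ideal.Quotient.mk_surjective
  let T : Finset Q := (Finset.univ.erase k).image v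
  -- by Nakayama, `h` together with all the `v i` except `v k` generates the maximal ideal
  have hle : m ≤ Ideal.span (insert h (T : Set Q)) := by
    refine Submodule.le_of_le_smul_of_le_jacobson_bot (I := m) (IsNoetherian.noetherian m)
      (IsLocalRing.maximalIdeal_le_jacobson _) ?_
    nth_rewrite 1 [← hv]
    rw [Ideal.span_le]
    rintro _ ⟨i, rfl⟩
    by_cases hi : i = k
    · subst hi
      obtain ⟨w, hw⟩ := hk
      have e : v i = ↑w⁻¹ * (h - ∑ j ∈ Finset.univ.erase i, c j * v j)
          + (-↑w⁻¹) * (h - ∑ j, c j * v j) := by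
        rw [← Finset.add_sum_erase _ _ (Finset.mem_univ i), ← hw]
        have := w.inv_mul
        linear_combination (-v i) * this
      rw [e]
      refine Submodule.add_mem_sup (Ideal.mul_mem_left _ _ (sub_mem ?_ (sum_mem fun j hj => ?_)))
        (Ideal.mul_mem_left _ _ ?_)
      · exact Ideal.subset_span (Set.mem_insert _ _)
      · exact Ideal.mul_mem_left _ _ (Ideal.subset_span (Set.mem_insert_of_mem _
          (Finset.mem_coe.2 (Finset.mem_image_of_mem _ hj))))
      · rw [pow_two] at hh
        exact hh
    · refine Submodule.mem_sup_left (Ideal.subset_span (Set.mem_insert_of_mem _ ?_))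
      exact Finset.mem_coe.2 (Finset.mem_image_of_mem _ (by simp [hi]))
  have hmq : IsLocalRing.maximalIdeal (Q ⧸ Ideal.span {h}) ≤
      Ideal.span (T.image (Ideal.Quotient.mk (Ideal.span {h})) : Set (Q ⧸ Ideal.span {h})) := by
    intro x hx
    obtain ⟨y, rfl⟩ := Ideal.Quotient.mk_surjective x
    have hy : y ∈ m := by
      rw [hm, IsLocalRing.mem_maximalIdeal, mem_nonunits_iff]
      intro hu
      exact (IsLocalRing.mem_maximalIdeal _).1 hx (hu.map _)
    have h2 := Ideal.mem_map_of_mem (Ideal.Quotient.mk (Ideal.span {h})) (hle hy)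
    rw [Ideal.map_span, Set.image_insert_eq] at h2
    have h0 : Ideal.Quotient.mk (Ideal.span {h}) h = 0 :=
      Ideal.Quotient.eq_zero_iff_mem.2 (Ideal.mem_span_singleton_self h)
    rw [h0, Ideal.span_insert_zero] at h2
    simpa using h2
  have hmq' : IsLocalRing.maximalIdeal (Q ⧸ Ideal.span {h}) =
      Ideal.span (T.image (Ideal.Quotient.mk (Ideal.span {h})) : Set (Q ⧸ Ideal.span {h})) := by
    refine le_antisymm hmq ?_
    rw [Ideal.span_le]
    intro x hx
    simp only [Finset.coe_image, Set.mem_image, T] at hx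
    obtain ⟨_, ⟨i, -, rfl⟩, rfl⟩ := hx
    rw [SetLike.mem_coe, IsLocalRing.mem_maximalIdeal, mem_nonunits_iff]
    intro hu
    obtain ⟨y, hy⟩ := Ideal.Quotient.mk_surjective (hu.unit⁻¹ : (Q ⧸ Ideal.span {h})ˣ).1
    have h3 : Ideal.Quotient.mk (Ideal.span {h}) (v i * y) = Ideal.Quotient.mk _ 1 := by
      rw [map_mul, hy]; simp
    rw [Ideal.Quotient.eq, Ideal.mem_span_singleton'] at h3
    obtain ⟨b, hb⟩ := h3
    have : (1 : Q) ∈ m := by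
      have e : (1 : Q) = v i * y - b * h := by rw [hb]; ring
      rw [e]
      exact sub_mem (Ideal.mul_mem_right _ _ (hvm i)) (Ideal.mul_mem_left _ _ hhm)
    exact (Ideal.ne_top_iff_one m).1 (IsLocalRing.maximalIdeal.isMaximal Q).ne_top this
  apply IsRegularLocalRing.of_spanFinrank_maximalIdeal_le
  have hcard : (IsLocalRing.maximalIdeal (Q ⧸ Ideal.span {h})).spanFinrank + 1 ≤
      Fintype.card ρ := by
    have h1 : (IsLocalRing.maximalIdeal (Q ⧸ Ideal.span {h})).spanFinrank ≤
        Fintype.card ρ - 1 := by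
      rw [hmq']
      refine (Submodule.spanFinrank_span_le_ncard_of_finite (Finset.finite_toSet _)).trans ?_
      rw [Set.ncard_coe_finset]
      refine Finset.card_image_le.trans (Finset.card_image_le.trans ?_)
      rw [Finset.card_erase_of_mem (Finset.mem_univ k), Finset.card_univ]
    have : 0 < Fintype.card ρ := Fintype.card_pos_iff.2 ⟨k⟩
    omega
  -- so the quotient needs fewer generators, while its dimension drops by at most one
  have hd : ringKrullDim Q ≤ ringKrullDim (Q ⧸ Ideal.span {h}) + 1 := by
    have := ringKrullDim_le_ringKrullDim_quotient_add_encard (R := Q) {h} (by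
      rw [IsLocalRing.ringJacobson_eq_maximalIdeal, Set.singleton_subset_iff]
      exact hhm)
    rwa [Set.encard_singleton] at this
  rw [hdim] at hd
  generalize ringKrullDim (Q ⧸ Ideal.span {h}) = D at hd ⊢
  generalize (IsLocalRing.maximalIdeal (Q ⧸ Ideal.span {h})).spanFinrank = s at hcard ⊢
  have h4 : ((s + 1 : ℕ) : WithBot ℕ∞) ≤ D + 1 := le_trans (by exact_mod_cast hcard) hd
  induction D using WithBot.recBotCoe with
  | bot => simp at h4
  | coe D =>
    have h5 : ((s + 1 : ℕ) : ℕ∞) ≤ D + 1 := by exact_mod_cast h4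
    have h6 : (s : ℕ∞) ≤ D := by
      rw [Nat.cast_add, Nat.cast_one] at h5
      exact (ENat.add_le_add_iff_right (by simp)).1 h5
    exact_mod_cast h6

variable {K : Type u} [Field K] {ρ : Type}

/-- The local ring of a hypersurface in affine space at a closed point. -/
theorem nonempty_localization_hypersurface_equiv (F : MvPolynomial ρ K) (a : ρ → K)
    (p : Ideal (MvPolynomial ρ K ⧸ Ideal.span {F})) [p.IsPrime]
    (hp : p.comap (Ideal.Quotient.mk _) = pointIdeal a) :
    Nonempty (Localization.AtPrime p ≃+* Localization.AtPrime (pointIdeal a) ⧸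
      Ideal.span {algebraMap (MvPolynomial ρ K) (Localization.AtPrime (pointIdeal a)) F}) := by
  let Q := Localization.AtPrime (pointIdeal a)
  let I : Ideal (MvPolynomial ρ K) := Ideal.span {F}
  have hI : I.map (algebraMap _ Q) = Ideal.span {algebraMap (MvPolynomial ρ K) Q F} := by
    rw [Ideal.map_span, Set.image_singleton]
  have hM : Algebra.algebraMapSubmonoid (MvPolynomial ρ K ⧸ I) (pointIdeal a).primeCompl =
      p.primeCompl := by
    ext x
    constructor
    · rintro ⟨y, hy, rfl⟩
      intro hx
      apply hy
      change y ∈ pointIdeal a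
      rw [← hp]
      exact hx
    · intro hx
      obtain ⟨y, rfl⟩ := Ideal.Quotient.mk_surjective x
      refine ⟨y, fun hy => hx ?_, rfl⟩
      change y ∈ pointIdeal a at hy
      rw [← hp] at hy
      exact hy
  have : IsLocalization p.primeCompl (Q ⧸ I.map (algebraMap (MvPolynomial ρ K) Q)) := by
    rw [← hM]
    infer_instance
  exact ⟨((IsLocalization.algEquiv p.primeCompl (Localization.AtPrime p)
    (Q ⧸ I.map (algebraMap (MvPolynomial ρ K) Q))).toRingEquiv).trans (Ideal.quotEquivOfEq hI)⟩

theorem maximalIdeal_localization_pointIdeal (a : ρ → K) :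
    Ideal.span (Set.range fun i => algebraMap (MvPolynomial ρ K)
      (Localization.AtPrime (pointIdeal a)) (MvPolynomial.X i - MvPolynomial.C (a i))) =
      IsLocalRing.maximalIdeal (Localization.AtPrime (pointIdeal a)) := by
  rw [← Localization.AtPrime.map_eq_maximalIdeal]
  refine Eq.trans ?_ (congrArg (Ideal.map (algebraMap (MvPolynomial ρ K)
    (Localization.AtPrime (pointIdeal a)))) (pointIdeal_eq_span a)).symm
  rw [Ideal.map_span, ← Set.range_comp]
  rfl

theorem pderiv_pderiv_comm (i j : ρ) (F : MvPolynomial ρ K) :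
    MvPolynomial.pderiv i (MvPolynomial.pderiv j F) =
      MvPolynomial.pderiv j (MvPolynomial.pderiv i F) := by
  classical
  let D : ρ → Derivation K (MvPolynomial ρ K) (MvPolynomial ρ K) := fun k => MvPolynomial.pderiv k
  have h : ⁅D i, D j⁆ = 0 := by
    apply MvPolynomial.derivation_ext
    intro k
    rw [Derivation.commutator_apply]
    simp only [D, MvPolynomial.pderiv_X, Pi.single_apply]
    split_ifs <;> simp
  have h2 := DFunLike.congr_fun h F
  rwa [Derivation.commutator_apply, Derivation.zero_apply, sub_eq_zero] at h2

variable [Fintype ρ] [IsAlgClosed K]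

theorem ringKrullDim_localization_pointIdeal (a : ρ → K) :
    ringKrullDim (Localization.AtPrime (pointIdeal a)) = (Fintype.card ρ : ℕ) := by
  rw [IsLocalization.AtPrime.ringKrullDim_eq_height (pointIdeal a), height_pointIdeal]
  rfl

variable [CharZero K]

/-- The Jacobian criterion: a hypersurface is regular at a closed point at which some partial
derivative of its equation does not vanish. -/
theorem isRegularLocalRing_of_pderiv_ne_zero (F : MvPolynomial ρ K) (a : ρ → K)
    (p : Ideal (MvPolynomial ρ K ⧸ Ideal.span {F})) [p.IsPrime]
    (hp : p.comap (Ideal.Quotient.mk _) = pointIdeal a) (h0 : MvPolynomial.eval a F = 0)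
    {k : ρ} (hk : MvPolynomial.eval a (MvPolynomial.pderiv k F) ≠ 0) :
    IsRegularLocalRing (Localization.AtPrime p) := by
  classical
  obtain ⟨e⟩ := nonempty_localization_hypersurface_equiv F a p hp
  let Q := Localization.AtPrime (pointIdeal a)
  let φ : MvPolynomial ρ K →+* Q := algebraMap _ _
  have : IsRegularLocalRing (Q ⧸ Ideal.span {φ F}) := by
    refine isRegularLocalRing_quotient_of_order_one _ (maximalIdeal_localization_pointIdeal a)
      (ringKrullDim_localization_pointIdeal a) _
      (fun i => φ (MvPolynomial.C (MvPolynomial.eval a (MvPolynomial.pderiv i F)))) ?_ (k := k)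
      ((IsUnit.mk0 _ hk).map (φ.comp MvPolynomial.C))
    have h1 := taylor_two a F
    rw [h0, map_zero, zero_add] at h1
    have h2 : F - ∑ i, MvPolynomial.C (MvPolynomial.eval a (MvPolynomial.pderiv i F)) *
          (MvPolynomial.X i - MvPolynomial.C (a i)) ∈ pointIdeal a ^ 2 := by
      have h3 : ∑ i, ∑ j, MvPolynomial.C
          (2⁻¹ * MvPolynomial.eval a (MvPolynomial.pderiv i (MvPolynomial.pderiv j F))) *
          (MvPolynomial.X i - MvPolynomial.C (a i)) * (MvPolynomial.X j - MvPolynomial.C (a j)) ∈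
          pointIdeal a ^ 2 := by
        refine sum_mem fun i _ => sum_mem fun j _ => ?_
        rw [mul_assoc, pow_two]
        exact Ideal.mul_mem_left _ _
          (Ideal.mul_mem_mul (X_sub_C_mem_pointIdeal a i) (X_sub_C_mem_pointIdeal a j))
      convert! add_mem (Ideal.pow_le_pow_right (by norm_num : 2 ≤ 3) h1) h3 using 1
      ring
    have h4 := Ideal.mem_map_of_mem φ h2
    rw [Ideal.map_pow, Localization.AtPrime.map_eq_maximalIdeal, map_sub, map_sum] at h4
    simpa only [map_mul] using h4
  exact @IsRegularLocalRing.of_ringEquiv (Q ⧸ Ideal.span {φ F}) _ this _ _ e.symm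

/-- A critical point of `F` at which the Hessian matrix has a non-vanishing minor of size `r > 0`
is a quadratic point of rank `≥ r` of the hypersurface `F = 0`. -/
theorem isQuadraticSingularity_of_hessian_minor (F : MvPolynomial ρ K) (a : ρ → K)
    (p : Ideal (MvPolynomial ρ K ⧸ Ideal.span {F})) [p.IsPrime]
    (hp : p.comap (Ideal.Quotient.mk _) = pointIdeal a) (h0 : MvPolynomial.eval a F = 0)
    (hk : ∀ k, MvPolynomial.eval a (MvPolynomial.pderiv k F) = 0) {r : ℕ} (hr : 0 < r)
    (s t : Fin r → ρ) (hst : (Matrix.of fun i j => MvPolynomial.eval a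
      (MvPolynomial.pderiv (s i) (MvPolynomial.pderiv (t j) F))).det ≠ 0) :
    ∃ k, r ≤ k ∧ IsQuadraticSingularity (Localization.AtPrime p) k := by
  obtain ⟨e⟩ := nonempty_localization_hypersurface_equiv F a p hp
  let Q := Localization.AtPrime (pointIdeal a)
  let φ : MvPolynomial ρ K →+* Q := algebraMap _ _
  let ε : Fin (Fintype.card ρ) ≃ ρ := (Fintype.equivFin ρ).symm
  let H : Matrix ρ ρ K := Matrix.of fun i j => MvPolynomial.eval a
      (MvPolynomial.pderiv i (MvPolynomial.pderiv j F))
  let c : Matrix (Fin (Fintype.card ρ)) (Fin (Fintype.card ρ)) Q :=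
    Matrix.of fun i j => φ (MvPolynomial.C (2⁻¹ * H (ε i) (ε j)))
  let ψ : K →+* IsLocalRing.ResidueField Q :=
    (IsLocalRing.residue Q).comp (φ.comp MvPolynomial.C)
  have hrank : r ≤ (c.map (IsLocalRing.residue Q)).rank := by
    have h1 : (c.map (IsLocalRing.residue Q)).submatrix (ε.symm ∘ s) (ε.symm ∘ t) =
        (ψ.mapMatrix ((2⁻¹ : K) • H.submatrix s t)) := by
      ext i j
      simp [c, ψ, H]
    have h2 : ((c.map (IsLocalRing.residue Q)).submatrix (ε.symm ∘ s) (ε.symm ∘ t)).rank = r := by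
      have hu : IsUnit ((c.map (IsLocalRing.residue Q)).submatrix (ε.symm ∘ s) (ε.symm ∘ t)) := by
        rw [Matrix.isUnit_iff_isUnit_det, h1, ← RingHom.map_det, Matrix.det_smul]
        refine (IsUnit.mk0 _ (mul_ne_zero (pow_ne_zero _ (by norm_num)) ?_)).map ψ
        exact hst
      rw [Matrix.rank_of_isUnit _ hu, Fintype.card_fin]
    rw [← h2]
    exact Matrix.rank_submatrix_le _ _ _
  refine ⟨_, hrank, Q, inferInstance, inferInstance, Fintype.card ρ,
    fun i => φ (MvPolynomial.X (ε i) - MvPolynomial.C (a (ε i))), c, φ F,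
    (ringKrullDim_localization_pointIdeal a).symm, ?_, ?_, ?_, rfl, by omega, ⟨e⟩⟩
  · rw [← maximalIdeal_localization_pointIdeal a]
    congr 1
    exact ε.surjective.range_comp
      (fun i => φ (MvPolynomial.X i - MvPolynomial.C (a i)))
  · ext i j
    simp only [c, H, Matrix.transpose_apply, Matrix.of_apply]
    rw [pderiv_pderiv_comm]
  · have h1 := taylor_two a F
    simp only [h0, hk, map_zero, zero_mul, Finset.sum_const_zero, zero_add] at h1
    have h4 := Ideal.mem_map_of_mem φ h1
    rw [Ideal.map_pow, Localization.AtPrime.map_eq_maximalIdeal, map_sub, map_sum] at h4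
    convert h4 using 2
    rw [← ε.sum_comp]
    refine Finset.sum_congr rfl fun i _ => ?_
    rw [map_sum, ← ε.sum_comp]
    refine Finset.sum_congr rfl fun j _ => ?_
    simp [c, H]

end LocalRings

/-! ### Schemes covered by affine hypersurfaces -/

section Charts

theorem IsQuadraticSingularity.of_ringEquiv {O O' : Type u} [CommRing O] [CommRing O'] {r : ℕ}
    (h : IsQuadraticSingularity O r) (e : O ≃+* O') : IsQuadraticSingularity O' r := by
  obtain ⟨Q, i1, i2, N, v, c, h, h1, h2, h3, h4, h5, h6, ⟨e'⟩⟩ := h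
  exact ⟨Q, i1, i2, N, v, c, h, h1, h2, h3, h4, h5, h6, ⟨e.symm.trans e'⟩⟩

variable {K : Type u} [Field K]

/-- The points of the affine hypersurface `F = 0` at which all partial derivatives of `F`
vanish. -/
def criticalPoints {ρ : Type} (F : MvPolynomial ρ K) : Set (ρ → K) :=
  {a | MvPolynomial.eval a F = 0 ∧ ∀ k, MvPolynomial.eval a (MvPolynomial.pderiv k F) = 0}

/-- The affine hypersurface `F = 0` has finitely many critical points, and at each of them the
Hessian matrix of `F` has rank at least `r`, expressed by a non-vanishing minor. -/
def HasQuadraticCriticalPoints {ρ : Type} (F : MvPolynomial ρ K) (r : ℕ) : Prop :=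
  (criticalPoints F).Finite ∧ ∀ a ∈ criticalPoints F, ∃ s t : Fin r → ρ,
    (Matrix.of fun i j => MvPolynomial.eval a
      (MvPolynomial.pderiv (s i) (MvPolynomial.pderiv (t j) F))).det ≠ 0

variable (K) in
/-- The ring `B` is the coordinate ring of an affine hypersurface over `K` all of whose critical
points are isolated and quadratic of rank at least `r`. -/
def IsQuadraticHypersurfaceRing (B : Type u) [CommRing B] (r : ℕ) : Prop :=
  ∃ (ρ : Type) (_ : Fintype ρ) (F : MvPolynomial ρ K), HasQuadraticCriticalPoints F r ∧
    Nonempty (B ≃+* MvPolynomial ρ K ⧸ Ideal.span {F})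

variable (K) in
theorem IsQuadraticHypersurfaceRing.of_ringEquiv {B B' : Type u} [CommRing B] [CommRing B'] {r : ℕ}
    (h : IsQuadraticHypersurfaceRing K B r) (e : B ≃+* B') :
    IsQuadraticHypersurfaceRing K B' r := by
  obtain ⟨ρ, i, F, hF, ⟨e'⟩⟩ := h
  exact ⟨ρ, i, F, hF, ⟨e.symm.trans e'⟩⟩

/-- The stalk at the image of a prime under an open immersion of an affine scheme. -/
theorem nonempty_stalk_equiv {X : Scheme.{u}} {B : Type u} [CommRing B]
    (ι : Spec (CommRingCat.of B) ⟶ X) [IsOpenImmersion ι] (y : PrimeSpectrum B) :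
    Nonempty (X.presheaf.stalk (ι y) ≃+* Localization.AtPrime y.asIdeal) :=
  let y' : Spec (CommRingCat.of B) := y
  ⟨((CategoryTheory.asIso (ι.stalkMap y')).trans
    (Spec.stalkIso (CommRingCat.of B) y)).commRingCatIsoToRingEquiv⟩

variable [IsAlgClosed K] [CharZero K]

/-- Singular points are closed points with non-regular local ring, so by the Nullstellensatz and
the Jacobian criterion those in an affine hypersurface chart come from critical points of the
equation. -/
theorem finite_isSingularPoint_of_openImmersion {X : Scheme.{u}} {B : Type u} [CommRing B]
    {r : ℕ} (hr : 0 < r) (hB : IsQuadraticHypersurfaceRing K B r)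
    (ι : Spec (CommRingCat.of B) ⟶ X) [IsOpenImmersion ι] :
    {x : X | IsSingularPoint X x ∧ x ∈ Set.range ι}.Finite ∧
    ∀ x : X, IsSingularPoint X x → x ∈ Set.range ι →
      ∃ k, r ≤ k ∧ IsQuadraticSingularity (X.presheaf.stalk x) k := by
  obtain ⟨ρ, _, F, ⟨hfin, hrank⟩, ⟨e⟩⟩ := hB
  let A : Type u := MvPolynomial ρ K ⧸ Ideal.span {F}
  let i : CommRingCat.of B ≅ CommRingCat.of A := e.toCommRingCatIso
  let j : Spec (CommRingCat.of A) ⟶ X := CategoryTheory.CategoryStruct.comp (Spec.map i.hom) ι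
  have hrange : ∀ x, x ∈ Set.range ι → ∃ y : PrimeSpectrum A, j y = x := by
    rintro x ⟨y, rfl⟩
    refine ⟨Spec.map i.inv y, ?_⟩
    rw [← Scheme.Hom.comp_apply]
    simp only [j]
    rw [← CategoryTheory.Category.assoc, ← Spec.map_comp, CategoryTheory.Iso.hom_inv_id,
      Spec.map_id, CategoryTheory.Category.id_comp]
  have key : ∀ y : PrimeSpectrum A, IsSingularPoint X (j y) → ∃ a ∈ criticalPoints F,
      y.asIdeal.comap (Ideal.Quotient.mk (Ideal.span {F})) = pointIdeal a := by
    rintro y ⟨hcl, hreg⟩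
    have hy : IsClosed ({y} : Set (PrimeSpectrum A)) := by
      have h1 : j ⁻¹' {j y} = ({y} : Set (PrimeSpectrum A)) := by
        ext z
        simp only [Set.mem_preimage, Set.mem_singleton_iff]
        exact ⟨fun h => j.isOpenEmbedding.injective h, fun h => h ▸ rfl⟩
      rw [← h1]
      exact hcl.preimage j.continuous
    have hmax : y.asIdeal.IsMaximal := (PrimeSpectrum.isClosed_singleton_iff_isMaximal y).1 hy
    have hmax' : (y.asIdeal.comap (Ideal.Quotient.mk (Ideal.span {F}))).IsMaximal :=
      Ideal.comap_isMaximal_of_surjective _ Ideal.Quotient.mk_surjective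
    obtain ⟨a, ha⟩ := MvPolynomial.eq_vanishingIdeal_singleton_of_isMaximal K hmax'
    have h0 : MvPolynomial.eval a F = 0 := by
      rw [← mem_pointIdeal, pointIdeal, ← ha, Ideal.mem_comap,
        Ideal.Quotient.eq_zero_iff_mem.2 (Ideal.mem_span_singleton_self F)]
      exact zero_mem _
    refine ⟨a, ⟨h0, fun k => ?_⟩, ha⟩
    by_contra hk
    have hloc := isRegularLocalRing_of_pderiv_ne_zero F a y.asIdeal ha h0 hk
    obtain ⟨e'⟩ := nonempty_stalk_equiv j y
    exact hreg (IsRegularLocalRing.of_ringEquiv e'.symm)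
  constructor
  · have hT : {y : PrimeSpectrum A | ∃ a ∈ criticalPoints F,
        y.asIdeal.comap (Ideal.Quotient.mk (Ideal.span {F})) = pointIdeal a}.Finite := by
      refine Set.Finite.of_finite_image ((hfin.image pointIdeal).subset ?_)
        (f := fun y : PrimeSpectrum A => y.asIdeal.comap (Ideal.Quotient.mk (Ideal.span {F}))) ?_
      · rintro _ ⟨y, ⟨a, ha, h⟩, rfl⟩
        exact ⟨a, ha, h.symm⟩
      · intro y _ z _ h
        exact PrimeSpectrum.ext
          (Ideal.comap_injective_of_surjective _ Ideal.Quotient.mk_surjective h)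
    refine (hT.image j).subset ?_
    rintro x ⟨hx, hr⟩
    obtain ⟨y, rfl⟩ := hrange x hr
    exact ⟨y, key y hx, rfl⟩
  · rintro x hx hxr
    obtain ⟨y, rfl⟩ := hrange x hxr
    obtain ⟨a, ha, hya⟩ := key y hx
    obtain ⟨s, t, hst⟩ := hrank a ha
    obtain ⟨k, hk, hq⟩ := isQuadraticSingularity_of_hessian_minor F a y.asIdeal hya ha.1 ha.2 hr
      s t hst
    obtain ⟨e'⟩ := nonempty_stalk_equiv j y
    exact ⟨k, hk, hq.of_ringEquiv e'.symm⟩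

/-- A scheme covered by finitely many affine hypersurfaces with isolated quadratic critical
points of rank at least `r` has isolated quadratic singularities of rank at least `r`. -/
theorem singularPointsIsolatedQuadratic_of_cover {X : Scheme.{u}} {r : ℕ} (hr : 0 < r)
    {κ : Type} [Finite κ] (B : κ → Type u) [∀ k, CommRing (B k)]
    (hB : ∀ k, IsQuadraticHypersurfaceRing K (B k) r)
    (ι : ∀ k, Spec (CommRingCat.of (B k)) ⟶ X) [∀ k, IsOpenImmersion (ι k)]
    (hcov : ∀ x, ∃ k, x ∈ Set.range (ι k)) : SingularPointsIsolatedQuadratic X r := by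
  have hfin : {x : X | IsSingularPoint X x}.Finite := by
    refine (Set.finite_iUnion fun k =>
      (finite_isSingularPoint_of_openImmersion hr (hB k) (ι k)).1).subset ?_
    intro x hx
    obtain ⟨k, hk⟩ := hcov x
    exact Set.mem_iUnion.2 ⟨k, hx, hk⟩
  intro x hx
  constructor
  · refine ⟨({y : X | IsSingularPoint X y} \ {x})ᶜ, ?_, by simp, ?_⟩
    · rw [isOpen_compl_iff, ← Set.biUnion_of_singleton ({y : X | IsSingularPoint X y} \ {x})]
      exact (hfin.subset Set.sdiff_subset).isClosed_biUnion fun y hy => hy.1.1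
    · intro y hy hy'
      by_contra hne
      exact hy ⟨hy', hne⟩
  · obtain ⟨k, hk⟩ := hcov x
    exact (finite_isSingularPoint_of_openImmersion hr (hB k) (ι k)).2 x hx hk

theorem singularPointsIsolatedQuadratic_Spec {B : Type u} [CommRing B] {r : ℕ} (hr : 0 < r)
    (hB : IsQuadraticHypersurfaceRing K B r) :
    SingularPointsIsolatedQuadratic (Spec (CommRingCat.of B)) r :=
  singularPointsIsolatedQuadratic_of_cover (κ := Unit) hr (fun _ => B)
    (fun _ => hB) (fun _ => CategoryTheory.CategoryStruct.id _) fun x => ⟨(), x, rfl⟩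

end Charts

/-! ### Charts of blow ups -/

section BlowUpCharts

variable {A : Type u} [CommRing A]

/-- The element `a t` of degree one of the Rees algebra. -/
def reesOfMem (I : Ideal A) {a : A} (ha : a ∈ I) : reesAlgebra I :=
  ⟨monomial 1 a, reesAlgebra.monomial_mem.2 (by simpa using ha)⟩

theorem reesOfMem_mem (I : Ideal A) {a : A} (ha : a ∈ I) : reesOfMem I ha ∈ reesGrading I 1 :=
  ⟨a, rfl⟩

/-- The chart `D₊(a t)` of the blow up of `I` is the spectrum of a ring `B` over `A` as soon as
`a` becomes a non-zero-divisor in `B` generating `I B`, every element of `B` is a fraction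
`c / a ^ k` with `c ∈ I ^ k`, and the kernel of `A → B` is killed by powers of `a`. -/
theorem nonempty_away_reesGrading_equiv (I : Ideal A) {a : A} (ha : a ∈ I)
    {B : Type u} [CommRing B] (α : A →+* B) (hnzd : α a ∈ nonZeroDivisors B)
    (hgen : ∀ c ∈ I, α a ∣ α c)
    (hfrac : ∀ b : B, ∃ k, ∃ c ∈ I ^ k, α a ^ k * b = α c)
    (hker : ∀ c, α c = 0 → ∃ k, a ^ k * c = 0) :
    Nonempty (HomogeneousLocalization.Away (reesGrading I) (reesOfMem I ha) ≃+* B) := by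
  let L := Localization.Away (α a)
  let ev : reesAlgebra I →+* L := ((algebraMap B L).comp α).comp
    ((Polynomial.evalRingHom (1 : A)).comp (reesAlgebra I).val.toRingHom)
  have hev : ∀ (k : ℕ) (c : A) (h : monomial k c ∈ reesAlgebra I),
      ev ⟨monomial k c, h⟩ = algebraMap B L (α c) := by
    intro k c h
    simp [ev]
  have hinj : Function.Injective (algebraMap B L) :=
    IsLocalization.injective L (Submonoid.powers_le.2 hnzd)
  have hev1 : ev (reesOfMem I ha) = algebraMap B L (α a) := hev 1 a _
  have hunit : IsUnit (ev (reesOfMem I ha)) := by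
    rw [hev1]
    exact IsLocalization.Away.algebraMap_isUnit (α a)
  let ψ : HomogeneousLocalization.Away (reesGrading I) (reesOfMem I ha) →+* L :=
    (IsLocalization.Away.lift (S := Localization.Away (reesOfMem I ha)) (reesOfMem I ha) hunit).comp
      (algebraMap _ _)
  have hgenpow : ∀ k, ∀ c ∈ I ^ k, α a ^ k ∣ α c := by
    intro k c hc
    have h1 : Ideal.map α I ≤ Ideal.span {α a} := by
      rw [Ideal.map_le_iff_le_comap]
      intro x hx
      exact Ideal.mem_span_singleton.2 (hgen x hx)
    have h2 := Ideal.mem_map_of_mem α hc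
    rw [Ideal.map_pow] at h2
    have h3 := Ideal.pow_right_mono h1 k h2
    rwa [Ideal.span_singleton_pow, Ideal.mem_span_singleton] at h3
  -- every element of the chart is `c t ^ k / (a t) ^ k` with `c ∈ I ^ k`
  have hform : ∀ x : HomogeneousLocalization.Away (reesGrading I) (reesOfMem I ha),
      ∃ (k : ℕ) (c : A) (hc : c ∈ I ^ k),
        x.val = Localization.mk ⟨monomial k c, reesAlgebra.monomial_mem.2 hc⟩
          (⟨reesOfMem I ha ^ k, pow_mem (Submonoid.mem_powers _) k⟩ :
            Submonoid.powers (reesOfMem I ha)) := by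
    intro x
    obtain ⟨k, y, hy, rfl⟩ :=
      HomogeneousLocalization.Away.mk_surjective (reesGrading I) (reesOfMem_mem I ha) x
    have hy' := hy
    obtain ⟨c, hc⟩ := mem_reesGrading.1 hy
    rw [smul_eq_mul, mul_one] at hc
    have hcI : c ∈ I ^ k := by
      rw [← reesAlgebra.monomial_mem, hc]
      exact y.2
    refine ⟨k, c, hcI, ?_⟩
    rw [HomogeneousLocalization.Away.val_mk]
    congr 1
    exact Subtype.ext hc.symm
  have hψ : ∀ (x : HomogeneousLocalization.Away (reesGrading I) (reesOfMem I ha)) (k : ℕ) (c : A)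
      (hc : c ∈ I ^ k), x.val = Localization.mk ⟨monomial k c, reesAlgebra.monomial_mem.2 hc⟩
          (⟨reesOfMem I ha ^ k, pow_mem (Submonoid.mem_powers _) k⟩ :
            Submonoid.powers (reesOfMem I ha)) →
      algebraMap B L (α a) ^ k * ψ x = algebraMap B L (α c) := by
    intro x k c hc hx
    have h1 : ψ x = IsLocalization.Away.lift (S := Localization.Away (reesOfMem I ha))
        (reesOfMem I ha) hunit x.val := rfl
    have h2 : algebraMap (reesAlgebra I) (Localization.Away (reesOfMem I ha)) (reesOfMem I ha ^ k) *
        x.val = algebraMap _ _ (⟨monomial k c, reesAlgebra.monomial_mem.2 hc⟩ : reesAlgebra I) := by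
      rw [hx, Localization.mk_eq_mk']
      exact IsLocalization.mk'_spec' (Localization.Away (reesOfMem I ha)) _
        (⟨reesOfMem I ha ^ k, pow_mem (Submonoid.mem_powers _) k⟩ :
            Submonoid.powers (reesOfMem I ha))
    have h3 := congrArg (IsLocalization.Away.lift (S := Localization.Away (reesOfMem I ha))
        (reesOfMem I ha) hunit) h2
    rw [map_mul, IsLocalization.Away.lift_eq, IsLocalization.Away.lift_eq, map_pow, hev,
      hev1] at h3
    rw [h1]
    exact h3
  have hunit' : IsUnit (algebraMap B L (α a)) := IsLocalization.Away.algebraMap_isUnit (α a)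
  have hψinj : Function.Injective ψ := by
    rw [injective_iff_map_eq_zero]
    intro x hx
    obtain ⟨k, c, hc, hxv⟩ := hform x
    have h1 := hψ x k c hc hxv
    rw [hx, mul_zero] at h1
    obtain ⟨m, hm⟩ := hker c (hinj (by rw [← h1, map_zero]))
    apply HomogeneousLocalization.val_injective
    rw [hxv, HomogeneousLocalization.val_zero, Localization.mk_eq_mk',
      IsLocalization.mk'_eq_zero_iff]
    refine ⟨⟨reesOfMem I ha ^ m, m, rfl⟩, ?_⟩
    apply Subtype.ext
    simp only [reesOfMem, MulMemClass.coe_mul, SubmonoidClass.coe_pow, monomial_pow,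
      monomial_mul_monomial, hm]
    simp
  -- the chart and `B` are the same subring of `B[1 / a]`
  have hrange : ψ.rangeS = (algebraMap B L).rangeS := by
    ext z
    constructor
    · rintro ⟨x, rfl⟩
      obtain ⟨k, c, hc, hxv⟩ := hform x
      obtain ⟨b, hb⟩ := hgenpow k c hc
      refine ⟨b, ?_⟩
      have h1 := hψ x k c hc hxv
      rw [hb, map_mul, map_pow] at h1
      exact ((hunit'.pow k).mul_left_cancel h1).symm
    · rintro ⟨b, rfl⟩
      obtain ⟨k, c, hc, hb⟩ := hfrac b
      have hm : (⟨monomial k c, reesAlgebra.monomial_mem.2 hc⟩ : reesAlgebra I) ∈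
          reesGrading I (k • 1) := ⟨c, by simp⟩
      refine ⟨HomogeneousLocalization.Away.mk (reesGrading I) (reesOfMem_mem I ha) k _ hm, ?_⟩
      have h1 := hψ (HomogeneousLocalization.Away.mk (reesGrading I) (reesOfMem_mem I ha) k _ hm)
        k c hc (HomogeneousLocalization.Away.val_mk ..)
      rw [← hb, map_mul, map_pow] at h1
      exact (hunit'.pow k).mul_left_cancel h1
  exact ⟨(RingEquiv.ofBijective ψ.rangeSRestrict ⟨fun x y h => hψinj (congrArg Subtype.val h),
    ψ.rangeSRestrict_surjective⟩).trans ((RingEquiv.subsemiringCongr hrange).trans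
      (RingEquiv.ofBijective (algebraMap B L).rangeSRestrict
        ⟨fun x y h => hinj (congrArg Subtype.val h),
          (algebraMap B L).rangeSRestrict_surjective⟩).symm)⟩

/-- The charts `D₊(a t)`, for `a` in a set of generators of `I`, cover the blow up of `I`. -/
theorem exists_mem_range_awayι (I : Ideal A) {κ : Type} (a : κ → A) (ha : ∀ k, a k ∈ I)
    (hI : I = Ideal.span (Set.range a)) (x : blowUp I) :
    ∃ k, x ∈ Set.range (Proj.awayι (reesGrading I) (reesOfMem I (ha k))
      (reesOfMem_mem I (ha k)) one_pos) := by
  have hmon : ∀ k (c : A) (hc : c ∈ I ^ (k + 1)),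
      (⟨monomial (k + 1) c, reesAlgebra.monomial_mem.2 hc⟩ : reesAlgebra I) ∈
        Ideal.span (Set.range fun k => reesOfMem I (ha k)) := by
    intro k c hc
    have hc' : c ∈ I ^ k • Ideal.span (Set.range a) := by
      rw [← hI, smul_eq_mul, ← pow_succ]
      exact hc
    obtain ⟨b, hb, hsum⟩ := (Submodule.mem_ideal_smul_span_iff_exists_sum _ _ _).1 hc'
    have e : (⟨monomial (k + 1) c, reesAlgebra.monomial_mem.2 hc⟩ : reesAlgebra I) =
        ∑ i ∈ b.support, (⟨monomial k (b i), reesAlgebra.monomial_mem.2 (hb i)⟩ : reesAlgebra I) *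
          reesOfMem I (ha i) := by
      apply Subtype.ext
      rw [AddSubmonoidClass.coe_finsetSum]
      refine (congrArg (monomial (k + 1)) hsum.symm).trans ?_
      rw [Finsupp.sum, map_sum]
      refine Finset.sum_congr rfl fun i _ => ?_
      simp [reesOfMem, monomial_mul_monomial]
    rw [e]
    exact sum_mem fun i _ => Ideal.mul_mem_left _ _ (Ideal.subset_span ⟨i, rfl⟩)
  have h := Proj.iSup_basicOpen_eq_top (reesGrading I) (fun k => reesOfMem I (ha k)) (by
    classical
    intro y hy
    rw [← DirectSum.sum_support_decompose (reesGrading I) y]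
    refine sum_mem fun k hk => ?_
    obtain ⟨c, hc⟩ := mem_reesGrading.1 (DirectSum.decompose (reesGrading I) y k).2
    cases k with
    | zero =>
      have h0 := (HomogeneousIdeal.mem_irrelevant_iff _ _).1 hy
      rw [GradedRing.proj_apply] at h0
      rw [h0]
      exact zero_mem _
    | succ k =>
      have hcI : c ∈ I ^ (k + 1) := by
        rw [← reesAlgebra.monomial_mem, hc]
        exact (DirectSum.decompose (reesGrading I) y (k + 1) : reesAlgebra I).2
      have := hmon k c hcI
      convert! this using 1
      exact Subtype.ext hc.symm)
  have hx : x ∈ (⊤ : (Proj (reesGrading I)).Opens) := trivial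
  rw [← h] at hx
  obtain ⟨k, hk⟩ := TopologicalSpace.Opens.mem_iSup.1 hx
  refine ⟨k, ?_⟩
  rw [← Proj.opensRange_awayι (reesGrading I) (reesOfMem I (ha k)) (reesOfMem_mem I (ha k))
    one_pos] at hk
  exact hk

end BlowUpCharts

/-! ### Directional derivatives -/

section DirectionalDerivatives

variable {K : Type u} [Field K] {σ : Type}

theorem aeval_aeval {τ : Type} {Λ : Type u} [CommRing Λ] [Algebra K Λ] (ζ : τ → Λ)
    (γ : σ → MvPolynomial τ K) (f : MvPolynomial σ K) :
    MvPolynomial.aeval ζ (MvPolynomial.aeval γ f) =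
      MvPolynomial.aeval (fun j => MvPolynomial.aeval ζ (γ j)) f := by
  rw [← AlgHom.comp_apply, MvPolynomial.comp_aeval]

theorem eval_aeval {τ : Type} (γ : σ → MvPolynomial τ K) (f : MvPolynomial σ K) (a : τ → K) :
    MvPolynomial.eval a (MvPolynomial.aeval γ f) =
      MvPolynomial.eval (fun j => MvPolynomial.eval a (γ j)) f := by
  induction f using MvPolynomial.induction_on with
  | C c => simp
  | add p q hp hq => simp only [map_add, hp, hq]
  | mul_X p i hp => simp only [map_mul, hp, MvPolynomial.aeval_X, MvPolynomial.eval_X]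

variable [Fintype σ]

/-- The derivative of polynomials in the direction of the vector `u`. -/
def dirDeriv : (σ → K) →ₗ[K] Derivation K (MvPolynomial σ K) (MvPolynomial σ K) :=
  ∑ k, (LinearMap.proj k).smulRight (MvPolynomial.pderiv k)

theorem dirDeriv_apply (u : σ → K) (f : MvPolynomial σ K) :
    dirDeriv u f = ∑ k, MvPolynomial.C (u k) * MvPolynomial.pderiv k f := by
  simp only [dirDeriv, LinearMap.sum_apply, LinearMap.smulRight_apply, LinearMap.proj_apply,
    MvPolynomial.C_mul']
  rw [← Derivation.coeFnAddMonoidHom_apply, map_sum, Finset.sum_apply]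
  rfl

theorem dirDeriv_single [DecidableEq σ] (k : σ) (f : MvPolynomial σ K) :
    dirDeriv (Pi.single k 1) f = MvPolynomial.pderiv k f := by
  rw [dirDeriv_apply, Finset.sum_eq_single k]
  · simp
  · intro b _ hb; simp [hb]
  · simp

theorem dirDeriv_comm (u v : σ → K) (f : MvPolynomial σ K) :
    dirDeriv u (dirDeriv v f) = dirDeriv v (dirDeriv u f) := by
  simp only [dirDeriv_apply, map_sum, MvPolynomial.pderiv_C_mul]
  rw [Finset.sum_comm]
  refine Finset.sum_congr rfl fun i _ => Finset.sum_congr rfl fun j _ => ?_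
  rw [pderiv_pderiv_comm]
  ring

theorem isHomogeneous_dirDeriv {f : MvPolynomial σ K} {d : ℕ} (hf : f.IsHomogeneous d)
    (u : σ → K) : (dirDeriv u f).IsHomogeneous (d - 1) := by
  rw [dirDeriv_apply]
  refine MvPolynomial.IsHomogeneous.sum _ _ _ fun k _ => ?_
  simpa using (MvPolynomial.isHomogeneous_C σ (u k)).mul hf.pderiv

/-- Euler's identity. -/
theorem eval_dirDeriv_self {f : MvPolynomial σ K} {d : ℕ} (hf : f.IsHomogeneous d) (x : σ → K) :
    MvPolynomial.eval x (dirDeriv x f) = d * MvPolynomial.eval x f := by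
  have h := congrArg (MvPolynomial.eval x) hf.sum_X_mul_pderiv
  rw [dirDeriv_apply, map_sum]
  simpa using h

/-- The chain rule. -/
theorem pderiv_aeval {τ : Type} (γ : σ → MvPolynomial τ K) (f : MvPolynomial σ K) (k : τ) :
    MvPolynomial.pderiv k (MvPolynomial.aeval γ f) =
      ∑ j, MvPolynomial.aeval γ (MvPolynomial.pderiv j f) * MvPolynomial.pderiv k (γ j) := by
  classical
  induction f using MvPolynomial.induction_on with
  | C c => simp
  | add p q hp hq => simp only [map_add, hp, hq, add_mul, Finset.sum_add_distrib]
  | mul_X p i hp =>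
    have h : ∀ j, MvPolynomial.aeval γ (MvPolynomial.pderiv j (p * MvPolynomial.X i)) *
        MvPolynomial.pderiv k (γ j) =
        MvPolynomial.aeval γ (MvPolynomial.pderiv j p) * MvPolynomial.pderiv k (γ j) * γ i +
        MvPolynomial.aeval γ p * (MvPolynomial.aeval γ (Pi.single (M := fun _ => MvPolynomial σ K)
          j 1 i) * MvPolynomial.pderiv k (γ j)) := by
      intro j
      rw [MvPolynomial.pderiv_mul, MvPolynomial.pderiv_X]
      simp only [map_add, map_mul, MvPolynomial.aeval_X]
      ring
    rw [Finset.sum_congr rfl fun j _ => h j, Finset.sum_add_distrib, ← Finset.sum_mul, ← hp,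
      ← Finset.mul_sum, Finset.sum_eq_single i]
    · simp only [map_mul, MvPolynomial.pderiv_mul, MvPolynomial.aeval_X, Pi.single_eq_same, map_one,
        one_mul]
    · intro j _ hj; simp [Ne.symm hj]
    · simp

end DirectionalDerivatives

/-! ### Double covers of affine space -/

section DoubleCover

variable {K : Type u} [Field K] {τ : Type}

/-- The equation `y ^ 2 - g` of the double cover of affine space branched over `g = 0`. -/
def doubleEquation (g : MvPolynomial τ K) : MvPolynomial (Option τ) K :=
  MvPolynomial.X none ^ 2 - MvPolynomial.rename some g

/-- The coordinate ring of the double cover of affine space branched over `g = 0`. -/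
abbrev DoubleRing (g : MvPolynomial τ K) : Type u :=
  MvPolynomial (Option τ) K ⧸ Ideal.span {doubleEquation g}

theorem pderiv_none_rename (g : MvPolynomial τ K) :
    MvPolynomial.pderiv (none : Option τ) (MvPolynomial.rename some g) = 0 := by
  apply MvPolynomial.pderiv_eq_zero_of_notMem_vars
  intro h
  classical
  have := MvPolynomial.vars_rename some g h
  simp at this

theorem pderiv_none_doubleEquation (g : MvPolynomial τ K) :
    MvPolynomial.pderiv none (doubleEquation g) = 2 * MvPolynomial.X none := by
  rw [doubleEquation, map_sub, pderiv_none_rename, sub_zero, MvPolynomial.pderiv_pow,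
    MvPolynomial.pderiv_X_self]
  simp

theorem pderiv_some_doubleEquation (g : MvPolynomial τ K) (k : τ) :
    MvPolynomial.pderiv (some k) (doubleEquation g) =
      - MvPolynomial.rename some (MvPolynomial.pderiv k g) := by
  rw [doubleEquation, map_sub, MvPolynomial.pderiv_rename (Option.some_injective τ),
    MvPolynomial.pderiv_pow, MvPolynomial.pderiv_X_of_ne (by simp)]
  simp

variable [CharZero K]

theorem mem_criticalPoints_doubleEquation {g : MvPolynomial τ K} {a : Option τ → K} :
    a ∈ criticalPoints (doubleEquation g) ↔ a none = 0 ∧ (a ∘ some) ∈ criticalPoints g := by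
  have h1 : MvPolynomial.eval a (doubleEquation g) = a none ^ 2 -
      MvPolynomial.eval (a ∘ some) g := by
    simp [doubleEquation, MvPolynomial.eval_rename]
  have h2 : MvPolynomial.eval a (MvPolynomial.pderiv none (doubleEquation g)) = 2 * a none := by
    rw [pderiv_none_doubleEquation]
    simp
  have h3 : ∀ k, MvPolynomial.eval a (MvPolynomial.pderiv (some k) (doubleEquation g)) =
      - MvPolynomial.eval (a ∘ some) (MvPolynomial.pderiv k g) := by
    intro k
    rw [pderiv_some_doubleEquation, map_neg, MvPolynomial.eval_rename]
  simp only [criticalPoints, Set.mem_ofPred_eq, Option.forall, h1, h2, h3]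
  constructor
  · rintro ⟨h, h', h''⟩
    have h0 : a none = 0 := by simpa using h'
    rw [h0] at h
    exact ⟨h0, by simpa using h, fun k => by simpa using h'' k⟩
  · rintro ⟨h0, h, h'⟩
    simp [h0, h, h']

/-- Passing to the double cover raises the ranks of the critical points by one. -/
theorem HasQuadraticCriticalPoints.doubleEquation {g : MvPolynomial τ K} {r : ℕ}
    (h : HasQuadraticCriticalPoints g r) :
    HasQuadraticCriticalPoints (doubleEquation g) (r + 1) := by
  refine ⟨?_, fun a ha => ?_⟩
  · refine Set.Finite.of_finite_image (f := fun a : Option τ → K => a ∘ some)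
      (h.1.subset ?_) ?_
    · rintro _ ⟨a, ha, rfl⟩
      exact (mem_criticalPoints_doubleEquation.1 ha).2
    · intro a ha b hb hab
      funext o
      cases o with
      | none => rw [(mem_criticalPoints_doubleEquation.1 ha).1,
          (mem_criticalPoints_doubleEquation.1 hb).1]
      | some k => exact congrFun hab k
  · obtain ⟨s, t, hst⟩ := h.2 _ (mem_criticalPoints_doubleEquation.1 ha).2
    refine ⟨Fin.cons none (some ∘ s), Fin.cons none (some ∘ t), ?_⟩
    rw [Matrix.det_succ_row_zero, Fin.sum_univ_succ, Finset.sum_eq_zero]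
    · have h1 : MvPolynomial.eval a (MvPolynomial.pderiv none
          (MvPolynomial.pderiv none (FanoDouble.doubleEquation g))) = 2 := by
        rw [pderiv_none_doubleEquation, ← map_ofNat MvPolynomial.C, MvPolynomial.pderiv_C_mul]
        simp
      have h2 : ((Matrix.of fun i j => MvPolynomial.eval a (MvPolynomial.pderiv
          ((Fin.cons none (some ∘ s) : Fin (r + 1) → Option τ) i) (MvPolynomial.pderiv
          ((Fin.cons none (some ∘ t) : Fin (r + 1) → Option τ) j)
            (FanoDouble.doubleEquation g)))).submatrix Fin.succ (Fin.succAbove 0)) =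
          -(Matrix.of fun i j => MvPolynomial.eval (a ∘ some)
            (MvPolynomial.pderiv (s i) (MvPolynomial.pderiv (t j) g))) := by
        ext i j
        simp only [Matrix.submatrix_apply, Matrix.of_apply, Fin.succAbove_zero, Fin.cons_succ,
          Function.comp_apply, Matrix.neg_apply]
        rw [pderiv_some_doubleEquation, map_neg,
          MvPolynomial.pderiv_rename (Option.some_injective τ), map_neg, MvPolynomial.eval_rename]
      rw [h2, Matrix.det_neg]
      simp only [Matrix.of_apply, Fin.cons_zero, h1]
      simpa using hst
    · intro j _
      simp only [Matrix.of_apply, Fin.cons_zero, Fin.cons_succ, Function.comp_apply]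
      rw [pderiv_some_doubleEquation, map_neg, pderiv_none_rename]
      simp

/-- A repeated factor of `y ^ 2 - g` divides its derivative `2 y`; but `y` divides `y ^ 2 - g`
only if `g = 0`. -/
theorem isRadical_doubleEquation {g : MvPolynomial τ K} (hg : g ≠ 0) :
    IsRadical (doubleEquation g) := by
  apply Squarefree.isRadical
  rintro q ⟨c, hc⟩
  have h2 : IsUnit (2 : MvPolynomial (Option τ) K) := by
    rw [← map_ofNat MvPolynomial.C]
    exact (IsUnit.mk0 (2 : K) two_ne_zero).map _
  -- `q` divides the derivative `2 y`
  have hq : q ∣ MvPolynomial.X none := by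
    have h := pderiv_none_doubleEquation g
    rw [hc, MvPolynomial.pderiv_mul, MvPolynomial.pderiv_mul] at h
    rw [← h2.dvd_mul_left, ← h]
    exact ⟨MvPolynomial.pderiv none q * c + MvPolynomial.pderiv none q * c +
      q * MvPolynomial.pderiv none c, by ring⟩
  have hX : Irreducible (MvPolynomial.X none : MvPolynomial (Option τ) K) :=
    (MvPolynomial.X_prime (i := none)).irreducible
  rcases (hX.dvd_iff.1 hq) with h | h
  · exact h
  · exfalso
    have h3 : MvPolynomial.X none ∣ MvPolynomial.rename some g := by
      have h4 : MvPolynomial.X none ∣ doubleEquation g := by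
        rw [hc, mul_assoc]
        exact h.dvd.mul_right _
      have h5 := dvd_sub (Dvd.intro_left (MvPolynomial.X none) rfl :
        (MvPolynomial.X none : MvPolynomial (Option τ) K) ∣ MvPolynomial.X none *
          MvPolynomial.X none) h4
      rwa [doubleEquation, ← pow_two, sub_sub_cancel] at h5
    obtain ⟨p, hp⟩ := h3
    have h6 := congrArg (MvPolynomial.aeval (fun o : Option τ =>
      o.elim (0 : MvPolynomial τ K) MvPolynomial.X)) hp
    rw [MvPolynomial.aeval_rename, map_mul, MvPolynomial.aeval_X] at h6
    apply hg
    have h7 : ((fun o : Option τ => o.elim (0 : MvPolynomial τ K) MvPolynomial.X) ∘ some) =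
      MvPolynomial.X := rfl
    rw [h7, MvPolynomial.aeval_X_left_apply] at h6
    simpa using h6

/-- A variable of the base is a non-zero-divisor on a double cover. -/
theorem X_some_mem_nonZeroDivisors (g : MvPolynomial τ K) (k : τ) :
    (Ideal.Quotient.mk (Ideal.span {doubleEquation g}) (MvPolynomial.X (some k))) ∈
      nonZeroDivisors (DoubleRing g) := by
  rw [mem_nonZeroDivisors_iff_right]
  intro x hx
  obtain ⟨p, rfl⟩ := Ideal.Quotient.mk_surjective x
  rw [← map_mul, Ideal.Quotient.eq_zero_iff_dvd] at hx
  rw [Ideal.Quotient.eq_zero_iff_dvd]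
  obtain ⟨q, hq⟩ := hx
  have hX : Prime (MvPolynomial.X (some k) : MvPolynomial (Option τ) K) := MvPolynomial.X_prime
  have h1 : MvPolynomial.X (some k) ∣ doubleEquation g * q := ⟨p, by rw [← hq, mul_comm]⟩
  rcases hX.dvd_or_dvd h1 with h | ⟨q', rfl⟩
  · exfalso
    obtain ⟨c, hc⟩ := h
    have h2 := congrArg (fun z => MvPolynomial.pderiv none (MvPolynomial.pderiv none z)) hc
    simp only [pderiv_none_doubleEquation, MvPolynomial.pderiv_mul,
      MvPolynomial.pderiv_X_of_ne (show some k ≠ none by simp), zero_mul, zero_add] at h2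
    have h3 := congrArg (MvPolynomial.eval (0 : Option τ → K)) h2
    rw [← map_ofNat MvPolynomial.C, MvPolynomial.pderiv_C] at h3
    simp at h3
  · refine ⟨q', ?_⟩
    refine mul_right_cancel₀ hX.ne_zero (hq.trans ?_)
    ring

end DoubleCover

/-! ### Coordinates on the double space -/

section ChartRing

variable {K : Type u} [Field K] {n : ℕ}

/-- The homomorphism from the chart ring given by the values of the coordinates. -/
def chartLift (f : MvPolynomial (Fin n) K) (i : Fin n) {Λ : Type u} [CommRing Λ] [Algebra K Λ]
    (ξ : Fin n → Λ) (η : Λ) (hi : ξ i = 1) (hη : η ^ 2 = MvPolynomial.aeval ξ f) :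
    ChartRing f i →ₐ[K] Λ :=
  Ideal.Quotient.liftₐ (chartIdeal f i)
    (MvPolynomial.aeval fun o : Option (Fin n) => o.elim η ξ) (by
      intro p hp
      rw [← AlgHom.coe_toRingHom, ← RingHom.mem_ker]
      refine (Ideal.span_le.2 ?_ : chartIdeal f i ≤ _) hp
      rintro _ (rfl | rfl)
      · simp [RingHom.mem_ker, hi]
      · simp only [SetLike.mem_coe, RingHom.mem_ker, AlgHom.coe_toRingHom, map_sub, map_pow,
          MvPolynomial.aeval_X, MvPolynomial.aeval_rename, Option.elim_none, hη]
        exact sub_self _)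

/-- The coordinate `x_j` as an element of the chart ring. -/
def chartX (f : MvPolynomial (Fin n) K) (i j : Fin n) : ChartRing f i :=
  Ideal.Quotient.mk (chartIdeal f i) (MvPolynomial.X (some j))

/-- The coordinate `y` as an element of the chart ring. -/
def chartY (f : MvPolynomial (Fin n) K) (i : Fin n) : ChartRing f i :=
  Ideal.Quotient.mk (chartIdeal f i) (MvPolynomial.X none)

variable (f : MvPolynomial (Fin n) K) (i : Fin n)

theorem chartX_self : chartX f i i = 1 := by
  rw [chartX, ← map_one (Ideal.Quotient.mk (chartIdeal f i)), Ideal.Quotient.eq]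
  exact Ideal.subset_span (by simp)

theorem chartY_sq : chartY f i ^ 2 = MvPolynomial.aeval (chartX f i) f := by
  have h1 : Ideal.Quotient.mkₐ K (chartIdeal f i) (MvPolynomial.rename some f) =
      MvPolynomial.aeval (chartX f i) f := by
    rw [← AlgHom.comp_apply]
    congr 1
    ext j : 1
    simp [chartX]
  rw [← h1, chartY, ← map_pow]
  refine (Ideal.Quotient.eq).2 (Ideal.subset_span (by simp))

section

variable {Λ : Type u} [CommRing Λ] [Algebra K Λ]

@[simp] theorem chartLift_chartX (ξ : Fin n → Λ) (η : Λ) (hi : ξ i = 1)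
    (hη : η ^ 2 = MvPolynomial.aeval ξ f) (j : Fin n) :
    chartLift f i ξ η hi hη (chartX f i j) = ξ j := by
  have : chartLift f i ξ η hi hη (chartX f i j) =
      MvPolynomial.aeval (fun o : Option (Fin n) => o.elim η ξ) (MvPolynomial.X (some j)) := rfl
  simpa using this

@[simp] theorem chartLift_chartY (ξ : Fin n → Λ) (η : Λ) (hi : ξ i = 1)
    (hη : η ^ 2 = MvPolynomial.aeval ξ f) :
    chartLift f i ξ η hi hη (chartY f i) = η := by
  have : chartLift f i ξ η hi hη (chartY f i) =
      MvPolynomial.aeval (fun o : Option (Fin n) => o.elim η ξ) (MvPolynomial.X none) := rfl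
  simpa using this

variable {f i} in
theorem chartRing_algHom_ext {φ ψ : ChartRing f i →ₐ[K] Λ}
    (h : ∀ j, φ (chartX f i j) = ψ (chartX f i j)) (h' : φ (chartY f i) = ψ (chartY f i)) :
    φ = ψ := by
  apply Ideal.Quotient.algHom_ext
  ext o : 1
  cases o with
  | none => exact h'
  | some j => exact h j

end

end ChartRing

section DoubleRing

variable {K : Type u} [Field K] {τ : Type} (g : MvPolynomial τ K)

/-- The coordinate `x_k` on the double cover. -/
def doubleX (k : τ) : DoubleRing g :=
  Ideal.Quotient.mk (Ideal.span {doubleEquation g}) (MvPolynomial.X (some k))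

/-- The coordinate `y` on the double cover. -/
def doubleY : DoubleRing g :=
  Ideal.Quotient.mk (Ideal.span {doubleEquation g}) (MvPolynomial.X none)

theorem doubleY_sq : doubleY g ^ 2 = MvPolynomial.aeval (doubleX g) g := by
  have h1 : Ideal.Quotient.mkₐ K (Ideal.span {doubleEquation g}) (MvPolynomial.rename some g) =
      MvPolynomial.aeval (doubleX g) g := by
    rw [← AlgHom.comp_apply]
    congr 1
    ext j : 1
    simp [doubleX]
  rw [← h1, doubleY, ← map_pow]
  exact (Ideal.Quotient.eq).2 (Ideal.subset_span (by simp [doubleEquation]))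

variable {Λ : Type u} [CommRing Λ] [Algebra K Λ]

/-- The homomorphism from the ring of a double cover given by the values of the coordinates. -/
def doubleLift (ξ : τ → Λ) (η : Λ) (hη : η ^ 2 = MvPolynomial.aeval ξ g) :
    DoubleRing g →ₐ[K] Λ :=
  Ideal.Quotient.liftₐ (Ideal.span {doubleEquation g})
    (MvPolynomial.aeval fun o : Option τ => o.elim η ξ) (by
      intro p hp
      rw [← AlgHom.coe_toRingHom, ← RingHom.mem_ker]
      refine (Ideal.span_le.2 ?_ : Ideal.span {doubleEquation g} ≤ _) hp
      rintro _ rfl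
      simp only [SetLike.mem_coe, RingHom.mem_ker, AlgHom.coe_toRingHom, doubleEquation, map_sub,
        map_pow, MvPolynomial.aeval_X, MvPolynomial.aeval_rename, Option.elim_none, hη]
      exact sub_self _)

@[simp] theorem doubleLift_doubleX (ξ : τ → Λ) (η : Λ)
    (hη : η ^ 2 = MvPolynomial.aeval ξ g) (j : τ) :
    doubleLift g ξ η hη (doubleX g j) = ξ j := by
  have : doubleLift g ξ η hη (doubleX g j) =
      MvPolynomial.aeval (fun o : Option τ => o.elim η ξ) (MvPolynomial.X (some j)) := rfl
  simpa using this

@[simp] theorem doubleLift_doubleY (ξ : τ → Λ) (η : Λ)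
    (hη : η ^ 2 = MvPolynomial.aeval ξ g) :
    doubleLift g ξ η hη (doubleY g) = η := by
  have : doubleLift g ξ η hη (doubleY g) =
      MvPolynomial.aeval (fun o : Option τ => o.elim η ξ) (MvPolynomial.X none) := rfl
  simpa using this

end DoubleRing

section AdaptedBasis

variable {K : Type u} [Field K] {n : ℕ}

/-- A basis of `Kⁿ` adapted to the affine chart `x_i = 1` and the linear subspace `P`: the first
vector lies on `x_i = 1` and all the others lie on `x_i = 0`; the first vector and those indexed by
`τ` span `P`. -/
structure AdaptedBasis (P : Submodule K (Fin n → K)) (i : Fin n) (τ ε : Type) where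
  /-- the underlying basis -/
  basis : Module.Basis (Unit ⊕ (τ ⊕ ε)) K (Fin n → K)
  repr_base : ∀ x, basis.repr x (Sum.inl ()) = x i
  mem_iff : ∀ x, x ∈ P ↔ ∀ e, basis.repr x (Sum.inr (Sum.inr e)) = 0

namespace AdaptedBasis

variable {P : Submodule K (Fin n → K)} {i : Fin n} {τ ε : Type} (b : AdaptedBasis P i τ ε)

/-- The point of the affine chart `x_i = 1` of `P` which serves as origin. -/
def origin : Fin n → K := b.basis (Sum.inl ())

/-- The directions of the affine chart of `P`. -/
def dir (k : τ) : Fin n → K := b.basis (Sum.inr (Sum.inl k))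

/-- The directions transversal to `P`. -/
def trans (e : ε) : Fin n → K := b.basis (Sum.inr (Sum.inr e))

/-- The value of a coordinate function at the point `ξ` with values in a `K`-algebra. -/
def coord {Λ : Type u} [CommRing Λ] [Algebra K Λ] (ξ : Fin n → Λ) (o : Unit ⊕ (τ ⊕ ε)) : Λ :=
  ∑ j, algebraMap K Λ (b.basis.repr (Pi.single j 1) o) * ξ j

theorem coord_algebraMap {Λ : Type u} [CommRing Λ] [Algebra K Λ] (x : Fin n → K)
    (o : Unit ⊕ (τ ⊕ ε)) :
    b.coord (fun j => algebraMap K Λ (x j)) o = algebraMap K Λ (b.basis.repr x o) := by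
  have hx : x = ∑ j, x j • (Pi.single j 1 : Fin n → K) := by
    funext k
    simp [Finset.sum_apply, Pi.single_apply]
  conv_rhs => rw [hx]
  simp only [coord, map_sum, map_smul, Finsupp.coe_finsetSum, Finset.sum_apply, Finsupp.smul_apply,
    smul_eq_mul, map_mul]
  exact Finset.sum_congr rfl fun j _ => mul_comm _ _

theorem coord_base {Λ : Type u} [CommRing Λ] [Algebra K Λ] (ξ : Fin n → Λ) :
    b.coord ξ (Sum.inl ()) = ξ i := by
  simp only [coord, b.repr_base]
  rw [Finset.sum_eq_single i]
  · simp
  · intro j _ hj; simp [Ne.symm hj]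
  · simp

theorem map_coord {Λ Λ' : Type u} [CommRing Λ] [Algebra K Λ] [CommRing Λ'] [Algebra K Λ']
    (φ : Λ →ₐ[K] Λ') (ξ : Fin n → Λ) (o : Unit ⊕ (τ ⊕ ε)) :
    φ (b.coord ξ o) = b.coord (fun j => φ (ξ j)) o := by
  simp [coord]

theorem origin_apply : b.origin i = 1 := by
  rw [← b.repr_base (b.origin), origin]; simp

theorem dir_apply (k : τ) : b.dir k i = 0 := by
  rw [← b.repr_base (b.dir k), dir]; simp

theorem trans_apply (e : ε) : b.trans e i = 0 := by
  rw [← b.repr_base (b.trans e), trans]; simp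

theorem origin_mem : b.origin ∈ P := by
  rw [b.mem_iff, origin]; simp

theorem dir_mem (k : τ) : b.dir k ∈ P := by
  rw [b.mem_iff, dir]; simp

variable [Fintype τ] [Fintype ε]

theorem sum_coord {Λ : Type u} [CommRing Λ] [Algebra K Λ] (ξ : Fin n → Λ) (j : Fin n) :
    ∑ o, b.coord ξ o * algebraMap K Λ (b.basis o j) = ξ j := by
  simp only [coord, Finset.sum_mul]
  rw [Finset.sum_comm]
  have h : ∀ l, ∑ o, b.basis.repr (Pi.single l 1) o * b.basis o j =
      (Pi.single l 1 : Fin n → K) j := by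
    intro l
    conv_rhs => rw [← b.basis.sum_repr (Pi.single l 1)]
    simp [Finset.sum_apply]
  have h2 : ∀ l, ∑ o, algebraMap K Λ (b.basis.repr (Pi.single l 1) o) * ξ l *
      algebraMap K Λ (b.basis o j) = algebraMap K Λ ((Pi.single l 1 : Fin n → K) j) * ξ l := by
    intro l
    rw [← h, map_sum, Finset.sum_mul]
    refine Finset.sum_congr rfl fun o _ => ?_
    rw [map_mul]; ring
  rw [Finset.sum_congr rfl fun l _ => h2 l, Finset.sum_eq_single j]
  · simp
  · intro l _ hl; simp [Ne.symm hl]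
  · simp

theorem sum_coord' {Λ : Type u} [CommRing Λ] [Algebra K Λ] (ξ : Fin n → Λ) (j : Fin n) :
    ξ j = ξ i * algebraMap K Λ (b.origin j)
      + (∑ k, b.coord ξ (Sum.inr (Sum.inl k)) * algebraMap K Λ (b.dir k j)
      + ∑ e, b.coord ξ (Sum.inr (Sum.inr e)) * algebraMap K Λ (b.trans e j)) := by
  conv_lhs => rw [← b.sum_coord ξ j, Fintype.sum_sum_type, Fintype.sum_sum_type]
  simp [b.coord_base, origin, dir, trans]

/-- The ideal of the chart ring generated by the linear forms that vanish on `P`. -/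
def linearIdeal (f : MvPolynomial (Fin n) K) (P : Submodule K (Fin n → K)) (i : Fin n) :
    Ideal (ChartRing f i) :=
  Ideal.span {l : ChartRing f i | ∃ a : Fin n → K, (∀ v ∈ P, ∑ j, a j * v j = 0) ∧
    l = Ideal.Quotient.mk (chartIdeal f i)
      (∑ j, MvPolynomial.C (a j) * MvPolynomial.X (some j))}

theorem preimageIdeal_eq (f : MvPolynomial (Fin n) K) (P : Submodule K (Fin n → K)) (i : Fin n) :
    preimageIdeal f P i = (linearIdeal f P i).radical := rfl

/-- The linear forms vanishing on `P` are generated by the coordinates transversal to `P`. -/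
theorem linearIdeal_eq_span (f : MvPolynomial (Fin n) K) : linearIdeal f P i =
    Ideal.span (Set.range fun e => b.coord (chartX f i) (Sum.inr (Sum.inr e))) := by
  have hmk : ∀ a : Fin n → K, Ideal.Quotient.mk (chartIdeal f i)
      (∑ j, MvPolynomial.C (a j) * MvPolynomial.X (some j)) =
      ∑ j, algebraMap K (ChartRing f i) (a j) * chartX f i j := by
    intro a
    rw [map_sum]
    exact Finset.sum_congr rfl fun j _ => map_mul _ _ _
  apply le_antisymm
  · rw [linearIdeal, Ideal.span_le]
    rintro _ ⟨a, ha, rfl⟩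
    rw [hmk]
    have h : ∑ j, algebraMap K (ChartRing f i) (a j) * chartX f i j =
        ∑ e, algebraMap K (ChartRing f i) (∑ j, a j * b.trans e j) *
          b.coord (chartX f i) (Sum.inr (Sum.inr e)) := by
      have h1 : ∑ j, algebraMap K (ChartRing f i) (a j) * chartX f i j =
          ∑ o, algebraMap K (ChartRing f i) (∑ j, a j * b.basis o j) * b.coord (chartX f i) o := by
        simp only [map_sum, map_mul, Finset.sum_mul]
        rw [Finset.sum_comm]
        refine Finset.sum_congr rfl fun j _ => ?_
        conv_lhs => rw [← b.sum_coord (chartX f i) j]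
        rw [Finset.mul_sum]
        refine Finset.sum_congr rfl fun o _ => ?_
        ring
      rw [h1, Fintype.sum_sum_type, Fintype.sum_sum_type]
      have h2 := ha _ b.origin_mem
      have h3 := fun k => ha _ (b.dir_mem k)
      simp only [origin] at h2
      simp only [dir] at h3
      simp [h2, h3, trans]
    rw [h]
    exact sum_mem fun e _ => Ideal.mul_mem_left _ _ (Ideal.subset_span ⟨e, rfl⟩)
  · rw [Ideal.span_le]
    rintro _ ⟨e, rfl⟩
    refine Ideal.subset_span ⟨fun j => b.basis.repr (Pi.single j 1) (Sum.inr (Sum.inr e)),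
      fun v hv => ?_, ?_⟩
    · have h1 := (b.mem_iff v).1 hv e
      have h2 := b.coord_algebraMap (Λ := K) v (Sum.inr (Sum.inr e))
      simpa [coord, h1] using h2
    · rw [hmk]
      rfl

end AdaptedBasis

end AdaptedBasis

/-! ### Charts of preimages and blow ups as double covers -/

theorem mul_mem_pow_add {A : Type u} [CommRing A] {I : Ideal A} {a b : A} {k m : ℕ}
    (ha : a ∈ I ^ k) (hb : b ∈ I ^ m) : a * b ∈ I ^ (k + m) := by
  rw [pow_add]
  exact Ideal.mul_mem_mul ha hb

/-- A criterion for an ideal to be radical by a description of the quotient ring. -/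
theorem isRadical_of_forall_ringEquiv {A D : Type u} [CommRing A] [CommRing D] (hD : IsReduced D)
    {J : Ideal A} (h : ∀ {Λ : Type u} [CommRing Λ] (π : A →+* Λ), Function.Surjective π →
      (∀ x, π x = 0 ↔ x ∈ J) → Nonempty (D ≃+* Λ)) : J.IsRadical := by
  obtain ⟨e⟩ := h (Ideal.Quotient.mk J) Ideal.Quotient.mk_surjective
    fun _ => Ideal.Quotient.eq_zero_iff_mem
  rw [Ideal.isRadical_iff_quotient_reduced]
  refine ⟨fun x hx => ?_⟩
  have h2 : e.symm x = 0 := hD.eq_zero _ (hx.map e.symm)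
  rw [← e.apply_symm_apply x, h2, map_zero]

theorem IsQuadraticHypersurfaceRing.quotient {K : Type u} [Field K] {A D : Type u} [CommRing A]
    [CommRing D] {r : ℕ} (hD : IsQuadraticHypersurfaceRing K D r) {J : Ideal A}
    (h : ∀ {Λ : Type u} [CommRing Λ] (π : A →+* Λ), Function.Surjective π →
      (∀ x, π x = 0 ↔ x ∈ J) → Nonempty (D ≃+* Λ)) :
    IsQuadraticHypersurfaceRing K (A ⧸ J) r := by
  obtain ⟨e⟩ := h (Ideal.Quotient.mk J) Ideal.Quotient.mk_surjective
    fun _ => Ideal.Quotient.eq_zero_iff_mem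
  exact hD.of_ringEquiv K e

namespace AdaptedBasis

variable {K : Type u} [Field K] {n : ℕ} {P : Submodule K (Fin n → K)} {i : Fin n}
  {τ ε : Type} [Fintype τ]

section Slice

variable (b : AdaptedBasis P i τ ε)

/-- The parametrization of the affine chart `x_i = 1` of `P`. -/
def slice (j : Fin n) : MvPolynomial τ K :=
  MvPolynomial.C (b.origin j) + ∑ k, MvPolynomial.C (b.dir k j) * MvPolynomial.X k

theorem aeval_slice {Λ : Type u} [CommRing Λ] [Algebra K Λ] (ζ : τ → Λ) (j : Fin n) :
    MvPolynomial.aeval ζ (b.slice j) = algebraMap K Λ (b.origin j) +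
      ∑ k, ζ k * algebraMap K Λ (b.dir k j) := by
  simp only [slice, map_add, map_sum, map_mul, MvPolynomial.aeval_C, MvPolynomial.aeval_X]
  simp only [mul_comm]

theorem coord_slice {Λ : Type u} [CommRing Λ] [Algebra K Λ] (ζ : τ → Λ) (o : Unit ⊕ (τ ⊕ ε)) :
    b.coord (fun j => algebraMap K Λ (b.origin j) + ∑ k, ζ k * algebraMap K Λ (b.dir k j)) o =
      algebraMap K Λ (b.basis.repr b.origin o) +
        ∑ k, ζ k * algebraMap K Λ (b.basis.repr (b.dir k) o) := by
  simp only [← b.coord_algebraMap]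
  simp only [coord, mul_add, Finset.sum_add_distrib, Finset.mul_sum]
  congr 1
  rw [Finset.sum_comm]
  refine Finset.sum_congr rfl fun k _ => Finset.sum_congr rfl fun j _ => ?_
  ring

variable [Fintype ε]

/-- The affine chart of `σ⁻¹(P)` is a double cover of affine space. -/
theorem nonempty_equiv_of_ker_eq_linearIdeal (f : MvPolynomial (Fin n) K) {Λ : Type u}
    [CommRing Λ] [Algebra K Λ] (π : ChartRing f i →ₐ[K] Λ) (hπ : Function.Surjective π)
    (hker : ∀ x, π x = 0 ↔ x ∈ linearIdeal f P i) :
    Nonempty (DoubleRing (MvPolynomial.aeval b.slice f) ≃ₐ[K] Λ) := by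
  classical
  set g := MvPolynomial.aeval b.slice f with hg
  let ξ : Fin n → DoubleRing g := fun j => MvPolynomial.aeval (doubleX g) (b.slice j)
  have hξ : ∀ j, ξ j = algebraMap K (DoubleRing g) (b.origin j) +
      ∑ k, doubleX g k * algebraMap K (DoubleRing g) (b.dir k j) := fun j => b.aeval_slice _ j
  have hξi : ξ i = 1 := by
    rw [hξ]; simp [b.origin_apply, b.dir_apply]
  have hηf : doubleY g ^ 2 = MvPolynomial.aeval ξ f :=
    (doubleY_sq g).trans (aeval_aeval _ _ _)
  let Φ : ChartRing f i →ₐ[K] DoubleRing g := chartLift f i ξ (doubleY g) hξi hηf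
  have hΦX : ∀ j, Φ (chartX f i j) = ξ j := fun j => chartLift_chartX ..
  have hΦY : Φ (chartY f i) = doubleY g := chartLift_chartY ..
  have hcoord : ∀ o, Φ (b.coord (chartX f i) o) =
      algebraMap K (DoubleRing g) (b.basis.repr b.origin o) +
        ∑ k, doubleX g k * algebraMap K (DoubleRing g) (b.basis.repr (b.dir k) o) := by
    intro o
    rw [b.map_coord, ← b.coord_slice]
    congr 1
    funext j
    rw [← hξ, hΦX]
  have hΦ : ∀ x ∈ linearIdeal f P i, Φ x = 0 := by
    intro x hx
    rw [← AlgHom.coe_toRingHom, ← RingHom.mem_ker]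
    refine (?_ : linearIdeal f P i ≤ _) hx
    rw [b.linearIdeal_eq_span, Ideal.span_le]
    rintro _ ⟨e, rfl⟩
    rw [SetLike.mem_coe, RingHom.mem_ker, AlgHom.coe_toRingHom, hcoord]
    simp [origin, dir]
  have hΦτ : ∀ k, Φ (b.coord (chartX f i) (Sum.inr (Sum.inl k))) = doubleX g k := by
    intro k
    rw [hcoord, Finset.sum_eq_single k]
    · simp [origin, dir]
    · intro l _ hl
      simp [dir, hl]
    · simp
  have hΦsurj : Function.Surjective Φ := by
    intro p
    obtain ⟨p, rfl⟩ := Ideal.Quotient.mk_surjective p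
    induction p using MvPolynomial.induction_on with
    | C a => exact ⟨algebraMap K _ a, Φ.commutes a⟩
    | add p q hp hq =>
      obtain ⟨x, hx⟩ := hp
      obtain ⟨y, hy⟩ := hq
      exact ⟨x + y, by rw [map_add, map_add, hx, hy]⟩
    | mul_X p o hp =>
      obtain ⟨x, hx⟩ := hp
      rw [map_mul, ← hx]
      cases o with
      | none => exact ⟨x * chartY f i, by rw [map_mul, hΦY]; rfl⟩
      | some k => exact ⟨x * b.coord (chartX f i) (Sum.inr (Sum.inl k)), by rw [map_mul, hΦτ]; rfl⟩
  let ζ : τ → Λ := fun k => π (b.coord (chartX f i) (Sum.inr (Sum.inl k)))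
  have hζ : ∀ j, MvPolynomial.aeval ζ (b.slice j) = π (chartX f i j) := by
    intro j
    rw [b.aeval_slice, b.sum_coord' (chartX f i) j, chartX_self, one_mul, map_add, map_add, map_sum,
      map_sum, AlgHom.commutes]
    have h0 : ∀ e, π (b.coord (chartX f i) (Sum.inr (Sum.inr e))) = 0 := fun e =>
      (hker _).2 (b.linearIdeal_eq_span f ▸ Ideal.subset_span ⟨e, rfl⟩)
    simp [h0, ζ]
  let Ψ : DoubleRing g →ₐ[K] Λ := doubleLift g ζ (π (chartY f i)) (by
    rw [← map_pow, chartY_sq, hg, aeval_aeval, ← AlgHom.comp_apply, MvPolynomial.comp_aeval]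
    congr 2
    funext j
    exact (hζ j).symm)
  have hΨΦ : Ψ.comp Φ = π := by
    apply chartRing_algHom_ext
    · intro j
      rw [AlgHom.comp_apply, hΦX, ← hζ]
      simp only [ξ]
      rw [← AlgHom.comp_apply, MvPolynomial.comp_aeval]
      congr 2
      funext k
      exact doubleLift_doubleX ..
    · rw [AlgHom.comp_apply, hΦY]
      exact doubleLift_doubleY ..
  refine ⟨AlgEquiv.ofBijective Ψ ⟨?_, ?_⟩⟩
  · rw [injective_iff_map_eq_zero]
    intro p hp
    obtain ⟨x, rfl⟩ := hΦsurj p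
    rw [← AlgHom.comp_apply, hΨΦ, hker] at hp
    exact hΦ x hp
  · intro z
    obtain ⟨x, rfl⟩ := hπ z
    exact ⟨Φ x, by rw [← AlgHom.comp_apply, hΨΦ]⟩

theorem nonempty_ringEquiv_of_ker_eq_linearIdeal (f : MvPolynomial (Fin n) K) {Λ : Type u}
    [CommRing Λ] (π : ChartRing f i →+* Λ) (hπ : Function.Surjective π)
    (hker : ∀ x, π x = 0 ↔ x ∈ linearIdeal f P i) :
    Nonempty (DoubleRing (MvPolynomial.aeval b.slice f) ≃+* Λ) := by
  let _ : Algebra K Λ := (π.comp (algebraMap K (ChartRing f i))).toAlgebra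
  let π' : ChartRing f i →ₐ[K] Λ := { π with commutes' := fun _ => rfl }
  obtain ⟨e⟩ := b.nonempty_equiv_of_ker_eq_linearIdeal f π' hπ hker
  exact ⟨e.toRingEquiv⟩

/-- The linear equations of `P` define `σ⁻¹(P)` with its reduced structure, because the double cover
of the affine chart of `P` is reduced when `f` does not vanish identically on it. -/
theorem preimageIdeal_eq_linearIdeal [CharZero K] (f : MvPolynomial (Fin n) K)
    (hf : MvPolynomial.aeval b.slice f ≠ 0) : preimageIdeal f P i = linearIdeal f P i := by
  rw [preimageIdeal_eq]
  have h1 := isRadical_doubleEquation hf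
  rw [isRadical_iff_span_singleton, Ideal.isRadical_iff_quotient_reduced] at h1
  exact (isRadical_of_forall_ringEquiv h1 fun π hπ hker =>
    b.nonempty_ringEquiv_of_ker_eq_linearIdeal f π hπ hker).radical

end Slice

section BlowUpSlice

variable (b : AdaptedBasis P i τ (Fin 2))

/-- The parametrization of a chart of the blow up of the affine chart `x_i = 1` along `P`; the
variables are the affine parameters of `P`, the equation `u = X none` of the exceptional divisor,
and the fibre coordinate `t = X (some none)`. -/
def blowSlice (j : Fin n) : MvPolynomial (Option (Option τ)) K :=
  MvPolynomial.C (b.origin j) +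
    (∑ k, MvPolynomial.C (b.dir k j) * MvPolynomial.X (some (some k)) +
      (MvPolynomial.C (b.trans 0 j) * MvPolynomial.X none +
        MvPolynomial.C (b.trans 1 j) * (MvPolynomial.X none * MvPolynomial.X (some none))))

theorem aeval_blowSlice {Λ : Type u} [CommRing Λ] [Algebra K Λ] (ζ : Option (Option τ) → Λ)
    (j : Fin n) : MvPolynomial.aeval ζ (b.blowSlice j) = algebraMap K Λ (b.origin j) +
      (∑ k, ζ (some (some k)) * algebraMap K Λ (b.dir k j) +
        (ζ none * algebraMap K Λ (b.trans 0 j) +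
        (ζ none * ζ (some none)) * algebraMap K Λ (b.trans 1 j))) := by
  simp only [blowSlice, map_add, map_sum, map_mul, MvPolynomial.aeval_C, MvPolynomial.aeval_X]
  simp only [mul_comm]

theorem coord_blowSlice {Λ : Type u} [CommRing Λ] [Algebra K Λ] (ζ : Option (Option τ) → Λ)
    (o : Unit ⊕ (τ ⊕ Fin 2)) :
    b.coord (fun j => MvPolynomial.aeval ζ (b.blowSlice j)) o =
      algebraMap K Λ (b.basis.repr b.origin o) +
      (∑ k, ζ (some (some k)) * algebraMap K Λ (b.basis.repr (b.dir k) o) +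
        (ζ none * algebraMap K Λ (b.basis.repr (b.trans 0) o) +
        (ζ none * ζ (some none)) * algebraMap K Λ (b.basis.repr (b.trans 1) o))) := by
  simp only [aeval_blowSlice, ← b.coord_algebraMap]
  simp only [coord, mul_add, Finset.sum_add_distrib, Finset.mul_sum]
  congr 1
  rw [Finset.sum_comm]
  congr 1
  · refine Finset.sum_congr rfl fun k _ => Finset.sum_congr rfl fun j _ => ?_
    ring
  · congr 1 <;> exact Finset.sum_congr rfl fun j _ => by ring

/-- The chart `D₊(l t)` of the blow up along `σ⁻¹(P)`, where `l` is the first of the two linear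
equations of `P`, is a double cover of affine space. -/
theorem nonempty_away_equiv [CharZero K] (f : MvPolynomial (Fin n) K) (I : Ideal (ChartRing f i))
    (hI : I = linearIdeal f P i) (hmem : b.coord (chartX f i) (Sum.inr (Sum.inr 0)) ∈ I) :
    Nonempty (HomogeneousLocalization.Away (reesGrading I) (reesOfMem I hmem) ≃+*
      DoubleRing (MvPolynomial.aeval b.blowSlice f)) := by
  classical
  set g := MvPolynomial.aeval b.blowSlice f with hg
  set l₀ := b.coord (chartX f i) (Sum.inr (Sum.inr 0)) with hl₀
  set l₁ := b.coord (chartX f i) (Sum.inr (Sum.inr 1)) with hl₁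
  let ξ : Fin n → DoubleRing g := fun j => MvPolynomial.aeval (doubleX g) (b.blowSlice j)
  have hξi : ξ i = 1 := by
    simp only [ξ]
    rw [aeval_blowSlice]; simp [b.origin_apply, b.dir_apply, b.trans_apply]
  have hηf : doubleY g ^ 2 = MvPolynomial.aeval ξ f :=
    (doubleY_sq g).trans (aeval_aeval _ _ _)
  let Φ : ChartRing f i →ₐ[K] DoubleRing g := chartLift f i ξ (doubleY g) hξi hηf
  have hΦX : ∀ j, Φ (chartX f i j) = ξ j := fun j => chartLift_chartX ..
  have hΦY : Φ (chartY f i) = doubleY g := chartLift_chartY ..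
  have hcoord : ∀ o, Φ (b.coord (chartX f i) o) =
      algebraMap K (DoubleRing g) (b.basis.repr b.origin o) +
      (∑ k, doubleX g (some (some k)) * algebraMap K (DoubleRing g) (b.basis.repr (b.dir k) o) +
        (doubleX g none * algebraMap K (DoubleRing g) (b.basis.repr (b.trans 0) o) +
        (doubleX g none * doubleX g (some none)) *
          algebraMap K (DoubleRing g) (b.basis.repr (b.trans 1) o))) := by
    intro o
    rw [b.map_coord, ← b.coord_blowSlice]
    simp only [hΦX, ξ]
  have hΦ₀ : Φ l₀ = doubleX g none := by
    rw [hl₀, hcoord]; simp [origin, dir, trans]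
  have hΦ₁ : Φ l₁ = doubleX g none * doubleX g (some none) := by
    rw [hl₁, hcoord]; simp [origin, dir, trans]
  have hΦτ : ∀ k, Φ (b.coord (chartX f i) (Sum.inr (Sum.inl k))) = doubleX g (some (some k)) := by
    intro k
    rw [hcoord, Finset.sum_eq_single k]
    · simp [origin, dir, trans]
    · intro l _ hl; simp [dir, hl]
    · simp
  have hspan : I = Ideal.span {l₀, l₁} := by
    rw [hI, b.linearIdeal_eq_span]
    congr 1
    ext x
    simp [Fin.exists_fin_two, hl₀, hl₁, eq_comm]
  have hl₁mem : l₁ ∈ I := hspan ▸ Ideal.subset_span (by simp)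
  -- the inverse of the homomorphism `Φ` after inverting `l₀`
  let L := Localization.Away l₀
  let v : L := IsLocalization.Away.invSelf l₀
  have hv : algebraMap (ChartRing f i) L l₀ * v = 1 := IsLocalization.Away.mul_invSelf l₀
  let ι : ChartRing f i →ₐ[K] L := IsScalarTower.toAlgHom K (ChartRing f i) L
  have hι : ∀ x, ι x = algebraMap _ _ x := fun x => rfl
  let ζ : Option (Option τ) → L := fun o => o.elim (ι l₀) (fun o' => o'.elim (ι l₁ * v)
    fun k => ι (b.coord (chartX f i) (Sum.inr (Sum.inl k))))
  have hζ : ∀ j, MvPolynomial.aeval ζ (b.blowSlice j) = ι (chartX f i j) := by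
    intro j
    rw [b.aeval_blowSlice, b.sum_coord' (chartX f i) j, chartX_self, one_mul, map_add, map_add,
      map_sum, map_sum, AlgHom.commutes, Fin.sum_univ_two]
    have h1 : ι l₀ * (ι l₁ * v) = ι l₁ := by
      rw [mul_left_comm, hι l₀, hv, mul_one]
    simp only [ζ, Option.elim_none, Option.elim_some, h1, map_mul, AlgHom.commutes, ← hl₀, ← hl₁]
  let Ψ : DoubleRing g →ₐ[K] L := doubleLift g ζ (ι (chartY f i)) (by
    rw [← map_pow, chartY_sq, hg, aeval_aeval, ← AlgHom.comp_apply, MvPolynomial.comp_aeval]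
    congr 2
    funext j
    exact (hζ j).symm)
  have hΨΦ : Ψ.comp Φ = ι := by
    apply chartRing_algHom_ext
    · intro j
      rw [AlgHom.comp_apply, hΦX, ← hζ]
      simp only [ξ]
      rw [← AlgHom.comp_apply, MvPolynomial.comp_aeval]
      congr 2
      funext k
      exact doubleLift_doubleX ..
    · rw [AlgHom.comp_apply, hΦY]
      exact doubleLift_doubleY ..
  refine nonempty_away_reesGrading_equiv I hmem Φ.toRingHom ?_ ?_ ?_ ?_
  · change Φ l₀ ∈ _
    rw [hΦ₀]
    exact X_some_mem_nonZeroDivisors g none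
  · intro c hc
    change Φ l₀ ∣ Φ c
    rw [hΦ₀, ← Ideal.mem_span_singleton]
    have h1 : I ≤ (Ideal.span {doubleX g none}).comap Φ := by
      rw [hspan, Ideal.span_le]
      rintro _ (rfl | rfl)
      · simp only [SetLike.mem_coe, Ideal.mem_comap, hΦ₀]
        exact Ideal.mem_span_singleton_self _
      · simp only [SetLike.mem_coe, Ideal.mem_comap, hΦ₁]
        exact Ideal.mul_mem_right _ _ (Ideal.mem_span_singleton_self _)
    exact h1 hc
  · -- every element of the chart is a fraction with denominator a power of `l₀`
    intro p
    change ∃ k, ∃ c ∈ I ^ k, Φ l₀ ^ k * p = Φ c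
    obtain ⟨p, rfl⟩ := Ideal.Quotient.mk_surjective p
    induction p using MvPolynomial.induction_on with
    | C a =>
      refine ⟨0, algebraMap K _ a, by simp, ?_⟩
      rw [AlgHom.commutes, pow_zero, one_mul]
      rfl
    | add p q hp hq =>
      obtain ⟨k, c, hc, h1⟩ := hp
      obtain ⟨k', c', hc', h2⟩ := hq
      refine ⟨k + k', l₀ ^ k' * c + l₀ ^ k * c', add_mem ?_ ?_, ?_⟩
      · rw [add_comm]
        exact mul_mem_pow_add (Ideal.pow_mem_pow hmem _) hc
      · exact mul_mem_pow_add (Ideal.pow_mem_pow hmem _) hc'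
      · rw [map_add, map_add, map_mul, map_mul, map_pow, map_pow, ← h1, ← h2]
        ring
    | mul_X p o hp =>
      obtain ⟨k, c, hc, h1⟩ := hp
      have hX : ∃ m, ∃ z ∈ I ^ m, Φ l₀ ^ m *
          Ideal.Quotient.mk (Ideal.span {doubleEquation g}) (MvPolynomial.X o) = Φ z := by
        match o with
        | none => exact ⟨0, chartY f i, by simp, by rw [hΦY, pow_zero, one_mul]; rfl⟩
        | some none => exact ⟨0, l₀, by simp, by rw [hΦ₀, pow_zero, one_mul]; rfl⟩
        | some (some none) =>
          exact ⟨1, l₁, by rwa [pow_one], by rw [hΦ₁, hΦ₀, pow_one]; rfl⟩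
        | some (some (some k)) =>
          exact ⟨0, b.coord (chartX f i) (Sum.inr (Sum.inl k)), by simp, by
            rw [hΦτ, pow_zero, one_mul]; rfl⟩
      obtain ⟨m, z, hz, h2⟩ := hX
      refine ⟨k + m, c * z, ?_, ?_⟩
      · exact mul_mem_pow_add hc hz
      · rw [map_mul, map_mul, ← h1, ← h2]
        ring
  · intro c hc
    have h1 : algebraMap (ChartRing f i) L c = 0 := by
      rw [← hι, ← hΨΦ, AlgHom.comp_apply]
      have : Φ c = 0 := hc
      rw [this, map_zero]
    rw [IsLocalization.map_eq_zero_iff (Submonoid.powers l₀)] at h1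
    obtain ⟨⟨_, k, rfl⟩, hk⟩ := h1
    exact ⟨k, hk⟩

end BlowUpSlice

end AdaptedBasis

/-! ### Existence of adapted bases -/

/-- A basis whose first part spans the given subspace. -/
theorem exists_basis_adapted {K W : Type*} [Field K] [AddCommGroup W] [Module K W]
    [Module.Finite K W] (P : Submodule K W) {p q : ℕ} (hP : Module.finrank K P = p)
    (hW : Module.finrank K W = p + q) :
    ∃ B : Module.Basis (Fin p ⊕ Fin q) K W, ∀ x, x ∈ P ↔ ∀ e, B.repr x (Sum.inr e) = 0 := by
  obtain ⟨Q, hQ⟩ := P.exists_isCompl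
  have hQ' : Module.finrank K Q = q := by
    have := Submodule.finrank_add_eq_of_isCompl hQ
    omega
  let bP : Module.Basis (Fin p) K P := Module.finBasisOfFinrankEq K P hP
  let bQ : Module.Basis (Fin q) K Q := Module.finBasisOfFinrankEq K Q hQ'
  refine ⟨(bP.prod bQ).map (P.prodEquivOfIsCompl Q hQ), fun x => ?_⟩
  rw [← Submodule.prodEquivOfIsCompl_symm_apply_snd_eq_zero P Q hQ,
    ← LinearEquiv.map_eq_zero_iff bQ.repr, DFunLike.ext_iff]
  simp only [Module.Basis.map_repr, LinearEquiv.trans_apply, Module.Basis.prod_repr_inr]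
  rfl

namespace AdaptedBasis

variable {K : Type u} [Field K] {n : ℕ} {P : Submodule K (Fin n → K)} {i : Fin n}

/-- Adapted bases exist on each affine chart which meets `P`: complete a point of `P` on the chart
by a basis of the hyperplane `x_i = 0` that extends a basis of its intersection with `P`. -/
theorem nonempty_of_mem {p q : ℕ} {o : Fin n → K} (ho : o ∈ P) (hoi : o i = 1)
    (hP : Module.finrank K P = p + 1) (hn : p + 1 + q = n) :
    Nonempty (AdaptedBasis P i (Fin p) (Fin q)) := by
  let π : (Fin n → K) →ₗ[K] K := LinearMap.proj i
  have hπ : ∀ x, π x = x i := fun x => rfl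
  let W := LinearMap.ker π
  have hmem : ∀ x, x ∈ W ↔ x i = 0 := fun x => Iff.rfl
  have hW : Module.finrank K W + 1 = n := by
    have h1 := π.finrank_range_add_finrank_ker
    rw [LinearMap.range_eq_top.2 fun c => ⟨c • o, by simp [hπ, hoi]⟩, finrank_top,
      Module.finrank_self, Module.finrank_fin_fun] at h1
    change 1 + Module.finrank K W = n at h1
    omega
  let P' : Submodule K W := P.comap W.subtype
  have hP' : Module.finrank K P' = p := by
    have h1 := Submodule.finrank_sup_add_finrank_inf_eq P W
    have h2 : P ⊔ W = ⊤ := by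
      rw [eq_top_iff]
      intro x _
      rw [← add_sub_cancel (x i • o) x]
      exact Submodule.add_mem_sup (P.smul_mem _ ho) ((hmem _).2 (by simp [hoi]))
    have h3 : Module.finrank K P' = Module.finrank K ↥(P ⊓ W) := by
      rw [inf_comm, ← Submodule.map_comap_subtype]
      exact (Submodule.finrank_map_subtype_eq W P').symm
    rw [h2, finrank_top, Module.finrank_fin_fun] at h1
    omega
  obtain ⟨B, hB⟩ := exists_basis_adapted P' hP' (q := q) (by omega)
  have hPP' : P' = P.comap W.subtype := rfl
  clear_value P'
  let ψ : (Fin n → K) ≃ₗ[K] K × W :=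
    { toFun := fun x => (x i, ⟨x - x i • o, (hmem _).2 (by simp [hoi])⟩)
      map_add' := by
        intro x y
        ext1
        · rfl
        · ext1
          simp only [Submodule.coe_add, Prod.snd_add, Pi.add_apply, add_smul]
          abel
      map_smul' := by
        intro c x
        ext1
        · rfl
        · ext1
          simp only [Submodule.coe_smul, Prod.smul_snd, Pi.smul_apply, smul_sub, smul_smul,
            smul_eq_mul, RingHom.id_apply]
      invFun := fun z => z.1 • o + (z.2 : Fin n → K)
      left_inv := by
        intro x
        simp
      right_inv := by
        rintro ⟨c, z⟩
        have h1 : (z : Fin n → K) i = 0 := (hmem _).1 z.2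
        ext1
        · simp [hoi, h1]
        · ext1
          simp [hoi, h1] }
  refine ⟨⟨((Module.Basis.singleton Unit K).prod B).map ψ.symm, fun x => ?_, fun x => ?_⟩⟩
  · simp [ψ]
  · have h1 : x ∈ P ↔ (⟨x - x i • o, (hmem _).2 (by simp [hoi])⟩ : W) ∈ P' := by
      rw [hPP']
      change _ ↔ x - x i • o ∈ P
      rw [sub_eq_add_neg, P.add_mem_iff_left (P.neg_mem (P.smul_mem _ ho))]
    rw [h1, hB]
    simp [ψ]

/-- Interchange the two equations of the linear subspace. -/
def swap {τ : Type} (b : AdaptedBasis P i τ (Fin 2)) : AdaptedBasis P i τ (Fin 2) where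
  basis := b.basis.reindex ((Equiv.refl Unit).sumCongr
    ((Equiv.refl τ).sumCongr (Equiv.swap 0 1)))
  repr_base x := by simp [b.repr_base]
  mem_iff x := by
    rw [b.mem_iff]
    simp [Fin.forall_fin_two, and_comm]

theorem swap_coord {τ : Type} (b : AdaptedBasis P i τ (Fin 2)) {Λ : Type u} [CommRing Λ]
    [Algebra K Λ] (ξ : Fin n → Λ) :
    b.swap.coord ξ (Sum.inr (Sum.inr 0)) = b.coord ξ (Sum.inr (Sum.inr 1)) := by
  simp [coord, swap]

variable {τ ε : Type} [Fintype τ]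

section

variable [Fintype ε] (b : AdaptedBasis P i τ ε)

/-- If a linear map vanishes on a vector with `x_i = 1` and on the other basis vectors, it
vanishes on every vector. -/
theorem map_eq_zero {V : Type u} [AddCommGroup V] [Module K V] (D : (Fin n → K) →ₗ[K] V)
    {x : Fin n → K} (hx : x i = 1) (h : D x = 0) (hdir : ∀ k, D (b.dir k) = 0)
    (htrans : ∀ e, D (b.trans e) = 0) : D = 0 := by
  refine LinearMap.ext fun u => ?_
  have h1 : D (u - u i • x) = 0 := by
    rw [← b.basis.sum_repr (u - u i • x), map_sum]
    refine Finset.sum_eq_zero fun o _ => ?_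
    rw [map_smul]
    match o with
    | Sum.inl () => rw [b.repr_base]; simp [hx]
    | Sum.inr (Sum.inl k) =>
      rw [show b.basis (Sum.inr (Sum.inl k)) = b.dir k from rfl, hdir, smul_zero]
    | Sum.inr (Sum.inr e) =>
      rw [show b.basis (Sum.inr (Sum.inr e)) = b.trans e from rfl, htrans, smul_zero]
  rw [map_sub, map_smul, h, smul_zero, sub_zero] at h1
  rw [h1]; rfl

theorem map_eq_zero_of_mem {V : Type u} [AddCommGroup V] [Module K V] (D : (Fin n → K) →ₗ[K] V)
    {x : Fin n → K} (hxP : x ∈ P) (hx : x i = 1) (h : D x = 0) (hdir : ∀ k, D (b.dir k) = 0)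
    {u : Fin n → K} (hu : u ∈ P) : D u = 0 := by
  have h1 : D (u - u i • x) = 0 := by
    rw [← b.basis.sum_repr (u - u i • x), map_sum]
    refine Finset.sum_eq_zero fun o _ => ?_
    rw [map_smul]
    match o with
    | Sum.inl () => rw [b.repr_base]; simp [hx]
    | Sum.inr (Sum.inl k) =>
      rw [show b.basis (Sum.inr (Sum.inl k)) = b.dir k from rfl, hdir, smul_zero]
    | Sum.inr (Sum.inr e) =>
      rw [(b.mem_iff _).1 (P.sub_mem hu (P.smul_mem _ hxP)) e, zero_smul]
  rwa [map_sub, map_smul, h, smul_zero, sub_zero] at h1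

end

end AdaptedBasis

/-! ### Critical points of the charts -/

section CriticalPoints

variable {K : Type u} [Field K]

/-- The differential of a polynomial at a point. -/
def gradAt {σ : Type} [Fintype σ] (f : MvPolynomial σ K) (x : σ → K) : (σ → K) →ₗ[K] K where
  toFun u := MvPolynomial.eval x (dirDeriv u f)
  map_add' u v := by simp
  map_smul' c u := by simp

theorem gradAt_apply {σ : Type} [Fintype σ] (f : MvPolynomial σ K) (x u : σ → K) :
    gradAt f x u = MvPolynomial.eval x (dirDeriv u f) := rfl

/-- The vectors of a linear subspace at which the restriction of `f` to this subspace is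
singular. -/
def restrictionSingularLocus {n : ℕ} (f : MvPolynomial (Fin n) K) (P : Submodule K (Fin n → K)) :
    Set (Fin n → K) :=
  {x | x ∈ P ∧ ∀ u ∈ P, gradAt f x u = 0}

/-- At every singular point of the restriction of `f` to the linear subspace, the Hessian form of
this restriction does not vanish. -/
def HasNonzeroHessians {n : ℕ} (f : MvPolynomial (Fin n) K) (P : Submodule K (Fin n → K)) : Prop :=
  ∀ x ∈ restrictionSingularLocus f P, x ≠ 0 → ∃ u ∈ P, ∃ v ∈ P, gradAt (dirDeriv u f) x v ≠ 0

namespace AdaptedBasis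

variable {n : ℕ} {P : Submodule K (Fin n → K)} {i : Fin n} {τ ε : Type} [Fintype τ]

section Slice

variable (b : AdaptedBasis P i τ ε)

/-- The point of the affine chart `x_i = 1` of `P` with given affine coordinates. -/
def slicePoint (a : τ → K) : Fin n → K := b.origin + ∑ k, a k • b.dir k

theorem eval_slice (a : τ → K) (j : Fin n) :
    MvPolynomial.eval a (b.slice j) = b.slicePoint a j := by
  simp [slice, slicePoint, mul_comm]

theorem slicePoint_mem (a : τ → K) : b.slicePoint a ∈ P :=
  P.add_mem b.origin_mem (P.sum_mem fun k _ => P.smul_mem _ (b.dir_mem k))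

theorem slicePoint_apply (a : τ → K) : b.slicePoint a i = 1 := by
  simp [slicePoint, b.origin_apply, b.dir_apply]

theorem slicePoint_injective : Function.Injective b.slicePoint := by
  classical
  intro a a' h
  funext k
  have h1 := congrArg (fun x => b.basis.repr x (Sum.inr (Sum.inl k))) h
  simpa [slicePoint, origin, dir, Finsupp.single_apply] using h1

theorem pderiv_aeval_slice (f : MvPolynomial (Fin n) K) (k : τ) :
    MvPolynomial.pderiv k (MvPolynomial.aeval b.slice f) =
      MvPolynomial.aeval b.slice (dirDeriv (b.dir k) f) := by
  classical
  have h : ∀ j, MvPolynomial.pderiv k (b.slice j) = MvPolynomial.C (b.dir k j) := by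
    intro j
    rw [slice, map_add, map_sum, MvPolynomial.pderiv_C, zero_add, Finset.sum_eq_single k]
    · simp
    · intro l _ hl
      rw [MvPolynomial.pderiv_C_mul, MvPolynomial.pderiv_X_of_ne hl, mul_zero]
    · simp
  rw [pderiv_aeval, dirDeriv_apply, map_sum]
  refine Finset.sum_congr rfl fun j _ => ?_
  rw [h, map_mul, MvPolynomial.aeval_C, mul_comm]
  rfl

theorem eval_aeval_slice (f : MvPolynomial (Fin n) K) (a : τ → K) :
    MvPolynomial.eval a (MvPolynomial.aeval b.slice f) =
      MvPolynomial.eval (b.slicePoint a) f := by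
  rw [eval_aeval]
  congr 2
  funext j
  exact b.eval_slice a j

variable {f : MvPolynomial (Fin n) K} {d : ℕ}

/-- By Euler's identity the critical points of the affine equation are critical for the form. -/
theorem slicePoint_mem_restrictionSingularLocus [Fintype ε] (hf : f.IsHomogeneous d) {a : τ → K}
    (ha : a ∈ criticalPoints (MvPolynomial.aeval b.slice f)) :
    b.slicePoint a ∈ restrictionSingularLocus f P := by
  obtain ⟨h0, h1⟩ := ha
  rw [b.eval_aeval_slice] at h0
  refine ⟨b.slicePoint_mem a, fun u hu => ?_⟩
  refine b.map_eq_zero_of_mem _ (b.slicePoint_mem a) (b.slicePoint_apply a) ?_ (fun k => ?_) hu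
  · rw [gradAt_apply, eval_dirDeriv_self hf, h0, mul_zero]
  · rw [gradAt_apply, ← b.eval_aeval_slice, ← b.pderiv_aeval_slice, h1]

theorem hasQuadraticCriticalPoints_slice [Fintype ε] (hf : f.IsHomogeneous d)
    (hfin : {x ∈ restrictionSingularLocus f P | x i = 1}.Finite) :
    HasQuadraticCriticalPoints (MvPolynomial.aeval b.slice f) 0 := by
  refine ⟨Set.Finite.of_finite_image (hfin.subset ?_) (b.slicePoint_injective.injOn),
    fun a _ => ⟨Fin.elim0, Fin.elim0, by simp⟩⟩
  rintro _ ⟨a, ha, rfl⟩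
  exact ⟨b.slicePoint_mem_restrictionSingularLocus hf ha, b.slicePoint_apply a⟩

/-- If `f` vanished on the chart of `P`, then all its points would be critical. -/
theorem aeval_slice_ne_zero [CharZero K] [Nonempty τ] [Fintype ε] (hf : f.IsHomogeneous d)
    (hfin : {x ∈ restrictionSingularLocus f P | x i = 1}.Finite) :
    MvPolynomial.aeval b.slice f ≠ 0 := by
  intro h0
  have h1 := (b.hasQuadraticCriticalPoints_slice hf hfin).1
  rw [h0] at h1
  have h2 : criticalPoints (0 : MvPolynomial τ K) = Set.univ := by
    ext a; simp [criticalPoints]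
  rw [h2] at h1
  have : Infinite K := CharZero.infinite K
  exact Set.infinite_univ h1

/-- A vector of the singular locus at which the Hessian form of the restriction does not vanish
has a nonzero second derivative in two directions of the affine chart. -/
theorem exists_dir_ne_zero [Fintype ε] (hf : f.IsHomogeneous d) (hH : HasNonzeroHessians f P)
    {x : Fin n → K} (hx : x ∈ restrictionSingularLocus f P) (hxi : x i = 1) :
    ∃ k l, gradAt (dirDeriv (b.dir k) f) x (b.dir l) ≠ 0 := by
  by_contra! h
  have hx0 : x ≠ 0 := by
    rintro rfl
    simp at hxi
  obtain ⟨u, hu, v, hv, huv⟩ := hH x hx hx0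
  have symm : ∀ u v, gradAt (dirDeriv u f) x v = gradAt (dirDeriv v f) x u := by
    intro u v
    rw [gradAt_apply, gradAt_apply, dirDeriv_comm]
  have hself : ∀ u ∈ P, gradAt (dirDeriv u f) x x = 0 := by
    intro u hu
    rw [gradAt_apply, eval_dirDeriv_self (isHomogeneous_dirDeriv hf u), ← gradAt_apply, hx.2 u hu,
      mul_zero]
  have h1 : ∀ k, gradAt (dirDeriv u f) x (b.dir k) = 0 := by
    intro k
    rw [symm]
    exact b.map_eq_zero_of_mem _ hx.1 hxi (hself _ (b.dir_mem k)) (fun l => h k l) hu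
  exact huv (b.map_eq_zero_of_mem _ hx.1 hxi (hself _ hu) h1 hv)

theorem hasQuadraticCriticalPoints_slice_one [Fintype ε] (hf : f.IsHomogeneous d)
    (hfin : {x ∈ restrictionSingularLocus f P | x i = 1}.Finite) (hH : HasNonzeroHessians f P) :
    HasQuadraticCriticalPoints (MvPolynomial.aeval b.slice f) 1 := by
  refine ⟨(b.hasQuadraticCriticalPoints_slice hf hfin).1, fun a ha => ?_⟩
  obtain ⟨k, l, hkl⟩ := b.exists_dir_ne_zero hf hH
    (b.slicePoint_mem_restrictionSingularLocus hf ha) (b.slicePoint_apply a)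
  refine ⟨fun _ => l, fun _ => k, ?_⟩
  rw [Matrix.det_unique, Matrix.of_apply, b.pderiv_aeval_slice, b.pderiv_aeval_slice,
    b.eval_aeval_slice]
  exact hkl

end Slice

section BlowSlice

variable (b : AdaptedBasis P i τ (Fin 2))

/-- The image in `Kⁿ` of a point of the chart of the blow up. -/
def blowPoint (a : Option (Option τ) → K) : Fin n → K :=
  b.origin + (∑ k, a (some (some k)) • b.dir k +
    (a none • b.trans 0 + (a none * a (some none)) • b.trans 1))

theorem eval_aeval_blowSlice (f : MvPolynomial (Fin n) K) (a : Option (Option τ) → K) :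
    MvPolynomial.eval a (MvPolynomial.aeval b.blowSlice f) =
      MvPolynomial.eval (b.blowPoint a) f := by
  rw [eval_aeval]
  congr 2
  funext j
  simp [blowSlice, blowPoint, mul_comm]

theorem blowPoint_apply (a : Option (Option τ) → K) : b.blowPoint a i = 1 := by
  simp [blowPoint, b.origin_apply, b.dir_apply, b.trans_apply]

theorem pderiv_aeval_blowSlice_dir (f : MvPolynomial (Fin n) K) (k : τ) :
    MvPolynomial.pderiv (some (some k)) (MvPolynomial.aeval b.blowSlice f) =
      MvPolynomial.aeval b.blowSlice (dirDeriv (b.dir k) f) := by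
  classical
  have h : ∀ j, MvPolynomial.pderiv (some (some k)) (b.blowSlice j) =
      MvPolynomial.C (b.dir k j) := by
    intro j
    have h1 : MvPolynomial.pderiv (some (some k)) (∑ l : τ, MvPolynomial.C (b.dir l j) *
        (MvPolynomial.X (some (some l)) : MvPolynomial (Option (Option τ)) K)) =
        MvPolynomial.C (b.dir k j) := by
      rw [map_sum, Finset.sum_eq_single k]
      · simp
      · intro l _ hl
        rw [MvPolynomial.pderiv_C_mul, MvPolynomial.pderiv_X_of_ne (by simpa using hl), mul_zero]
      · simp
    simp [blowSlice, h1]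
  rw [pderiv_aeval, dirDeriv_apply, map_sum]
  refine Finset.sum_congr rfl fun j _ => ?_
  rw [h, map_mul, MvPolynomial.aeval_C, mul_comm]
  rfl

theorem pderiv_aeval_blowSlice_fibre (f : MvPolynomial (Fin n) K) :
    MvPolynomial.pderiv (some none) (MvPolynomial.aeval b.blowSlice f) =
      MvPolynomial.X none * MvPolynomial.aeval b.blowSlice (dirDeriv (b.trans 1) f) := by
  have h : ∀ j, MvPolynomial.pderiv (some none) (b.blowSlice j) =
      MvPolynomial.X none * MvPolynomial.C (b.trans 1 j) := by
    intro j
    simp [blowSlice, MvPolynomial.pderiv_X_of_ne, mul_comm]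
  rw [pderiv_aeval, dirDeriv_apply, map_sum, Finset.mul_sum]
  refine Finset.sum_congr rfl fun j _ => ?_
  rw [h, map_mul, MvPolynomial.aeval_C, MvPolynomial.algebraMap_eq]
  ring

theorem pderiv_aeval_blowSlice_none (f : MvPolynomial (Fin n) K) :
    MvPolynomial.pderiv none (MvPolynomial.aeval b.blowSlice f) =
      MvPolynomial.aeval b.blowSlice (dirDeriv (b.trans 0) f) +
      MvPolynomial.X (some none) * MvPolynomial.aeval b.blowSlice (dirDeriv (b.trans 1) f) := by
  have h : ∀ j, MvPolynomial.pderiv none (b.blowSlice j) =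
      MvPolynomial.C (b.trans 0 j) + MvPolynomial.X (some none) * MvPolynomial.C (b.trans 1 j) := by
    intro j
    simp [blowSlice, MvPolynomial.pderiv_X_of_ne, mul_comm]
  rw [pderiv_aeval, dirDeriv_apply, dirDeriv_apply, map_sum, map_sum, Finset.mul_sum,
    ← Finset.sum_add_distrib]
  refine Finset.sum_congr rfl fun j _ => ?_
  rw [h, map_mul, map_mul, MvPolynomial.aeval_C, MvPolynomial.aeval_C, MvPolynomial.algebraMap_eq]
  ring

variable {f : MvPolynomial (Fin n) K} {d : ℕ}

/-- The critical points of the blow up chart lie on the exceptional divisor over the singular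
points of the restriction of `f` to `P`, and they are determined by their images. -/
theorem critical_blowSlice (hf : f.IsHomogeneous d)
    (hsm : IsSmoothHypersurface f) {a : Option (Option τ) → K}
    (ha : a ∈ criticalPoints (MvPolynomial.aeval b.blowSlice f)) :
    a none = 0 ∧ b.blowPoint a ∈ restrictionSingularLocus f P ∧
      gradAt f (b.blowPoint a) (b.trans 1) ≠ 0 ∧
      gradAt f (b.blowPoint a) (b.trans 0) +
        a (some none) * gradAt f (b.blowPoint a) (b.trans 1) = 0 := by
  obtain ⟨h0, h1⟩ := ha
  rw [b.eval_aeval_blowSlice] at h0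
  set x := b.blowPoint a with hx
  have hxi : x i = 1 := b.blowPoint_apply a
  have hx0 : x ≠ 0 := by
    intro h; rw [h] at hxi; simp at hxi
  have hself : gradAt f x x = 0 := by
    rw [gradAt_apply, eval_dirDeriv_self hf, h0, mul_zero]
  have hdir : ∀ k, gradAt f x (b.dir k) = 0 := by
    intro k
    rw [gradAt_apply, ← b.eval_aeval_blowSlice, ← b.pderiv_aeval_blowSlice_dir, h1]
  have ht : a none * gradAt f x (b.trans 1) = 0 := by
    have h := h1 (some none)
    rwa [b.pderiv_aeval_blowSlice_fibre, map_mul, MvPolynomial.eval_X,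
      b.eval_aeval_blowSlice] at h
  have hu : gradAt f x (b.trans 0) + a (some none) * gradAt f x (b.trans 1) = 0 := by
    have h := h1 none
    rwa [b.pderiv_aeval_blowSlice_none, map_add, map_mul, MvPolynomial.eval_X,
      b.eval_aeval_blowSlice, b.eval_aeval_blowSlice] at h
  -- otherwise all the derivatives of `f` vanish at `x`, against the smoothness of the hypersurface
  have h2 : gradAt f x (b.trans 1) ≠ 0 := by
    intro h3
    rw [h3, mul_zero, add_zero] at hu
    have h4 : gradAt f x = 0 := b.map_eq_zero _ hxi hself hdir (by
      intro e
      match e with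
      | 0 => exact hu
      | 1 => exact h3)
    obtain ⟨j, hj⟩ := hsm x hx0 h0
    apply hj
    rw [← dirDeriv_single, ← gradAt_apply, h4]
    rfl
  have h5 : a none = 0 := (mul_eq_zero.1 ht).resolve_right h2
  have hxP : x ∈ P := by
    rw [hx, blowPoint, h5]
    simp only [zero_smul, zero_mul, add_zero]
    exact P.add_mem b.origin_mem (P.sum_mem fun k _ => P.smul_mem _ (b.dir_mem k))
  exact ⟨h5, ⟨hxP, fun u hu => b.map_eq_zero_of_mem _ hxP hxi hself hdir hu⟩, h2, hu⟩

theorem finite_criticalPoints_blowSlice (hf : f.IsHomogeneous d)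
    (hsm : IsSmoothHypersurface f)
    (hfin : {x ∈ restrictionSingularLocus f P | x i = 1}.Finite) :
    (criticalPoints (MvPolynomial.aeval b.blowSlice f)).Finite := by
  classical
  refine Set.Finite.of_finite_image (f := b.blowPoint) (hfin.subset ?_) ?_
  · rintro _ ⟨a, ha, rfl⟩
    exact ⟨(b.critical_blowSlice hf hsm ha).2.1, b.blowPoint_apply a⟩
  · intro a ha a' ha' h
    obtain ⟨h1, -, h2, h3⟩ := b.critical_blowSlice hf hsm ha
    obtain ⟨h1', -, h2', h3'⟩ := b.critical_blowSlice hf hsm ha'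
    funext o
    match o with
    | none => rw [h1, h1']
    | some none =>
      rw [← h] at h3'
      exact mul_right_cancel₀ h2 (add_left_cancel (h3.trans h3'.symm))
    | some (some k) =>
      have h4 := congrArg (fun x => b.basis.repr x (Sum.inr (Sum.inl k))) h
      simpa [blowPoint, origin, dir, trans, Finsupp.single_apply] using h4

/-- The Hessian matrix at a point of the exceptional divisor `u = 0`: in the coordinates `u`, `t`
it is an antidiagonal block up to the entry at `(u, u)`, the row of `t` vanishes otherwise, and
along `P` it is the Hessian matrix of the restriction of `f`. -/
theorem hessian_blowSlice (f : MvPolynomial (Fin n) K) {a : Option (Option τ) → K}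
    (ha : a none = 0) :
    MvPolynomial.eval a (MvPolynomial.pderiv none (MvPolynomial.pderiv (some none)
      (MvPolynomial.aeval b.blowSlice f))) = gradAt f (b.blowPoint a) (b.trans 1) ∧
    MvPolynomial.eval a (MvPolynomial.pderiv (some none) (MvPolynomial.pderiv none
      (MvPolynomial.aeval b.blowSlice f))) = gradAt f (b.blowPoint a) (b.trans 1) ∧
    MvPolynomial.eval a (MvPolynomial.pderiv (some none) (MvPolynomial.pderiv (some none)
      (MvPolynomial.aeval b.blowSlice f))) = 0 ∧
    (∀ k, MvPolynomial.eval a (MvPolynomial.pderiv (some (some k)) (MvPolynomial.pderiv (some none)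
      (MvPolynomial.aeval b.blowSlice f))) = 0) ∧
    (∀ k, MvPolynomial.eval a (MvPolynomial.pderiv (some none) (MvPolynomial.pderiv (some (some k))
      (MvPolynomial.aeval b.blowSlice f))) = 0) ∧
    (∀ k l, MvPolynomial.eval a (MvPolynomial.pderiv (some (some k)) (MvPolynomial.pderiv
      (some (some l)) (MvPolynomial.aeval b.blowSlice f))) =
        gradAt (dirDeriv (b.dir l) f) (b.blowPoint a) (b.dir k)) := by
  have h1 : MvPolynomial.eval a (MvPolynomial.pderiv none (MvPolynomial.pderiv (some none)
      (MvPolynomial.aeval b.blowSlice f))) = gradAt f (b.blowPoint a) (b.trans 1) := by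
    rw [b.pderiv_aeval_blowSlice_fibre, MvPolynomial.pderiv_mul, MvPolynomial.pderiv_X_self]
    simp [ha, gradAt_apply, b.eval_aeval_blowSlice, -MvPolynomial.aeval_eq_bind₁]
  have h4 : ∀ k, MvPolynomial.eval a (MvPolynomial.pderiv (some (some k)) (MvPolynomial.pderiv
      (some none) (MvPolynomial.aeval b.blowSlice f))) = 0 := by
    intro k
    rw [b.pderiv_aeval_blowSlice_fibre, MvPolynomial.pderiv_mul,
      MvPolynomial.pderiv_X_of_ne (by simp)]
    simp [ha]
  refine ⟨h1, by rw [pderiv_pderiv_comm, h1], ?_, h4, fun k => by rw [pderiv_pderiv_comm, h4],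
    fun k l => ?_⟩
  · rw [b.pderiv_aeval_blowSlice_fibre, MvPolynomial.pderiv_mul,
      MvPolynomial.pderiv_X_of_ne (by simp)]
    simp [ha]
  · rw [b.pderiv_aeval_blowSlice_dir, b.pderiv_aeval_blowSlice_dir, b.eval_aeval_blowSlice,
      gradAt_apply]

/-- The minor of size two belongs to the equation `u` of the exceptional divisor and the fibre
coordinate `t`. -/
theorem hasQuadraticCriticalPoints_blowSlice_two (hf : f.IsHomogeneous d)
    (hsm : IsSmoothHypersurface f)
    (hfin : {x ∈ restrictionSingularLocus f P | x i = 1}.Finite) :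
    HasQuadraticCriticalPoints (MvPolynomial.aeval b.blowSlice f) 2 := by
  refine ⟨b.finite_criticalPoints_blowSlice hf hsm hfin, fun a ha => ?_⟩
  obtain ⟨h0, -, h2, -⟩ := b.critical_blowSlice hf hsm ha
  obtain ⟨e1, e2, e3, -⟩ := b.hessian_blowSlice f h0
  refine ⟨![none, some none], ![none, some none], ?_⟩
  rw [Matrix.det_fin_two]
  simp [e1, e2, e3, h2, -MvPolynomial.aeval_eq_bind₁]

/-- The minor of size three is completed by a nonzero second derivative along `P`. -/
theorem hasQuadraticCriticalPoints_blowSlice_three (hf : f.IsHomogeneous d)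
    (hsm : IsSmoothHypersurface f)
    (hfin : {x ∈ restrictionSingularLocus f P | x i = 1}.Finite) (hH : HasNonzeroHessians f P) :
    HasQuadraticCriticalPoints (MvPolynomial.aeval b.blowSlice f) 3 := by
  refine ⟨b.finite_criticalPoints_blowSlice hf hsm hfin, fun a ha => ?_⟩
  obtain ⟨h0, h1, h2, -⟩ := b.critical_blowSlice hf hsm ha
  obtain ⟨k, l, hkl⟩ := b.exists_dir_ne_zero hf hH h1 (b.blowPoint_apply a)
  obtain ⟨e1, e2, e3, e4, e5, e6⟩ := b.hessian_blowSlice f h0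
  refine ⟨![none, some none, some (some l)], ![none, some none, some (some k)], ?_⟩
  rw [Matrix.det_fin_three]
  simp [e1, e2, e3, e4, e5, e6, h2, hkl, -MvPolynomial.aeval_eq_bind₁]

end BlowSlice

end AdaptedBasis

end CriticalPoints

/-! ### Local structure of preimages and blow ups -/

section LocalStructure

variable {K : Type u} [Field K] {n : ℕ}

theorem linearIdeal_le_preimageIdeal (f : MvPolynomial (Fin n) K) (P : Submodule K (Fin n → K))
    (i : Fin n) : AdaptedBasis.linearIdeal f P i ≤ preimageIdeal f P i := Ideal.le_radical

/-- If `P` lies in the hyperplane `x_i = 0`, then its preimage does not meet the chart. -/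
theorem preimageIdeal_eq_top (f : MvPolynomial (Fin n) K) {P : Submodule K (Fin n → K)}
    {i : Fin n} (hP : ∀ x ∈ P, x i = 0) : preimageIdeal f P i = ⊤ := by
  rw [Ideal.eq_top_iff_one]
  refine linearIdeal_le_preimageIdeal f P i (Ideal.subset_span ⟨Pi.single i 1, ?_, ?_⟩)
  · intro v hv
    simpa [Pi.single_apply] using hP v hv
  · rw [← chartX_self f i, chartX]
    congr 1
    rw [Finset.sum_eq_single i]
    · simp
    · intro j _ hj; simp [hj]
    · simp

/-- The zero ring is the coordinate ring of the hypersurface `1 = 0`. -/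
theorem isQuadraticHypersurfaceRing_of_subsingleton {B : Type u} [CommRing B] [Subsingleton B]
    (r : ℕ) : IsQuadraticHypersurfaceRing K B r := by
  have h : criticalPoints (1 : MvPolynomial Unit K) = ∅ := by
    ext a; simp [criticalPoints]
  have : Subsingleton (MvPolynomial Unit K ⧸ Ideal.span {(1 : MvPolynomial Unit K)}) :=
    Ideal.Quotient.subsingleton_iff.2 (by simp)
  refine ⟨Unit, inferInstance, 1, ⟨by simp [h], by simp [h]⟩, ⟨?_⟩⟩
  exact { toFun := fun _ => 0, invFun := fun _ => 0, left_inv := fun _ => Subsingleton.elim _ _,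
          right_inv := fun _ => Subsingleton.elim _ _, map_mul' := fun _ _ => by simp,
          map_add' := fun _ _ => by simp }

theorem isQuadraticHypersurfaceRing_doubleRing [CharZero K] {τ : Type} [Fintype τ]
    {g : MvPolynomial τ K} {r : ℕ} (h : HasQuadraticCriticalPoints g r) :
    IsQuadraticHypersurfaceRing K (DoubleRing g) (r + 1) :=
  ⟨Option τ, inferInstance, doubleEquation g, h.doubleEquation, ⟨RingEquiv.refl _⟩⟩

/-- The double space is smooth: its equation has no critical points, so the bound on the ranks holds
for every `r`. -/
theorem isQuadraticHypersurfaceRing_chartRing [CharZero K] {d : ℕ}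
    {f : MvPolynomial (Fin n) K}
    (hf : f.IsHomogeneous d) (hsm : IsSmoothHypersurface f) (i : Fin n) (r : ℕ) :
    IsQuadraticHypersurfaceRing K (ChartRing f i) (r + 1) := by
  obtain ⟨p, rfl⟩ : ∃ p, n = p + 1 := ⟨n - 1, by have := i.pos; omega⟩
  obtain ⟨b⟩ := AdaptedBasis.nonempty_of_mem (P := (⊤ : Submodule K (Fin (p + 1) → K))) (p := p)
    (q := 0) (i := i) (o := Pi.single i 1) trivial (by simp) (by simp) (by simp)
  have hcrit : criticalPoints (MvPolynomial.aeval b.slice f) = ∅ := by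
    rw [Set.eq_empty_iff_forall_notMem]
    intro a ha
    have h1 := b.slicePoint_mem_restrictionSingularLocus hf ha
    have h2 := b.slicePoint_apply a
    have h0 : b.slicePoint a ≠ 0 := by
      intro h; rw [h] at h2; simp at h2
    obtain ⟨j, hj⟩ := hsm _ h0 (by rw [← b.eval_aeval_slice]; exact ha.1)
    rw [← dirDeriv_single] at hj
    exact hj (h1.2 _ trivial)
  obtain ⟨e⟩ := b.nonempty_ringEquiv_of_ker_eq_linearIdeal f (RingHom.id _)
    Function.surjective_id fun x => by
      rw [b.linearIdeal_eq_span, Set.range_eq_empty, Ideal.span_empty]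
      rfl
  have h : HasQuadraticCriticalPoints (MvPolynomial.aeval b.slice f) r :=
    ⟨by rw [hcrit]; exact Set.finite_empty, by rw [hcrit]; exact fun a ha => ha.elim⟩
  exact (isQuadraticHypersurfaceRing_doubleRing h).of_ringEquiv K e

variable [IsAlgClosed K] [CharZero K]

/-- It suffices to describe the charts of the blow up that belong to a set of generators. -/
theorem singularPointsIsolatedQuadratic_blowUp {A : Type u} [CommRing A] {I : Ideal A} {r : ℕ}
    (hr : 0 < r) {κ : Type} [Finite κ] (a : κ → A) (ha : ∀ k, a k ∈ I)
    (hI : I = Ideal.span (Set.range a))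
    (h : ∀ k, IsQuadraticHypersurfaceRing K
      (HomogeneousLocalization.Away (reesGrading I) (reesOfMem I (ha k))) r) :
    SingularPointsIsolatedQuadratic (blowUp I) r :=
  singularPointsIsolatedQuadratic_of_cover (X := Proj (reesGrading I)) hr
    (fun k => HomogeneousLocalization.Away (reesGrading I) (reesOfMem I (ha k))) h
    (fun k => Proj.awayι (reesGrading I) (reesOfMem I (ha k)) (reesOfMem_mem I (ha k)) one_pos)
    (exists_mem_range_awayι I a ha hI)

/-- The preimage of `P` has isolated quadratic singular points of rank at least two when
the singular points of `f|_P` are isolated with nonzero Hessian form. -/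
theorem singularPointsIsolatedQuadratic_preimageChart {d : ℕ}
    {f : MvPolynomial (Fin n) K} (hf : f.IsHomogeneous d) {P : Submodule K (Fin n → K)} {p : ℕ}
    (hp : p ≠ 0) (hP : Module.finrank K P = p + 1) (hn : p + 3 = n) {i : Fin n}
    (hfin : {x ∈ restrictionSingularLocus f P | x i = 1}.Finite) (hH : HasNonzeroHessians f P) :
    SingularPointsIsolatedQuadratic (preimageChart f P i) 2 := by
  refine singularPointsIsolatedQuadratic_Spec (K := K) two_pos ?_
  by_cases ho : ∃ o ∈ P, o i = 1
  · obtain ⟨o, ho, hoi⟩ := ho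
    obtain ⟨b⟩ := AdaptedBasis.nonempty_of_mem ho hoi hP (q := 2) (by omega)
    have : Nonempty (Fin p) := ⟨⟨0, Nat.pos_of_ne_zero hp⟩⟩
    rw [b.preimageIdeal_eq_linearIdeal f (b.aeval_slice_ne_zero hf hfin)]
    exact (isQuadraticHypersurfaceRing_doubleRing
      (b.hasQuadraticCriticalPoints_slice_one hf hfin hH)).quotient fun π hπ hker =>
        b.nonempty_ringEquiv_of_ker_eq_linearIdeal f π hπ hker
  · have hP0 : ∀ x ∈ P, x i = 0 := by
      intro x hx
      by_contra h
      exact ho ⟨(x i)⁻¹ • x, P.smul_mem _ hx, by simp [h]⟩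
    rw [preimageIdeal_eq_top f hP0]
    have : Subsingleton (ChartRing f i ⧸ (⊤ : Ideal (ChartRing f i))) :=
      Ideal.Quotient.subsingleton_iff.2 rfl
    exact isQuadraticHypersurfaceRing_of_subsingleton 2

/-- The blow up has isolated quadratic singular points when its standard charts do. -/
theorem singularPointsIsolatedQuadratic_blowUpChart {d : ℕ}
    {f : MvPolynomial (Fin n) K} (hf : f.IsHomogeneous d) (hsm : IsSmoothHypersurface f)
    {P : Submodule K (Fin n → K)} {p : ℕ}
    (hp : p ≠ 0) (hP : Module.finrank K P = p + 1) (hn : p + 3 = n) {i : Fin n} {r : ℕ}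
    (hfin : {x ∈ restrictionSingularLocus f P | x i = 1}.Finite)
    (hrank : ∀ b : AdaptedBasis P i (Fin p) (Fin 2),
      HasQuadraticCriticalPoints (MvPolynomial.aeval b.blowSlice f) r) :
    SingularPointsIsolatedQuadratic (blowUpChart f P i) (r + 1) := by
  by_cases ho : ∃ o ∈ P, o i = 1
  · obtain ⟨o, ho, hoi⟩ := ho
    obtain ⟨b⟩ := AdaptedBasis.nonempty_of_mem ho hoi hP (q := 2) (by omega)
    have : Nonempty (Fin p) := ⟨⟨0, Nat.pos_of_ne_zero hp⟩⟩
    have hI := b.preimageIdeal_eq_linearIdeal f (b.aeval_slice_ne_zero hf hfin)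
    have hspan : preimageIdeal f P i =
        Ideal.span (Set.range fun e => b.coord (chartX f i) (Sum.inr (Sum.inr e))) :=
      hI.trans (b.linearIdeal_eq_span f)
    have hmem : ∀ e, b.coord (chartX f i) (Sum.inr (Sum.inr e)) ∈ preimageIdeal f P i :=
      fun e => hspan ▸ Ideal.subset_span ⟨e, rfl⟩
    refine singularPointsIsolatedQuadratic_blowUp (K := K) (Nat.succ_pos r) _ hmem hspan
      (fun e => ?_)
    have key : ∀ (b' : AdaptedBasis P i (Fin p) (Fin 2)) (l : ChartRing f i)
        (hl : l ∈ preimageIdeal f P i), b'.coord (chartX f i) (Sum.inr (Sum.inr 0)) = l →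
        IsQuadraticHypersurfaceRing K (HomogeneousLocalization.Away
          (reesGrading (preimageIdeal f P i)) (reesOfMem _ hl)) (r + 1) := by
      rintro b' _ hl rfl
      obtain ⟨e⟩ := b'.nonempty_away_equiv f _ hI hl
      exact (isQuadraticHypersurfaceRing_doubleRing (hrank b')).of_ringEquiv K e.symm
    -- the chart of the second equation of `P` is the chart of the first one for another basis
    match e with
    | 0 => exact key b _ _ rfl
    | 1 => exact key b.swap _ _ (b.swap_coord _)
  · have hP0 : ∀ x ∈ P, x i = 0 := by
      intro x hx
      by_contra h
      exact ho ⟨(x i)⁻¹ • x, P.smul_mem _ hx, by simp [h]⟩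
    -- the centre is empty here, so that the blow up is the smooth chart of the double space
    have hI := preimageIdeal_eq_top f hP0
    have hmem : (1 : ChartRing f i) ∈ preimageIdeal f P i := hI ▸ Submodule.mem_top
    refine singularPointsIsolatedQuadratic_blowUp (K := K) (Nat.succ_pos r)
      (fun _ : Unit => (1 : ChartRing f i)) (fun _ => hmem)
      (by rw [hI, Set.range_const, Ideal.span_singleton_one]) (fun _ => ?_)
    obtain ⟨e⟩ := nonempty_away_reesGrading_equiv _ hmem (RingHom.id _) (by simp)
      (fun c _ => by simp) (fun c => ⟨0, c, by simp, by simp⟩) (fun c hc => ⟨0, by simpa using hc⟩)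
    exact (isQuadraticHypersurfaceRing_chartRing hf hsm i r).of_ringEquiv K e.symm

end LocalStructure

/-! ### Elimination and generic forms -/

section Elimination

variable {K : Type u} [Field K]

/-- A matrix with linearly independent rows has a nonvanishing maximal minor. -/
theorem exists_equiv_det_ne_zero {τ ν : Type} [Fintype τ] [DecidableEq τ] [Fintype ν]
    (B : Matrix τ ν K) (hB : LinearIndependent K B.row) :
    ∃ e : ν ≃ τ ⊕ Fin (Fintype.card ν - Fintype.card τ),
      (Matrix.of fun t t' => B t (e.symm (Sum.inl t'))).det ≠ 0 := by
  classical
  obtain ⟨κ, a, ha, hspan, hli⟩ := exists_linearIndependent' K B.col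
  have hrank := hB.rank_matrix
  rw [Matrix.rank_eq_finrank_span_cols, ← hspan] at hrank
  have : Finite κ := Finite.of_injective a ha
  let _ : Fintype κ := Fintype.ofFinite κ
  have hκ : Fintype.card κ = Fintype.card τ := by
    rw [← hrank]
    exact linearIndependent_iff_card_eq_finrank_span.1 hli
  let e₀ : κ ≃ τ := Fintype.equivOfCardEq hκ
  have hcompl : Fintype.card {m // m ∉ Set.range a} = Fintype.card ν - Fintype.card τ := by
    rw [Fintype.card_subtype_compl, ← hκ]
    congr 1
    exact (Fintype.card_congr (Equiv.ofInjective a ha)).symm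
  let e : ν ≃ τ ⊕ Fin (Fintype.card ν - Fintype.card τ) :=
    (Equiv.sumCompl (· ∈ Set.range a)).symm.trans
      (((Equiv.ofInjective a ha).symm.trans e₀).sumCongr
        (Fintype.equivFinOfCardEq hcompl))
  have he : ∀ t, e.symm (Sum.inl t) = a (e₀.symm t) := fun t => rfl
  refine ⟨e, ?_⟩
  have h1 : LinearIndependent K (Matrix.of fun t t' => B t (e.symm (Sum.inl t'))).col := by
    have h2 := hli.comp e₀.symm e₀.symm.injective
    exact h2
  rw [Matrix.linearIndependent_cols_iff_isUnit, Matrix.isUnit_iff_isUnit_det] at h1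
  exact h1.ne_zero

/-- More polynomials than variables are algebraically dependent. -/
theorem exists_aeval_eq_zero {ν ρ : Type} [Fintype ν] [Fintype ρ]
    (h : Fintype.card ρ < Fintype.card ν) (g : ν → MvPolynomial ρ K) :
    ∃ Φ : MvPolynomial ν K, Φ ≠ 0 ∧ MvPolynomial.aeval g Φ = 0 := by
  by_contra! hg
  have h1 : AlgebraicIndependent K g := by
    rw [algebraicIndependent_iff]
    intro Φ hΦ
    by_contra h0
    exact hg Φ h0 hΦ
  have h2 := h1.lift_cardinalMk_le_trdeg
  rw [MvPolynomial.trdeg_of_isDomain] at h2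
  simp only [Cardinal.mk_fintype, Cardinal.lift_natCast, Nat.cast_le] at h2
  omega

/-- The vectors `c` orthogonal to the rows `L t` evaluated at `a`, when the maximal minor at the
columns given by `e` does not vanish, are the values of a polynomial map: by Cramer's rule `c`
depends on `a` and on `k` free coordinates. These are fewer variables than `c` has coordinates, so
the coordinates of `c` satisfy a nontrivial polynomial equation. -/
theorem exists_polynomial_of_equiv {ν τ σ : Type} [Fintype ν] [Fintype τ] [DecidableEq τ]
    [Fintype σ] {k : ℕ} (hcard : Fintype.card σ < Fintype.card τ) (L : τ → ν → MvPolynomial σ K)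
    (e : ν ≃ τ ⊕ Fin k) :
    ∃ Φ : MvPolynomial ν K, Φ ≠ 0 ∧ ∀ (c : ν → K) (a : σ → K),
      (Matrix.of fun t t' => MvPolynomial.eval a (L t (e.symm (Sum.inl t')))).det ≠ 0 →
      (∀ t, ∑ m, MvPolynomial.eval a (L t m) * c m = 0) → MvPolynomial.eval c Φ = 0 := by
  let R := MvPolynomial (σ ⊕ Fin k) K
  let ℓ : τ → ν → R := fun t m => MvPolynomial.rename Sum.inl (L t m)
  let A : Matrix τ τ R := Matrix.of fun t t' => ℓ t (e.symm (Sum.inl t'))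
  let w : τ → R := fun t => ∑ j, ℓ t (e.symm (Sum.inr j)) * MvPolynomial.X (Sum.inr j)
  -- the solutions of the linear system by Cramer's rule, multiplied by the determinant
  let g : ν → R := fun m => Sum.elim (fun t => -(A.adjugate.mulVec w t))
    (fun j => A.det * MvPolynomial.X (Sum.inr j)) (e m)
  obtain ⟨Φ, h0, hΦ⟩ := exists_aeval_eq_zero (K := K) (ρ := σ ⊕ Fin k) (ν := ν) (by
    rw [Fintype.card_congr e]; simpa using hcard) g
  refine ⟨Φ, h0, fun c a hdet hc => ?_⟩
  set A₀ : Matrix τ τ K :=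
    Matrix.of fun t t' => MvPolynomial.eval a (L t (e.symm (Sum.inl t'))) with hA₀
  let z : σ ⊕ Fin k → K := Sum.elim a fun j => c (e.symm (Sum.inr j)) / A₀.det
  have hℓ : ∀ t m, MvPolynomial.eval z (ℓ t m) = MvPolynomial.eval a (L t m) := by
    intro t m
    rw [MvPolynomial.eval_rename]
    rfl
  have hA : (MvPolynomial.eval z).mapMatrix A = A₀ := by
    ext t t'
    exact hℓ t _
  have hD : MvPolynomial.eval z A.det = A₀.det := by rw [RingHom.map_det, hA]
  have hgz : (fun m => MvPolynomial.eval z (g m)) = c := by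
    funext m
    obtain ⟨o, rfl⟩ := e.symm.surjective m
    simp only [g, Equiv.apply_symm_apply]
    cases o with
    | inr j =>
      simp only [Sum.elim_inr, map_mul, hD, MvPolynomial.eval_X, z]
      exact mul_div_cancel₀ _ hdet
    | inl t =>
      have h1 : MvPolynomial.eval z (A.adjugate.mulVec w t) =
          (A₀.adjugate.mulVec fun t => MvPolynomial.eval z (w t)) t := by
        rw [← hA, ← RingHom.map_adjugate]
        simp only [Matrix.mulVec, dotProduct, map_sum, map_mul]
        rfl
      have h2 : (fun t => MvPolynomial.eval z (w t)) =
          (-A₀.det⁻¹) • A₀.mulVec (fun t' => c (e.symm (Sum.inl t'))) := by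
        funext t
        have h3 := hc t
        rw [← Equiv.sum_comp e.symm, Fintype.sum_sum_type] at h3
        have h4 : MvPolynomial.eval z (w t) = A₀.det⁻¹ *
            ∑ j, MvPolynomial.eval a (L t (e.symm (Sum.inr j))) * c (e.symm (Sum.inr j)) := by
          simp only [w, map_sum, map_mul, hℓ, MvPolynomial.eval_X, z, Sum.elim_inr, Finset.mul_sum]
          refine Finset.sum_congr rfl fun j _ => ?_
          ring
        rw [h4, ← neg_eq_of_add_eq_zero_right h3]
        simp only [Matrix.mulVec, dotProduct, Pi.smul_apply, smul_eq_mul, hA₀, Matrix.of_apply]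
        ring
      simp only [Sum.elim_inl, map_neg]
      rw [h1, h2, Matrix.mulVec_smul, Matrix.mulVec_mulVec, Matrix.adjugate_mul,
        Matrix.smul_mulVec, Matrix.one_mulVec]
      simp only [Pi.smul_apply, smul_eq_mul]
      field_simp
  rw [← hgz, ← eval_aeval, hΦ, map_zero]

/-- The vectors orthogonal to a family of linearly independent vectors that depends polynomially
on fewer parameters than it has members satisfy a nontrivial polynomial equation. -/
theorem exists_polynomial_of_linearIndependent {ν τ σ : Type} [Fintype ν] [Fintype τ] [Fintype σ]
    (hcard : Fintype.card σ < Fintype.card τ) (L : τ → ν → MvPolynomial σ K) :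
    ∃ Φ : MvPolynomial ν K, Φ ≠ 0 ∧ ∀ (c : ν → K) (a : σ → K),
      LinearIndependent K (fun t m => MvPolynomial.eval a (L t m)) →
      (∀ t, ∑ m, MvPolynomial.eval a (L t m) * c m = 0) → MvPolynomial.eval c Φ = 0 := by
  classical
  choose Φ h0 hΦ using fun e : ν ≃ τ ⊕ Fin (Fintype.card ν - Fintype.card τ) =>
    exists_polynomial_of_equiv hcard L e
  refine ⟨∏ e, Φ e, Finset.prod_ne_zero_iff.2 fun e _ => h0 e, fun c a hli hc => ?_⟩
  obtain ⟨e, he⟩ := exists_equiv_det_ne_zero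
    (Matrix.of fun t m => MvPolynomial.eval a (L t m)) hli
  rw [map_prod]
  exact Finset.prod_eq_zero (Finset.mem_univ e) (hΦ e c a he hc)

end Elimination

section GenericForms

variable (K : Type u) [Field K] (n d : ℕ)

/-- The exponents of the monomials of degree `d` in `n` variables. -/
abbrev FormIndex : Type := {m : Fin n →₀ ℕ // m ∈ Finset.finsuppAntidiag Finset.univ d}

/-- The property holds on a nonempty principal open subset of the space of forms. In contrast to
`HoldsForGenericForm`, only the coefficients of monomials of the given degree are used. -/
def HoldsGenerically (p : MvPolynomial (Fin n) K → Prop) : Prop :=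
  ∃ Φ : MvPolynomial (FormIndex n d) K, Φ ≠ 0 ∧ ∀ f : MvPolynomial (Fin n) K,
    f.IsHomogeneous d → MvPolynomial.eval (fun m => f.coeff m.1) Φ ≠ 0 → p f

variable {K n d}

theorem mem_finsuppAntidiag_univ {m : Fin n →₀ ℕ} :
    m ∈ Finset.finsuppAntidiag Finset.univ d ↔ m.degree = d := by
  simp [Finset.mem_finsuppAntidiag, Finsupp.degree_eq_sum]

theorem sum_formIndex {f : MvPolynomial (Fin n) K} (hf : f.IsHomogeneous d) :
    ∑ m : FormIndex n d, f.coeff m.1 • MvPolynomial.monomial m.1 (1 : K) = f := by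
  rw [Finset.sum_coe_sort (Finset.finsuppAntidiag Finset.univ d)
    (fun m => f.coeff m • MvPolynomial.monomial m (1 : K))]
  conv_rhs => rw [f.as_sum]
  refine (Finset.sum_subset_zero_on_sdiff (fun m hm => ?_) (fun m hm => ?_) (fun m _ => ?_)).symm
  · rw [mem_finsuppAntidiag_univ]
    have h := hf (MvPolynomial.mem_support_iff.1 hm)
    rwa [Finsupp.degree_eq_weight_one]
  · rw [MvPolynomial.notMem_support_iff.1 (Finset.mem_sdiff.1 hm).2, zero_smul]
  · rw [MvPolynomial.smul_monomial, smul_eq_mul, mul_one]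

theorem exists_form (c : FormIndex n d → K) : ∃ f : MvPolynomial (Fin n) K,
    f.IsHomogeneous d ∧ ∀ m : FormIndex n d, f.coeff m.1 = c m := by
  classical
  refine ⟨∑ m, MvPolynomial.monomial m.1 (c m), ?_, fun m => ?_⟩
  · exact MvPolynomial.IsHomogeneous.sum _ _ _ fun m _ =>
      MvPolynomial.isHomogeneous_monomial _ (mem_finsuppAntidiag_univ.1 m.2)
  · rw [MvPolynomial.coeff_sum, Finset.sum_eq_single m]
    · simp
    · intro m' _ h
      rw [MvPolynomial.coeff_monomial, if_neg fun h' => h (Subtype.ext h')]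
    · simp

namespace HoldsGenerically

variable {p q : MvPolynomial (Fin n) K → Prop}

theorem mono (h : HoldsGenerically K n d p)
    (hpq : ∀ f : MvPolynomial (Fin n) K, f.IsHomogeneous d → p f → q f) :
    HoldsGenerically K n d q := by
  obtain ⟨Φ, h0, hΦ⟩ := h
  exact ⟨Φ, h0, fun f hf hne => hpq f hf (hΦ f hf hne)⟩

theorem and (hp : HoldsGenerically K n d p) (hq : HoldsGenerically K n d q) :
    HoldsGenerically K n d fun f => p f ∧ q f := by
  obtain ⟨Φ, h0, hΦ⟩ := hp
  obtain ⟨Ψ, h1, hΨ⟩ := hq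
  refine ⟨Φ * Ψ, mul_ne_zero h0 h1, fun f hf hne => ?_⟩
  rw [map_mul] at hne
  exact ⟨hΦ f hf (left_ne_zero_of_mul hne), hΨ f hf (right_ne_zero_of_mul hne)⟩

theorem forall_of_finite {ι : Type} [Finite ι] {p : ι → MvPolynomial (Fin n) K → Prop}
    (h : ∀ j, HoldsGenerically K n d (p j)) : HoldsGenerically K n d fun f => ∀ j, p j f := by
  let _ : Fintype ι := Fintype.ofFinite ι
  choose Φ h0 hΦ using h
  refine ⟨∏ j, Φ j, Finset.prod_ne_zero_iff.2 fun j _ => h0 j, fun f hf hne j => ?_⟩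
  rw [map_prod] at hne
  exact hΦ j f hf (Finset.prod_ne_zero_iff.1 hne j (Finset.mem_univ j))

theorem imp {P : Prop} (h : P → HoldsGenerically K n d p) :
    HoldsGenerically K n d fun f => P → p f := by
  by_cases hP : P
  · exact (h hP).mono fun f _ hf _ => hf
  · exact ⟨1, one_ne_zero, fun f _ _ h => absurd h hP⟩

theorem holdsForGenericForm [Infinite K] (h : HoldsGenerically K n d p) :
    HoldsForGenericForm K n d p := by
  obtain ⟨Φ, h0, hΦ⟩ := h
  have h1 : ∀ f : MvPolynomial (Fin n) K,
      MvPolynomial.eval (fun m => f.coeff m) (MvPolynomial.rename Subtype.val Φ) =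
      MvPolynomial.eval (fun m : FormIndex n d => f.coeff m.1) Φ := by
    intro f
    rw [MvPolynomial.eval_rename]
    rfl
  refine ⟨MvPolynomial.rename Subtype.val Φ, ?_, fun f hf hne => hΦ f hf (by rwa [← h1])⟩
  obtain ⟨c, hc⟩ : ∃ c, MvPolynomial.eval c Φ ≠ 0 := by
    by_contra! h
    exact h0 (MvPolynomial.funext fun c => by rw [h, map_zero])
  obtain ⟨f, hf, hfc⟩ := exists_form c
  refine ⟨f, hf, ?_⟩
  rw [h1]
  simpa only [hfc] using hc

end HoldsGenerically

/-- A generic form is not annihilated by all the members of a family of linear functionals which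
depends polynomially on fewer parameters than it has members, for those values of the parameters
at which the functionals are linearly independent on the forms. -/
theorem holdsGenerically_of_functionals {τ σ : Type} [Fintype τ] [Fintype σ]
    (hcard : Fintype.card σ < Fintype.card τ)
    (lam : τ → (σ → K) → MvPolynomial (Fin n) K →ₗ[K] K)
    (hlam : ∀ t g, ∃ q : MvPolynomial σ K, ∀ a, lam t a g = MvPolynomial.eval a q) :
    HoldsGenerically K n d fun f => ∀ a,
      (∀ c : τ → K, (∀ g : MvPolynomial (Fin n) K, g.IsHomogeneous d →
        ∑ t, c t * lam t a g = 0) → c = 0) → ∃ t, lam t a f ≠ 0 := by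
  choose q hq using hlam
  obtain ⟨Φ, h0, hΦ⟩ := exists_polynomial_of_linearIndependent hcard
    fun t (m : FormIndex n d) => q t (MvPolynomial.monomial m.1 1)
  refine ⟨Φ, h0, fun f hf hne a hind => ?_⟩
  by_contra! h
  refine hne (hΦ _ a ?_ fun t => ?_)
  · rw [Fintype.linearIndependent_iff]
    intro c hc
    refine congrFun (hind c fun g hg => ?_)
    rw [← sum_formIndex hg]
    simp only [map_sum, map_smul, smul_eq_mul, Finset.mul_sum]
    rw [Finset.sum_comm]
    refine Finset.sum_eq_zero fun m _ => ?_
    have h1 := congrFun hc m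
    simp only [← hq, Finset.sum_apply, Pi.smul_apply, smul_eq_mul, Pi.zero_apply] at h1
    calc _ = g.coeff m.1 * ∑ t, c t * lam t a (MvPolynomial.monomial m.1 1) := by
          rw [Finset.mul_sum]
          exact Finset.sum_congr rfl fun t _ => by ring
      _ = 0 := by rw [h1, mul_zero]
  · have h1 := h t
    rw [← sum_formIndex hf] at h1
    simp only [map_sum, map_smul, smul_eq_mul] at h1
    simp only [← hq]
    rw [← h1]
    exact Finset.sum_congr rfl fun m _ => mul_comm _ _

end GenericForms

/-! ### Linear forms and their differentials -/

section LinearForms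

variable {K : Type u} [Field K] {n : ℕ}

theorem eval_smul_of_isHomogeneous {σ : Type} {f : MvPolynomial σ K} {d : ℕ}
    (hf : f.IsHomogeneous d) (c : K) (x : σ → K) :
    MvPolynomial.eval (c • x) f = c ^ d * MvPolynomial.eval x f := by
  rw [MvPolynomial.eval_eq, MvPolynomial.eval_eq, Finset.mul_sum]
  refine Finset.sum_congr rfl fun m hm => ?_
  have h : m.degree = d := by
    rw [Finsupp.degree_eq_weight_one]
    exact hf (MvPolynomial.mem_support_iff.1 hm)
  simp only [Pi.smul_apply, smul_eq_mul, mul_pow, Finset.prod_mul_distrib,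
    Finset.prod_pow_eq_pow_sum]
  rw [← h, Finsupp.degree_apply]
  ring

/-- The linear functional as a polynomial. -/
def linForm (φ : (Fin n → K) →ₗ[K] K) : MvPolynomial (Fin n) K :=
  ∑ k, MvPolynomial.C (φ (Pi.single k 1)) * MvPolynomial.X k

theorem sum_apply_single (φ : (Fin n → K) →ₗ[K] K) (x : Fin n → K) :
    ∑ k, φ (Pi.single k 1) * x k = φ x := by
  have hx : x = ∑ k, x k • (Pi.single k 1 : Fin n → K) := by
    funext j
    simp [Finset.sum_apply, Pi.single_apply]
  conv_rhs => rw [hx, map_sum]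
  refine Finset.sum_congr rfl fun k _ => ?_
  rw [map_smul, smul_eq_mul, mul_comm]

@[simp] theorem eval_linForm (φ : (Fin n → K) →ₗ[K] K) (x : Fin n → K) :
    MvPolynomial.eval x (linForm φ) = φ x := by
  simp [linForm, sum_apply_single]

@[simp] theorem dirDeriv_linForm (φ : (Fin n → K) →ₗ[K] K) (u : Fin n → K) :
    dirDeriv u (linForm φ) = MvPolynomial.C (φ u) := by
  rw [dirDeriv_apply, ← sum_apply_single, map_sum]
  refine Finset.sum_congr rfl fun k _ => ?_
  rw [linForm, map_sum, Finset.sum_eq_single k]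
  · simp [mul_comm]
  · intro l _ hl
    rw [MvPolynomial.pderiv_C_mul, MvPolynomial.pderiv_X_of_ne hl, mul_zero]
  · simp

theorem isHomogeneous_linForm (φ : (Fin n → K) →ₗ[K] K) : (linForm φ).IsHomogeneous 1 :=
  MvPolynomial.IsHomogeneous.sum _ _ _ fun _ _ => MvPolynomial.isHomogeneous_C_mul_X _ _

@[simp] theorem gradAt_linForm (φ : (Fin n → K) →ₗ[K] K) (x u : Fin n → K) :
    gradAt (linForm φ) x u = φ u := by
  simp [gradAt_apply]

theorem gradAt_mul (f g : MvPolynomial (Fin n) K) (x u : Fin n → K) :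
    gradAt (f * g) x u = MvPolynomial.eval x f * gradAt g x u +
      MvPolynomial.eval x g * gradAt f x u := by
  simp [gradAt_apply]

/-- The differential of a product of linear forms normalized at `x`. -/
theorem gradAt_prod_linForm {ι : Type} (s : Finset ι) (φ : ι → (Fin n → K) →ₗ[K] K)
    {x : Fin n → K} (hφ : ∀ j ∈ s, φ j x = 1) (u : Fin n → K) :
    gradAt (∏ j ∈ s, linForm (φ j)) x u = (∑ j ∈ s, φ j) u := by
  classical
  induction s using Finset.induction_on with
  | empty => simp [gradAt_apply]
  | insert j s hj ih =>
    have h1 : ∀ k ∈ s, φ k x = 1 := fun k hk => hφ k (Finset.mem_insert_of_mem hk)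
    rw [Finset.prod_insert hj, Finset.sum_insert hj, gradAt_mul, ih h1, map_prod,
      Finset.prod_eq_one fun k hk => by rw [eval_linForm, h1 k hk], eval_linForm,
      hφ j (Finset.mem_insert_self j s), gradAt_linForm, LinearMap.add_apply]
    ring

theorem gradAt_sq_mul (f g : MvPolynomial (Fin n) K) {x : Fin n → K}
    (hf : MvPolynomial.eval x f = 0) (u : Fin n → K) : gradAt (f ^ 2 * g) x u = 0 := by
  simp [pow_two, gradAt_mul, hf]

/-- The linear map `v ↦ η v • x + v` has determinant `η x + 1`, so it is injective if this is not
zero. Differentials of products of linear forms, with all factors but one normalized at `x`, are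
functionals on the image of this map. -/
theorem eq_zero_of_smul_add_eq_zero {x v : Fin n → K} {η : (Fin n → K) →ₗ[K] K} {d : ℕ} [CharZero K]
    (hη : η x + 1 = d) (hd : d ≠ 0) (h : η v • x + v = 0) : v = 0 := by
  have h1 := congrArg η h
  rw [map_add, map_smul, smul_eq_mul, map_zero] at h1
  have h2 : η v * (d : K) = 0 := by
    rw [← hη]; linear_combination h1
  have h3 : η v = 0 := (mul_eq_zero.1 h2).resolve_right (Nat.cast_ne_zero.2 hd)
  rwa [h3, zero_smul, zero_add] at h

theorem eq_zero_of_forall_linearMap {v : Fin n → K} (h : ∀ δ : (Fin n → K) →ₗ[K] K, δ v = 0) :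
    v = 0 := by
  funext k
  exact h (LinearMap.proj k)

/-- The functional `g ↦ D_u g(x)` on polynomials. -/
def gradFunctional (x u : Fin n → K) : MvPolynomial (Fin n) K →ₗ[K] K where
  toFun g := gradAt g x u
  map_add' f g := by simp [gradAt_apply]
  map_smul' c f := by simp [gradAt_apply]

@[simp] theorem gradFunctional_apply (x u : Fin n → K) (g : MvPolynomial (Fin n) K) :
    gradFunctional x u g = gradAt g x u := rfl

/-- The functional `g ↦ D_v D_u g(x)` on polynomials. -/
def hessFunctional (x u v : Fin n → K) : MvPolynomial (Fin n) K →ₗ[K] K where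
  toFun g := gradAt (dirDeriv u g) x v
  map_add' f g := by simp [gradAt_apply]
  map_smul' c f := by simp [gradAt_apply]

@[simp] theorem hessFunctional_apply (x u v : Fin n → K) (g : MvPolynomial (Fin n) K) :
    hessFunctional x u v g = gradAt (dirDeriv u g) x v := rfl

theorem hessFunctional_comm (x u v : Fin n → K) :
    hessFunctional x u v = hessFunctional x v u := by
  refine LinearMap.ext fun g => ?_
  simp only [hessFunctional_apply, gradAt_apply]
  rw [dirDeriv_comm]

end LinearForms

section PolynomialFunctions

variable {K : Type u} [Field K] {σ : Type}

/-- A function of finitely many parameters given by a polynomial. -/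
def IsPolynomialFunction (F : (σ → K) → K) : Prop :=
  ∃ q : MvPolynomial σ K, ∀ a, F a = MvPolynomial.eval a q

namespace IsPolynomialFunction

theorem const (c : K) : IsPolynomialFunction fun _ : σ → K => c :=
  ⟨MvPolynomial.C c, fun a => by simp⟩

theorem apply (s : σ) : IsPolynomialFunction fun a : σ → K => a s :=
  ⟨MvPolynomial.X s, fun a => by simp⟩

theorem mul {F G : (σ → K) → K} (hF : IsPolynomialFunction F) (hG : IsPolynomialFunction G) :
    IsPolynomialFunction fun a => F a * G a := by
  obtain ⟨p, hp⟩ := hF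
  obtain ⟨q, hq⟩ := hG
  exact ⟨p * q, fun a => by simp [hp, hq]⟩

theorem sum {ι : Type} (s : Finset ι) {F : ι → (σ → K) → K}
    (hF : ∀ j, IsPolynomialFunction (F j)) : IsPolynomialFunction fun a => ∑ j ∈ s, F j a := by
  choose p hp using hF
  exact ⟨∑ j ∈ s, p j, fun a => by simp [hp]⟩

theorem insertNth {m : ℕ} (k : Fin (m + 1)) {c : (σ → K) → K} {F : Fin m → (σ → K) → K}
    (hc : IsPolynomialFunction c) (hF : ∀ j, IsPolynomialFunction (F j)) (j : Fin (m + 1)) :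
    IsPolynomialFunction fun a => k.insertNth (α := fun _ => K) (c a) (fun l => F l a) j := by
  refine Fin.succAboveCases k ?_ (fun l => ?_) j
  · simpa using hc
  · simpa using hF l

variable {n : ℕ} {x u v : (σ → K) → Fin n → K}

theorem eval (g : MvPolynomial (Fin n) K) (hx : ∀ j, IsPolynomialFunction fun a => x a j) :
    IsPolynomialFunction fun a => MvPolynomial.eval (x a) g := by
  choose p hp using hx
  exact ⟨MvPolynomial.aeval p g, fun a => (congrArg (fun y => MvPolynomial.eval y g)
    (funext fun j => hp j a)).trans (eval_aeval p g a).symm⟩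

theorem gradAt (g : MvPolynomial (Fin n) K) (hx : ∀ j, IsPolynomialFunction fun a => x a j)
    (hu : ∀ j, IsPolynomialFunction fun a => u a j) :
    IsPolynomialFunction fun a => FanoDouble.gradAt g (x a) (u a) := by
  simp only [gradAt_apply, dirDeriv_apply, map_sum, map_mul, MvPolynomial.eval_C]
  exact sum _ fun j => (hu j).mul (eval _ hx)

theorem hessAt (g : MvPolynomial (Fin n) K) (hx : ∀ j, IsPolynomialFunction fun a => x a j)
    (hu : ∀ j, IsPolynomialFunction fun a => u a j)
    (hv : ∀ j, IsPolynomialFunction fun a => v a j) :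
    IsPolynomialFunction fun a => FanoDouble.gradAt (dirDeriv (u a) g) (x a) (v a) := by
  simp only [gradAt_apply, dirDeriv_apply, map_sum, MvPolynomial.pderiv_C_mul, map_mul,
    MvPolynomial.eval_C]
  exact sum _ fun j => sum _ fun l => (hv l).mul ((hu j).mul (eval _ hx))

end IsPolynomialFunction

end PolynomialFunctions

/-! ### Smoothness of generic hypersurfaces -/

section Smoothness

variable {K : Type u} [Field K] [CharZero K]

/-- A generic form defines a smooth hypersurface: the `n + 1` partial derivatives at a point
depend on the `n` affine coordinates of the point. -/
theorem holdsGenerically_isSmoothHypersurface (n d : ℕ) (hd : 2 ≤ d) :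
    HoldsGenerically K (n + 1) d IsSmoothHypersurface := by
  refine (HoldsGenerically.forall_of_finite fun i : Fin (n + 1) =>
    holdsGenerically_of_functionals (K := K) (d := d) (τ := Fin (n + 1)) (σ := Fin n) (by simp)
      (fun k a => gradFunctional (i.insertNth (α := fun _ => K) 1 a) (Pi.single k 1))
      fun k g => ?_).mono fun f hf h x hx hfx => ?_
  · exact IsPolynomialFunction.gradAt g (fun j => IsPolynomialFunction.insertNth i
      (IsPolynomialFunction.const 1) (fun l => IsPolynomialFunction.apply l) j)
      (fun j => IsPolynomialFunction.const _)
  · obtain ⟨i, hi⟩ := Function.ne_iff.1 hx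
    set y := (x i)⁻¹ • x with hy
    have hyi : y i = 1 := by simp only [hy, Pi.smul_apply, smul_eq_mul]; exact inv_mul_cancel₀ hi
    have hins : i.insertNth (α := fun _ => K) 1 (i.removeNth y) = y := by
      rw [← hyi, Fin.insertNth_self_removeNth]
    obtain ⟨k, hk⟩ := h i (i.removeNth y) (by
      intro c hc
      rw [hins] at hc
      have hc' : ∀ g : MvPolynomial (Fin (n + 1)) K, g.IsHomogeneous d → gradAt g y c = 0 := by
        intro g hg
        rw [← sum_apply_single (gradAt g y) c, ← hc g hg]
        exact Finset.sum_congr rfl fun k _ => mul_comm _ _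
      let p : (Fin (n + 1) → K) →ₗ[K] K := LinearMap.proj i
      refine eq_zero_of_smul_add_eq_zero (x := y) (η := ((d - 1 : ℕ) : K) • p) (d := d) ?_
        (by omega) ?_
      · simp only [LinearMap.smul_apply, p, LinearMap.proj_apply, hyi, smul_eq_mul, mul_one]
        rw [Nat.cast_sub (by omega)]; simp
      · refine eq_zero_of_forall_linearMap fun δ => ?_
        have h1 := hc' ((∏ _j ∈ Finset.range (d - 1), linForm p) * linForm δ) (by
          have h2 := (MvPolynomial.IsHomogeneous.prod (Finset.range (d - 1))
            (fun _ => linForm p) (fun _ => 1) fun _ _ => isHomogeneous_linForm p).mul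
            (isHomogeneous_linForm δ)
          have h3 : ∑ _j ∈ Finset.range (d - 1), 1 + 1 = d := by simp; omega
          rwa [h3] at h2)
        rw [gradAt_mul, gradAt_prod_linForm _ _ (fun _ _ => hyi), map_prod,
          Finset.prod_eq_one fun _ _ => by rw [eval_linForm]; exact hyi] at h1
        simp only [eval_linForm, gradAt_linForm, one_mul, Finset.sum_const, Finset.card_range,
          LinearMap.smul_apply, nsmul_eq_mul] at h1
        rw [map_add, map_smul, smul_eq_mul, LinearMap.smul_apply, smul_eq_mul]
        linear_combination h1)
    rw [hins, gradFunctional_apply, gradAt_apply, dirDeriv_single, hy,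
      eval_smul_of_isHomogeneous hf.pderiv] at hk
    exact ⟨k, right_ne_zero_of_mul hk⟩

end Smoothness

/-! ### Linear subspaces as graphs -/

section Graph

variable {K : Type u} [Field K] {n m q : ℕ}

/-- The parametrization of a linear subspace which is the graph of the matrix `A`, where the
coordinates are divided into free ones and dependent ones. -/
def graphMap (e : Fin n ≃ Fin m ⊕ Fin q) (A : Fin q → Fin m → K) :
    (Fin m → K) →ₗ[K] (Fin n → K) :=
  LinearMap.pi fun j => Sum.elim (fun a => LinearMap.proj a)
    (fun b => ∑ a, A b a • LinearMap.proj a) (e j)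

variable (e : Fin n ≃ Fin m ⊕ Fin q) (A : Fin q → Fin m → K)

theorem graphMap_inl (z : Fin m → K) (a : Fin m) : graphMap e A z (e.symm (Sum.inl a)) = z a := by
  simp [graphMap]

theorem graphMap_inr (z : Fin m → K) (b : Fin q) :
    graphMap e A z (e.symm (Sum.inr b)) = ∑ a, A b a * z a := by
  simp [graphMap]

theorem graphMap_injective : Function.Injective (graphMap e A) := by
  intro z z' h
  funext a
  rw [← graphMap_inl e A z, h, graphMap_inl]

/-- Every linear subspace is a graph. -/
theorem exists_range_graphMap (P : Submodule K (Fin n → K)) (hP : Module.finrank K P = m)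
    (hn : n = m + q) : ∃ (e : Fin n ≃ Fin m ⊕ Fin q) (A : Fin q → Fin m → K),
      LinearMap.range (graphMap e A) = P := by
  let b : Module.Basis (Fin m) K P := Module.finBasisOfFinrankEq K P hP
  have h1 := exists_equiv_det_ne_zero (Matrix.of fun a j => (b a : Fin n → K) j)
    (b.linearIndependent.map' P.subtype (by simp))
  rw [Fintype.card_fin, Fintype.card_fin, show n - m = q by omega] at h1
  obtain ⟨e, he⟩ := h1
  -- the free coordinates on `P`
  let φ : P →ₗ[K] (Fin m → K) := LinearMap.pi fun a => (LinearMap.proj (e.symm (Sum.inl a))) ∘ₗ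
    P.subtype
  have hφ : ∀ x a, φ x a = (x : Fin n → K) (e.symm (Sum.inl a)) := fun x a => rfl
  have hinj : Function.Injective φ := by
    rw [injective_iff_map_eq_zero]
    intro x hx
    rw [← b.sum_repr x] at hx ⊢
    refine Finset.sum_eq_zero fun a _ => ?_
    have h2 : (Matrix.of fun a a' => (b a : Fin n → K) (e.symm (Sum.inl a'))).vecMul
        (b.repr x) = 0 := by
      funext a
      have h3 := congrFun hx a
      rw [hφ] at h3
      simp only [Submodule.coe_sum, Submodule.coe_smul, Finset.sum_apply, Pi.smul_apply,
        smul_eq_mul, Pi.zero_apply] at h3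
      exact h3
    have h4 := Matrix.eq_zero_of_vecMul_eq_zero he h2
    rw [congrFun h4 a]
    simp
  let ψ : P ≃ₗ[K] (Fin m → K) :=
    LinearEquiv.ofInjectiveOfFinrankEq φ hinj (by rw [hP, Module.finrank_fin_fun])
  have hψ : ∀ x a, ψ x a = (x : Fin n → K) (e.symm (Sum.inl a)) := fun x a => rfl
  let A : Fin q → Fin m → K := fun b a => (ψ.symm (Pi.single a 1) : Fin n → K) (e.symm (Sum.inr b))
  have key : ∀ z, graphMap e A z = (ψ.symm z : Fin n → K) := by
    intro z
    funext j
    obtain ⟨o, rfl⟩ := e.symm.surjective j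
    cases o with
    | inl a => rw [graphMap_inl, ← hψ, LinearEquiv.apply_symm_apply]
    | inr b =>
      rw [graphMap_inr]
      have h2 := sum_apply_single ((LinearMap.proj (e.symm (Sum.inr b)) : (Fin n → K) →ₗ[K] K) ∘ₗ
        P.subtype ∘ₗ ψ.symm.toLinearMap) z
      exact h2
  refine ⟨e, A, ?_⟩
  ext x
  rw [LinearMap.mem_range]
  constructor
  · rintro ⟨z, rfl⟩
    rw [key]
    exact (ψ.symm z).2
  · intro hx
    exact ⟨ψ ⟨x, hx⟩, by rw [key, LinearEquiv.symm_apply_apply]⟩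

theorem IsPolynomialFunction.graphMap {σ : Type} {A : (σ → K) → Fin q → Fin m → K}
    {z : (σ → K) → Fin m → K} (hA : ∀ b a, IsPolynomialFunction fun s => A s b a)
    (hz : ∀ a, IsPolynomialFunction fun s => z s a) (j : Fin n) :
    IsPolynomialFunction fun s => FanoDouble.graphMap e (A s) (z s) j := by
  obtain ⟨o, rfl⟩ := e.symm.surjective j
  cases o with
  | inl a => simpa only [graphMap_inl] using hz a
  | inr b =>
    simp only [graphMap_inr]
    exact IsPolynomialFunction.sum _ fun a => (hA b a).mul (hz a)

end Graph

/-! ### Hessian forms of restrictions -/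

section Hessians

variable {K : Type u} [Field K]

/-- The second derivatives at `x` of the product of a power of a linear form and of two
further linear forms. -/
theorem gradAt_dirDeriv_pow_mul {n : ℕ} (h φ ψ : (Fin n → K) →ₗ[K] K) (k : ℕ) {x : Fin n → K}
    (hx : h x = 1) (u v : Fin n → K) :
    gradAt (dirDeriv u (linForm h ^ k * (linForm φ * linForm ψ))) x v =
      φ u * ψ v + φ v * ψ u + k * h u * (φ v * ψ x + φ x * ψ v) +
      k * h v * (φ u * ψ x + φ x * ψ u) + k * (k - 1) * h u * h v * (φ x * ψ x) := by
  have hpow : ∀ (k : ℕ) (w : Fin n → K), dirDeriv w (linForm h ^ k) =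
      MvPolynomial.C (k * h w) * linForm h ^ (k - 1) := by
    intro k w
    rw [Derivation.leibniz_pow, dirDeriv_linForm]
    simp only [smul_eq_mul, nsmul_eq_mul, map_mul, map_natCast]
    ring
  have hk : (k : K) * ((k - 1 : ℕ) : K) = k * (k - 1) := by
    cases k with
    | zero => simp
    | succ k => simp
  rw [gradAt_apply]
  simp only [Derivation.leibniz, hpow, dirDeriv_linForm, smul_eq_mul, map_add, map_mul,
    MvPolynomial.eval_C, eval_linForm, map_pow, hx, one_pow, mul_one, one_mul,
    MvPolynomial.derivation_C, mul_zero, add_zero, zero_add]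
  linear_combination (h u * h v * φ x * ψ x) * hk

variable [CharZero K]

/-- The second derivatives at a point of a linear subspace, in the directions of a basis of this
subspace that contains the point, are linearly independent functionals on forms. They are indexed by
unordered pairs of basis vectors. -/
theorem hessFunctional_linearIndependent {n m d : ℕ} (hd : 2 ≤ d)
    (e : Fin n ≃ Fin (m + 1) ⊕ Fin 2) (A : Fin 2 → Fin (m + 1) → K) (a₀ : Fin (m + 1))
    {z : Fin (m + 1) → K} (hz : z a₀ = 1) (u : Fin (m + 1) → Fin n → K)
    (hu : ∀ a, u a = if a = a₀ then graphMap e A z else graphMap e A (Pi.single a 1))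
    (lam : Sym2 (Fin (m + 1)) → MvPolynomial (Fin n) K →ₗ[K] K)
    (hlam : ∀ a b, lam s(a, b) = hessFunctional (graphMap e A z) (u a) (u b))
    (c : Sym2 (Fin (m + 1)) → K)
    (hc : ∀ g : MvPolynomial (Fin n) K, g.IsHomogeneous d → ∑ t, c t * lam t g = 0) : c = 0 := by
  obtain ⟨k, rfl⟩ := Nat.exists_eq_add_of_le' hd
  set x := graphMap e A z with hx
  let φ : Fin (m + 1) → (Fin n → K) →ₗ[K] K := fun a => LinearMap.proj (e.symm (Sum.inl a))
  have hφ : ∀ a w, φ a (graphMap e A w) = w a := fun a w => graphMap_inl e A w a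
  -- the functionals dual to the directions
  let ψ : Fin (m + 1) → (Fin n → K) →ₗ[K] K := fun a =>
    if a = a₀ then φ a₀ else φ a - z a • φ a₀
  have hψ : ∀ a b, ψ a (u b) = if a = b then 1 else 0 := by
    intro a b
    rw [hu]
    by_cases ha : a = a₀ <;> by_cases hb : b = a₀
    · simp [ψ, ha, hb, hx, hφ, hz]
    · simp [ψ, ha, hb, hφ, Ne.symm hb]
    · simp [ψ, ha, hb, hx, hφ, hz]
    · simp [ψ, ha, hb, hφ, Pi.single_apply, Ne.symm hb]
  have hux : u a₀ = x := by rw [hu, if_pos rfl]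
  have hval : ∀ a b p q, ∃ C : K, C ≠ 0 ∧
      lam s(p, q) (linForm (ψ a₀) ^ k * (linForm (ψ a) * linForm (ψ b))) =
        C * (ψ a (u p) * ψ b (u q) + ψ a (u q) * ψ b (u p)) := by
    intro a b p q
    have hψx : ∀ a, ψ a x = if a = a₀ then 1 else 0 := fun a => by rw [← hux, hψ]
    have h1 : (k : K) + 1 ≠ 0 := by exact_mod_cast Nat.succ_ne_zero k
    have h2 : (k : K) + 2 ≠ 0 := by exact_mod_cast Nat.succ_ne_zero (k + 1)
    rw [hlam, hessFunctional_apply, gradAt_dirDeriv_pow_mul _ _ _ _ (by rw [hψx, if_pos rfl])]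
    by_cases ha : a = a₀ <;> by_cases hb : b = a₀
    · refine ⟨(k + 2) * (k + 1) / 2, div_ne_zero (mul_ne_zero h2 h1) two_ne_zero, ?_⟩
      simp only [hψx, ha, hb, if_true]
      field_simp
      ring
    · refine ⟨k + 1, h1, ?_⟩
      simp only [hψx, ha, hb, if_true, if_false]
      ring
    · refine ⟨k + 1, h1, ?_⟩
      simp only [hψx, ha, hb, if_true, if_false]
      ring
    · refine ⟨1, one_ne_zero, ?_⟩
      simp only [hψx, ha, hb, if_false]
      ring
  funext t
  induction t using Sym2.ind with
  | _ a b =>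
  have h1 := hc (linForm (ψ a₀) ^ k * (linForm (ψ a) * linForm (ψ b))) (by
    have h2 := ((isHomogeneous_linForm (ψ a₀)).pow k).mul
      ((isHomogeneous_linForm (ψ a)).mul (isHomogeneous_linForm (ψ b)))
    rwa [one_mul] at h2)
  rw [Finset.sum_eq_single s(a, b)] at h1
  · obtain ⟨C, hC, h2⟩ := hval a b a b
    rw [h2] at h1
    have h3 : ψ a (u a) * ψ b (u b) + ψ a (u b) * ψ b (u a) ≠ 0 := by
      simp only [hψ, if_true]
      by_cases hab : a = b
      · simp only [hab, if_true]
        norm_num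
      · simp [hab]
    exact (mul_eq_zero.1 h1).resolve_right (mul_ne_zero hC h3)
  · intro t _ ht
    induction t using Sym2.ind with
    | _ p q =>
    obtain ⟨C, -, h2⟩ := hval a b p q
    rw [h2]
    have h3 : ψ a (u p) * ψ b (u q) + ψ a (u q) * ψ b (u p) = 0 := by
      rw [Ne, Sym2.eq_iff, not_or, not_and, not_and] at ht
      simp only [hψ]
      by_cases h4 : a = p <;> by_cases h5 : b = q <;> by_cases h6 : a = q <;>
        by_cases h7 : b = p <;> simp_all
    rw [h3, mul_zero, mul_zero]
  · simp

/-- For a generic form the Hessian forms of the restrictions to the linear subspaces of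
codimension two do not vanish anywhere: the `(m + 2).choose 2` second derivatives depend on
`2 * (m + 1) + m` parameters, those of the subspace and of the point. -/
theorem holdsGenerically_hasNonzeroHessians {m d : ℕ} (hd : 2 ≤ d)
    (hm : 3 * m + 2 < (m + 2).choose 2) :
    HoldsGenerically K (m + 3) d fun f => ∀ P : Submodule K (Fin (m + 3) → K),
      Module.finrank K P = m + 1 → HasNonzeroHessians f P := by
  -- the parameters: the matrix of the subspace, and the affine coordinates of the point
  let σ : Type := (Fin 2 × Fin (m + 1)) ⊕ Fin m
  let A : (σ → K) → Fin 2 → Fin (m + 1) → K := fun s b a => s (Sum.inl (b, a))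
  let z : Fin (m + 1) → (σ → K) → Fin (m + 1) → K := fun a₀ s =>
    a₀.insertNth (α := fun _ => K) 1 fun l => s (Sum.inr l)
  let u : (Fin (m + 3) ≃ Fin (m + 1) ⊕ Fin 2) → Fin (m + 1) → (σ → K) → Fin (m + 1) →
      Fin (m + 3) → K := fun e a₀ s a =>
    if a = a₀ then graphMap e (A s) (z a₀ s) else graphMap e (A s) (Pi.single a 1)
  let lam : (Fin (m + 3) ≃ Fin (m + 1) ⊕ Fin 2) → Fin (m + 1) → Sym2 (Fin (m + 1)) → (σ → K) →
      MvPolynomial (Fin (m + 3)) K →ₗ[K] K := fun e a₀ t s =>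
    Sym2.lift ⟨fun a b => hessFunctional (graphMap e (A s) (z a₀ s)) (u e a₀ s a) (u e a₀ s b),
      fun a b => hessFunctional_comm _ _ _⟩ t
  have hA : ∀ b a, IsPolynomialFunction fun s => A s b a := fun b a =>
    IsPolynomialFunction.apply _
  have hz : ∀ a₀ a, IsPolynomialFunction fun s => z a₀ s a := fun a₀ a =>
    IsPolynomialFunction.insertNth a₀ (IsPolynomialFunction.const 1)
      (fun l => IsPolynomialFunction.apply _) a
  have hx : ∀ (e : Fin (m + 3) ≃ Fin (m + 1) ⊕ Fin 2) a₀ j,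
      IsPolynomialFunction fun s => graphMap e (A s) (z a₀ s) j := fun e a₀ j =>
    IsPolynomialFunction.graphMap e hA (hz a₀) j
  have hu : ∀ e a₀ a j, IsPolynomialFunction fun s => u e a₀ s a j := by
    intro e a₀ a j
    by_cases h : a = a₀
    · simp only [u, h, if_true]
      exact hx e a₀ j
    · simp only [u, h, if_false]
      exact IsPolynomialFunction.graphMap (z := fun _ => Pi.single a 1) e hA
        (fun l => IsPolynomialFunction.const ((Pi.single a 1 : Fin (m + 1) → K) l)) j
  refine (HoldsGenerically.forall_of_finite fun e : Fin (m + 3) ≃ Fin (m + 1) ⊕ Fin 2 =>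
    HoldsGenerically.forall_of_finite fun a₀ : Fin (m + 1) =>
      holdsGenerically_of_functionals (d := d) ?_ (lam e a₀) ?_).mono ?_
  · simp only [σ, Fintype.card_sum, Fintype.card_prod, Fintype.card_fin, Sym2.card]
    rw [show m + 1 + 1 = m + 2 from rfl]
    omega
  · intro t g
    induction t using Sym2.ind with
    | _ a b => exact IsPolynomialFunction.hessAt g (hx e a₀) (hu e a₀ a) (hu e a₀ b)
  · intro f hf h P hP x hxP hx0
    obtain ⟨e, B, rfl⟩ := exists_range_graphMap P hP (q := 2) rfl
    obtain ⟨w, rfl⟩ := hxP.1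
    have hw : w ≠ 0 := by
      rintro rfl
      exact hx0 (map_zero _)
    obtain ⟨a₀, ha₀⟩ := Function.ne_iff.1 hw
    set y := (w a₀)⁻¹ • w with hy
    have hya : y a₀ = 1 := by simp only [hy, Pi.smul_apply, smul_eq_mul]; exact inv_mul_cancel₀ ha₀
    let s : σ → K := Sum.elim (fun p => B p.1 p.2) (a₀.removeNth y)
    have hAs : A s = B := rfl
    have hzs : z a₀ s = y := by
      change a₀.insertNth (α := fun _ => K) 1 (a₀.removeNth y) = y
      rw [← hya, Fin.insertNth_self_removeNth]
    obtain ⟨t, ht⟩ := h e a₀ s fun c hc => hessFunctional_linearIndependent hd e (A s) a₀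
      (by rw [hzs, hya]) (u e a₀ s) (fun a => rfl) (fun t => lam e a₀ t s) (fun a b => rfl) c hc
    induction t using Sym2.ind with
    | _ a b =>
    have hmem : ∀ a, u e a₀ s a ∈ LinearMap.range (graphMap e B) := by
      intro a
      simp only [u, hAs]
      split_ifs
      · exact LinearMap.mem_range_self _ _
      · exact LinearMap.mem_range_self _ _
    refine ⟨_, hmem a, _, hmem b, fun h0 => ht ?_⟩
    change gradAt (dirDeriv (u e a₀ s a) f) (graphMap e (A s) (z a₀ s)) (u e a₀ s b) = 0
    rw [hAs, hzs, hy, map_smul, gradAt_apply,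
      eval_smul_of_isHomogeneous (isHomogeneous_dirDeriv (isHomogeneous_dirDeriv hf _) _),
      ← gradAt_apply, h0, mul_zero]

end Hessians

/-! ### Finiteness of projective varieties -/

section ProjectiveFiniteness

variable {K : Type u} [Field K] {m : ℕ}

/-- Comparison of the coefficients of `s ^ (e + 1)`. -/
theorem homogeneousComponent_eval_eq {b : MvPolynomial (Fin m) K} [Infinite K] {e : ℕ}
    {z : Fin m → K} {c y : K}
    (h : ∀ s : K, s ^ (e + 1) * y = s * c * MvPolynomial.eval (s • z) b) :
    y = c * MvPolynomial.eval z (MvPolynomial.homogeneousComponent e b) := by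
  have hb : ∀ s : K, MvPolynomial.eval (s • z) b = ∑ j ∈ Finset.range (b.totalDegree + 1),
      s ^ j * MvPolynomial.eval z (MvPolynomial.homogeneousComponent j b) := by
    intro s
    conv_lhs => rw [← MvPolynomial.sum_homogeneousComponent b]
    rw [map_sum]
    exact Finset.sum_congr rfl fun j _ => eval_smul_of_isHomogeneous
      (MvPolynomial.homogeneousComponent_isHomogeneous j b) s z
  let p : K[X] := Polynomial.C y * Polynomial.X ^ (e + 1) -
    ∑ j ∈ Finset.range (b.totalDegree + 1), Polynomial.C
      (c * MvPolynomial.eval z (MvPolynomial.homogeneousComponent j b)) * Polynomial.X ^ (j + 1)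
  have hp : p = 0 := by
    refine Polynomial.funext fun s => ?_
    simp only [p, Polynomial.eval_sub, Polynomial.eval_mul, Polynomial.eval_C, Polynomial.eval_pow,
      Polynomial.eval_X, Polynomial.eval_finsetSum, Polynomial.eval_zero]
    rw [mul_comm, h s, hb, Finset.mul_sum, ← Finset.sum_sub_distrib]
    refine Finset.sum_eq_zero fun j _ => ?_
    ring
  have h1 := congrArg (fun p : K[X] => p.coeff (e + 1)) hp
  simp only [p, Polynomial.coeff_sub, Polynomial.finsetSum_coeff, Polynomial.coeff_C_mul_X_pow,
    Polynomial.coeff_zero, if_true, Nat.add_right_cancel_iff] at h1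
  rw [Finset.sum_ite_eq] at h1
  split_ifs at h1 with h2
  · exact sub_eq_zero.1 h1
  · rw [sub_zero] at h1
    rw [Finset.mem_range, not_lt] at h2
    rw [h1, MvPolynomial.homogeneousComponent_eq_zero e b (by omega), map_zero, mul_zero]

/-- If the cone `Z` meets the hyperplane `h = 0` only in the origin, then on `Z` some power of each
coordinate is a multiple of `h`. -/
theorem exists_pow_eq_mul [IsAlgClosed K] {ι : Type} {k : ℕ} {g : ι → MvPolynomial (Fin m) K}
    (hg : ∀ a, (g a).IsHomogeneous k) (h : (Fin m → K) →ₗ[K] K)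
    (hZ : ∀ z, (∀ a, MvPolynomial.eval z (g a) = 0) → h z = 0 → z = 0) (l : Fin m) :
    ∃ (e : ℕ) (b : MvPolynomial (Fin m) K), b.IsHomogeneous e ∧
      ∀ z, (∀ a, MvPolynomial.eval z (g a) = 0) → z l ^ (e + 1) = h z * MvPolynomial.eval z b := by
  have : Infinite K := IsAlgClosed.instInfinite
  let I : Ideal (MvPolynomial (Fin m) K) := Ideal.span (insert (linForm h) (Set.range g))
  have h1 : MvPolynomial.X l ∈ I.radical := by
    rw [← MvPolynomial.vanishingIdeal_zeroLocus_eq_radical (K := K),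
      MvPolynomial.mem_vanishingIdeal_iff]
    intro z hz
    rw [MvPolynomial.mem_zeroLocus_iff] at hz
    have hz0 : z = 0 := by
      refine hZ z (fun a => ?_) ?_
      · simpa [MvPolynomial.coe_aeval_eq_eval] using hz (g a) (Ideal.subset_span (by simp))
      · rw [← eval_linForm]
        simpa [MvPolynomial.coe_aeval_eq_eval] using hz (linForm h) (Ideal.subset_span (by simp))
    simp [hz0]
  obtain ⟨e, he⟩ := h1
  have he' : MvPolynomial.X l ^ (e + 1) ∈ I := by
    rw [pow_succ]
    exact Ideal.mul_mem_right _ _ he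
  obtain ⟨b, p, hp, hbp⟩ := Ideal.mem_span_insert.1 he'
  have hpz : ∀ z, (∀ a, MvPolynomial.eval z (g a) = 0) → MvPolynomial.eval z p = 0 := by
    intro z hz
    have h2 : Ideal.span (Set.range g) ≤ RingHom.ker (MvPolynomial.eval z) := by
      rw [Ideal.span_le]
      rintro _ ⟨a, rfl⟩
      exact hz a
    exact h2 hp
  refine ⟨e, MvPolynomial.homogeneousComponent e b,
    MvPolynomial.homogeneousComponent_isHomogeneous e b, fun z hz => ?_⟩
  refine homogeneousComponent_eval_eq fun s => ?_
  have hsz : ∀ a, MvPolynomial.eval (s • z) (g a) = 0 := fun a => by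
    rw [eval_smul_of_isHomogeneous (hg a), hz a, mul_zero]
  have h3 := congrArg (MvPolynomial.eval (s • z)) hbp
  rw [map_add, map_mul, hpz _ hsz, eval_linForm, map_pow, MvPolynomial.eval_X, map_smul] at h3
  simp only [Pi.smul_apply, smul_eq_mul, mul_pow] at h3
  rw [h3]
  ring

/-- The linear map of evaluation at finitely many points. -/
def evalAt (S : Finset (Fin m → K)) : MvPolynomial (Fin m) K →ₗ[K] (S → K) :=
  LinearMap.pi fun p => (MvPolynomial.aeval (p : Fin m → K)).toLinearMap

@[simp] theorem evalAt_apply (S : Finset (Fin m → K)) (f : MvPolynomial (Fin m) K) (p : S) :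
    evalAt S f p = MvPolynomial.eval (p : Fin m → K) f := by
  simp [evalAt]

/-- Forms of sufficiently high degree separate points of an affine hyperplane. -/
theorem map_evalAt_eq_top {q : (Fin m → K) →ₗ[K] K} {S : Finset (Fin m → K)}
    (hS : ∀ p ∈ S, q p = 1) {t : ℕ} (ht : S.card ≤ t) :
    (MvPolynomial.homogeneousSubmodule (Fin m) K t).map (evalAt S) = ⊤ := by
  classical
  have hsep : ∀ p p' : Fin m → K, ∃ φ : (Fin m → K) →ₗ[K] K,
      q p = 1 → q p' = 1 → p ≠ p' → φ p ≠ 0 ∧ φ p' = 0 := by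
    intro p p'
    by_cases h : p = p'
    · exact ⟨0, fun _ _ h' => absurd h h'⟩
    · obtain ⟨l, hl⟩ := Function.ne_iff.1 h
      refine ⟨LinearMap.proj l - p' l • q, fun h1 h2 _ => ⟨?_, ?_⟩⟩
      · simpa [h1] using sub_ne_zero.2 hl
      · simp [h2]
  choose φ hφ using hsep
  let F : (Fin m → K) → MvPolynomial (Fin m) K := fun p =>
    (∏ p' ∈ S.erase p, linForm (φ p p')) * linForm q ^ (t - (S.erase p).card)
  have hF : ∀ p, (F p).IsHomogeneous t := by
    intro p
    have h1 := (MvPolynomial.IsHomogeneous.prod (S.erase p) (fun p' => linForm (φ p p'))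
      (fun _ => 1) fun p' _ => isHomogeneous_linForm _).mul
      ((isHomogeneous_linForm q).pow (t - (S.erase p).card))
    have h2 := Finset.card_erase_le (s := S) (a := p)
    have h3 : ∑ _p' ∈ S.erase p, 1 + 1 * (t - (S.erase p).card) = t := by simp; omega
    rwa [h3] at h1
  have hFp : ∀ p ∈ S, MvPolynomial.eval p (F p) ≠ 0 := by
    intro p hp
    simp only [F, map_mul, map_prod, map_pow, eval_linForm, hS p hp, one_pow, mul_one]
    refine Finset.prod_ne_zero_iff.2 fun p' hp' => ?_
    exact (hφ p p' (hS p hp) (hS p' (Finset.mem_of_mem_erase hp'))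
      (Finset.ne_of_mem_erase hp').symm).1
  have hFp' : ∀ p ∈ S, ∀ p' ∈ S, p ≠ p' → MvPolynomial.eval p' (F p) = 0 := by
    intro p hp p' hp' hne
    simp only [F, map_mul, map_prod, eval_linForm]
    rw [Finset.prod_eq_zero (f := fun x => φ p x p') (Finset.mem_erase.2 ⟨hne.symm, hp'⟩)
      ((hφ p p' (hS p hp) (hS p' hp') hne).2), zero_mul]
  rw [Submodule.eq_top_iff']
  intro w
  refine ⟨∑ p : S, (w p / MvPolynomial.eval (p : Fin m → K) (F p)) • F p,
    Submodule.sum_mem _ fun p _ => Submodule.smul_mem _ _ (hF p), ?_⟩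
  funext p
  rw [map_sum, Finset.sum_apply, Finset.sum_eq_single p]
  · rw [map_smul, Pi.smul_apply, evalAt_apply, smul_eq_mul, div_mul_cancel₀ _ (hFp p p.2)]
  · intro p' _ hne
    rw [map_smul, Pi.smul_apply, evalAt_apply,
      hFp' p' p'.2 p p.2 (fun h => hne (Subtype.ext h)), smul_zero]
  · simp

/-- A projective variety which does not meet some hyperplane is finite; its points are counted on
the affine chart `q = 1`. Modulo the variety every monomial of high degree is a multiple of the
equation `h` of the hyperplane, so the space of values of the forms at finitely many points of the
variety stops growing with the degree, while forms of high degree take arbitrary values at these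
points. -/
theorem finite_of_forall_eq_zero [IsAlgClosed K] {ι : Type} {k : ℕ}
    {g : ι → MvPolynomial (Fin m) K} (hg : ∀ a, (g a).IsHomogeneous k)
    (h q : (Fin m → K) →ₗ[K] K)
    (hZ : ∀ z, (∀ a, MvPolynomial.eval z (g a) = 0) → h z = 0 → z = 0) :
    {z | (∀ a, MvPolynomial.eval z (g a) = 0) ∧ q z = 1}.Finite := by
  choose e b hb hpow using exists_pow_eq_mul hg h hZ
  set D := ∑ l, e l with hD
  -- the spaces of values of forms of degree at least `D` do not grow with the degree
  have hstep : ∀ (S : Finset (Fin m → K)), (∀ p ∈ S, ∀ a, MvPolynomial.eval p (g a) = 0) →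
      ∀ t, D ≤ t → Module.finrank K
        ((MvPolynomial.homogeneousSubmodule (Fin m) K t).map (evalAt S)) ≤
        Module.finrank K ((MvPolynomial.homogeneousSubmodule (Fin m) K D).map (evalAt S)) := by
    intro S hS t ht
    induction t, ht using Nat.le_induction with
    | base => exact le_rfl
    | succ t ht ih =>
      refine le_trans ?_ ih
      let μ : (S → K) →ₗ[K] (S → K) := LinearMap.mulLeft K fun p => h p
      refine le_trans (Submodule.finrank_mono (?_ : _ ≤
        ((MvPolynomial.homogeneousSubmodule (Fin m) K t).map (evalAt S)).map μ))
        (Submodule.finrank_map_le _ _)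
      rintro _ ⟨f, hf, rfl⟩
      rw [SetLike.mem_coe, MvPolynomial.mem_homogeneousSubmodule] at hf
      rw [f.as_sum, map_sum]
      refine Submodule.sum_mem _ fun c hc => ?_
      have hdeg : c.degree = t + 1 := by
        rw [Finsupp.degree_eq_weight_one]
        exact hf (MvPolynomial.mem_support_iff.1 hc)
      obtain ⟨l, hl⟩ : ∃ l, e l < c l := by
        by_contra! hle
        have h1 : c.degree ≤ D := by
          rw [Finsupp.degree_eq_sum]
          exact Finset.sum_le_sum fun l _ => hle l
        omega
      obtain ⟨c', rfl⟩ : ∃ c', c = c' + Finsupp.single l (e l + 1) :=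
        ⟨c - Finsupp.single l (e l + 1), (tsub_add_cancel_of_le (by
          rw [Finsupp.single_le_iff]; omega)).symm⟩
      rw [map_add, Finsupp.degree_single] at hdeg
      refine ⟨evalAt S (MvPolynomial.monomial c' (f.coeff (c' + Finsupp.single l (e l + 1))) *
        b l), ⟨_, ?_, rfl⟩, ?_⟩
      · have h1 := (MvPolynomial.isHomogeneous_monomial (σ := Fin m)
          (f.coeff (c' + Finsupp.single l (e l + 1))) (rfl : c'.degree = c'.degree)).mul (hb l)
        have h2 : c'.degree + e l = t := by omega
        rwa [h2] at h1
      · funext p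
        simp only [μ, LinearMap.mulLeft_apply, Pi.mul_apply, evalAt_apply, map_mul]
        have h1 := hpow l p (hS p p.2)
        have h2 : MvPolynomial.monomial (c' + Finsupp.single l (e l + 1))
            (f.coeff (c' + Finsupp.single l (e l + 1))) =
            MvPolynomial.monomial c' (f.coeff (c' + Finsupp.single l (e l + 1))) *
              MvPolynomial.X l ^ (e l + 1) := by
          rw [MvPolynomial.X_pow_eq_monomial, MvPolynomial.monomial_mul, mul_one]
        rw [h2, map_mul, map_pow, MvPolynomial.eval_X, h1]
        ring
  by_contra hinf
  have : Module.Finite K (MvPolynomial.homogeneousSubmodule (Fin m) K D) :=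
    Module.Finite.iff_fg.2 (MvPolynomial.homogeneousSubmodule_fg _ _ D)
  obtain ⟨S, hSsub, hScard⟩ := Set.Infinite.exists_subset_card_eq hinf
    (Module.finrank K (MvPolynomial.homogeneousSubmodule (Fin m) K D) + 1)
  have h1 := hstep S (fun p hp => (hSsub hp).1) (max D S.card) (le_max_left _ _)
  rw [map_evalAt_eq_top (fun p hp => (hSsub hp).2) (le_max_right _ _), finrank_top,
    Module.finrank_fintype_fun_eq_card, Fintype.card_coe, hScard] at h1
  have h2 := Submodule.finrank_map_le (evalAt S)
    (MvPolynomial.homogeneousSubmodule (Fin m) K D)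
  omega

end ProjectiveFiniteness

/-! ### Independence of differentials of forms -/

section Independence

variable {K : Type u} [Field K] {n : ℕ}

theorem isHomogeneous_sq_prod_mul {ι : Type} (s : Finset ι) (φ : ι → (Fin n → K) →ₗ[K] K)
    (μ δ : (Fin n → K) →ₗ[K] K) :
    ((∏ j ∈ s, linForm (φ j)) ^ 2 * (linForm μ * linForm δ)).IsHomogeneous (2 * (s.card + 1)) := by
  have h := ((MvPolynomial.IsHomogeneous.prod s (fun j => linForm (φ j)) (fun _ => 1)
    fun j _ => isHomogeneous_linForm _).pow 2).mul
    ((isHomogeneous_linForm μ).mul (isHomogeneous_linForm δ))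
  have h1 : (∑ _j ∈ s, 1) * 2 + (1 + 1) = 2 * (s.card + 1) := by simp; ring
  rwa [h1] at h

theorem gradAt_sq_prod_mul {ι : Type} {s : Finset ι} {φ : ι → (Fin n → K) →ₗ[K] K}
    {μ : (Fin n → K) →ₗ[K] K} {x : Fin n → K} (hφ : ∀ j ∈ s, φ j x = 1) (hμ : μ x = 1)
    (δ : (Fin n → K) →ₗ[K] K) (v : Fin n → K) :
    gradAt ((∏ j ∈ s, linForm (φ j)) ^ 2 * (linForm μ * linForm δ)) x v =
      δ ((μ + (2 : K) • ∑ j ∈ s, φ j) v • x + v) := by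
  have h1 : MvPolynomial.eval x (∏ j ∈ s, linForm (φ j)) = 1 := by
    rw [map_prod]
    exact Finset.prod_eq_one fun j hj => by rw [eval_linForm, hφ j hj]
  simp only [pow_two, gradAt_mul, map_mul, h1, gradAt_prod_linForm s φ hφ, eval_linForm, hμ,
    gradAt_linForm, map_add, map_smul, LinearMap.add_apply, LinearMap.smul_apply, smul_eq_mul]
  ring

theorem gradAt_sq_prod_mul_of_mem {ι : Type} {s : Finset ι} {φ : ι → (Fin n → K) →ₗ[K] K}
    (μ : (Fin n → K) →ₗ[K] K) {x : Fin n → K} {j : ι} (hj : j ∈ s) (hφ : φ j x = 0)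
    (δ : (Fin n → K) →ₗ[K] K) (v : Fin n → K) :
    gradAt ((∏ j ∈ s, linForm (φ j)) ^ 2 * (linForm μ * linForm δ)) x v = 0 := by
  refine gradAt_sq_mul _ _ ?_ v
  rw [map_prod]
  exact Finset.prod_eq_zero hj (by rw [eval_linForm, hφ])

/-- A functional which separates a point of the hyperplane `H = 0` from a point outside. -/
theorem exists_dual {x y : Fin n → K} (hx : x ≠ 0) (H : (Fin n → K) →ₗ[K] K) (hHx : H x = 0)
    (hHy : H y ≠ 0) : ∃ φ : (Fin n → K) →ₗ[K] K, φ y = 0 ∧ φ x = 1 := by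
  obtain ⟨l, hl⟩ := Function.ne_iff.1 hx
  refine ⟨(x l)⁻¹ • (LinearMap.proj l - (y l / H y) • H), ?_, ?_⟩
  · simp [hHy]
  · simpa [hHx] using inv_mul_cancel₀ hl

theorem sum_smul_add_one {ι : Type} {s : Finset ι} {φ : ι → (Fin n → K) →ₗ[K] K}
    {μ : (Fin n → K) →ₗ[K] K} {x : Fin n → K} (hφ : ∀ j ∈ s, φ j x = 1) (hμ : μ x = 1) :
    (μ + (2 : K) • ∑ j ∈ s, φ j) x + 1 = ((2 * (s.card + 1) : ℕ) : K) := by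
  have h : (∑ j ∈ s, φ j) x = s.card := by
    rw [LinearMap.sum_apply, Finset.sum_congr rfl hφ]
    simp
  rw [LinearMap.add_apply, LinearMap.smul_apply, h, hμ, smul_eq_mul]
  push_cast
  ring

variable [CharZero K]

/-- The differentials of forms of degree `2 (r + 1)` at `r + 1` points outside a hyperplane, in
arbitrary directions, and at one point of the hyperplane, in the directions of the
hyperplane, are independent. The relation is tested on products of linear forms that vanish doubly
at all the points but one or two. -/
theorem eq_zero_of_sum_gradAt_eq_zero {r : ℕ} {y v : Fin (r + 1) → Fin n → K} {y' v' : Fin n → K}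
    (H : (Fin n → K) →ₗ[K] K) (hy : ∀ j, H (y j) ≠ 0) (hy' : H y' = 0) (hy0 : y' ≠ 0)
    (hsep : ∀ i j, i ≠ j → ∃ φ : (Fin n → K) →ₗ[K] K, φ (y j) = 0 ∧ φ (y i) = 1)
    (hv' : H v' = 0)
    (hsum : ∀ g : MvPolynomial (Fin n) K, g.IsHomogeneous (2 * (r + 1)) →
      ∑ j, gradAt g (y j) (v j) + gradAt g y' v' = 0) : (∀ j, v j = 0) ∧ v' = 0 := by
  classical
  have hcard : ∀ i : Fin (r + 1), 2 * ((Finset.univ.erase i).card + 1) = 2 * (r + 1) := by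
    intro i
    rw [Finset.card_erase_of_mem (Finset.mem_univ i)]
    simp
  -- the forms used here vanish doubly at the points off the hyperplane: at the first point because
  -- `φ 0` and `δ` vanish, at the others because of the squared factors
  have hv0 : v' = 0 := by
    choose φ hφ hφ' using fun j => exists_dual hy0 H hy' (hy j)
    have hφ1 : ∀ j ∈ (Finset.univ.erase 0 : Finset (Fin (r + 1))), φ j y' = 1 := fun j _ => hφ' j
    refine eq_zero_of_smul_add_eq_zero (x := y') (d := 2 * (r + 1))
      (η := φ 0 + (2 : K) • ∑ j ∈ Finset.univ.erase 0, φ j)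
      ((sum_smul_add_one hφ1 (hφ' 0)).trans (by rw [hcard])) (by omega) ?_
    set w := (φ 0 + (2 : K) • ∑ j ∈ Finset.univ.erase 0, φ j) v' • y' + v' with hw
    have hHw : H w = 0 := by rw [hw, map_add, map_smul, hy', hv', smul_zero, add_zero]
    refine eq_zero_of_forall_linearMap fun ψ => ?_
    -- the functional `ψ` corrected to vanish at the first point
    let δ : (Fin n → K) →ₗ[K] K := ψ - (ψ (y 0) / H (y 0)) • H
    have hδ0 : δ (y 0) = 0 := by simp [δ, hy 0]
    have h1 := hsum _ (hcard 0 ▸ isHomogeneous_sq_prod_mul (Finset.univ.erase 0) φ (φ 0) δ)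
    rw [gradAt_sq_prod_mul hφ1 (hφ' 0), ← hw, Finset.sum_eq_zero, zero_add] at h1
    · simpa [δ, hHw] using h1
    · intro j _
      by_cases hj : j = 0
      · subst hj
        simp [gradAt_mul, hφ 0, hδ0]
      · exact gradAt_sq_prod_mul_of_mem _ (Finset.mem_erase.2 ⟨hj, Finset.mem_univ j⟩) (hφ j) _ _
  refine ⟨fun i => ?_, hv0⟩
  have hex : ∀ j, ∃ φ : (Fin n → K) →ₗ[K] K, i ≠ j → φ (y j) = 0 ∧ φ (y i) = 1 := by
    intro j
    by_cases hij : i = j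
    · exact ⟨0, fun h => absurd hij h⟩
    · obtain ⟨φ, hφ⟩ := hsep i j hij
      exact ⟨φ, fun _ => hφ⟩
  choose φ hφ using hex
  let μ : (Fin n → K) →ₗ[K] K := (H (y i))⁻¹ • H
  have hμ : μ (y i) = 1 := by simp [μ, hy i]
  have hφ1 : ∀ j ∈ Finset.univ.erase i, φ j (y i) = 1 := fun j hj =>
    (hφ j (Finset.ne_of_mem_erase hj).symm).2
  refine eq_zero_of_smul_add_eq_zero (x := y i) (d := 2 * (r + 1))
    (η := μ + (2 : K) • ∑ j ∈ Finset.univ.erase i, φ j)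
    ((sum_smul_add_one hφ1 hμ).trans (by rw [hcard])) (by omega) ?_
  refine eq_zero_of_forall_linearMap fun δ => ?_
  have h1 := hsum _ (hcard i ▸ isHomogeneous_sq_prod_mul (Finset.univ.erase i) φ μ δ)
  rw [hv0, map_zero, add_zero, Finset.sum_eq_single i] at h1
  · rwa [gradAt_sq_prod_mul hφ1 hμ] at h1
  · intro j _ hj
    exact gradAt_sq_prod_mul_of_mem _ (Finset.mem_erase.2 ⟨hj, Finset.mem_univ j⟩)
      (hφ j hj.symm).1 _ _
  · simp

end Independence

/-! ### Moment hyperplanes -/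

section Hyperplanes

variable {K : Type u} [Field K] {m : ℕ}

/-- The functional with coefficients `1, c, c², …`. -/
def momentForm (c : K) : (Fin (m + 1) → K) →ₗ[K] K :=
  ∑ j : Fin (m + 1), c ^ (j : ℕ) • LinearMap.proj j

theorem momentForm_apply (c : K) (z : Fin (m + 1) → K) :
    momentForm c z = ∑ j : Fin (m + 1), c ^ (j : ℕ) * z j := by
  simp [momentForm]

/-- The parametrization of the hyperplane on which `momentForm c` vanishes. -/
def momentMap (c : K) : (Fin m → K) →ₗ[K] (Fin (m + 1) → K) :=
  LinearMap.pi (Fin.cons (-∑ k : Fin m, c ^ (k + 1 : ℕ) • LinearMap.proj k) LinearMap.proj)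

theorem momentMap_zero (c : K) (w : Fin m → K) :
    momentMap c w 0 = -∑ k : Fin m, c ^ (k + 1 : ℕ) * w k := by
  simp [momentMap]

theorem momentMap_succ (c : K) (w : Fin m → K) (k : Fin m) : momentMap c w k.succ = w k := by
  simp [momentMap]

theorem momentForm_momentMap (c : K) (w : Fin m → K) : momentForm c (momentMap c w) = 0 := by
  rw [momentForm_apply, Fin.sum_univ_succ, momentMap_zero]
  simp [momentMap_succ]

theorem momentMap_injective (c : K) : Function.Injective (momentMap (m := m) c) := by
  intro w w' h
  funext k
  rw [← momentMap_succ c w, h, momentMap_succ]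

theorem momentMap_tail {c : K} {z : Fin (m + 1) → K} (hz : momentForm c z = 0) :
    momentMap c (fun k => z k.succ) = z := by
  funext j
  refine Fin.cases ?_ (fun k => momentMap_succ _ _ _) j
  rw [momentForm_apply, Fin.sum_univ_succ] at hz
  rw [momentMap_zero]
  simp only [Fin.val_zero, pow_zero, one_mul, Fin.val_succ] at hz
  exact (eq_neg_of_add_eq_zero_left hz).symm

theorem IsPolynomialFunction.momentMap {σ : Type} (c : K) {w : (σ → K) → Fin m → K}
    (hw : ∀ k, IsPolynomialFunction fun s => w s k) (j : Fin (m + 1)) :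
    IsPolynomialFunction fun s => FanoDouble.momentMap c (w s) j := by
  refine Fin.cases ?_ (fun k => ?_) j
  · simp only [momentMap_zero, ← neg_one_mul (∑ k, _)]
    exact (IsPolynomialFunction.const _).mul
      (IsPolynomialFunction.sum _ fun k => (IsPolynomialFunction.const _).mul (hw k))
  · simpa only [momentMap_succ] using hw k

variable [CharZero K]

/-- A nonzero vector lies on few of the hyperplanes, because `momentForm c z` is a nonzero
polynomial of degree at most `m` in `c`. -/
theorem card_momentForm_eq_zero_le {z : Fin (m + 1) → K} (hz : z ≠ 0) (B : ℕ) [DecidableEq K] :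
    (Finset.univ.filter fun c : Fin B => momentForm ((c : ℕ) : K) z = 0).card ≤ m := by
  let p : K[X] := ∑ j : Fin (m + 1), Polynomial.C (z j) * Polynomial.X ^ (j : ℕ)
  have hcoeff : ∀ j : Fin (m + 1), p.coeff j = z j := by
    intro j
    simp only [p, Polynomial.finsetSum_coeff, Polynomial.coeff_C_mul_X_pow, Fin.val_inj]
    simp
  have hp : p ≠ 0 := by
    intro h
    obtain ⟨j, hj⟩ := Function.ne_iff.1 hz
    apply hj
    rw [← hcoeff, h]
    simp
  have hdeg : p.natDegree ≤ m := by
    refine Polynomial.natDegree_sum_le_of_forall_le _ _ fun j _ => ?_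
    exact (Polynomial.natDegree_C_mul_X_pow_le _ _).trans (Nat.lt_succ_iff.1 j.2)
  have heval : ∀ c : K, p.eval c = momentForm c z := by
    intro c
    simp only [p, momentForm_apply, Polynomial.eval_finsetSum, Polynomial.eval_mul,
      Polynomial.eval_C, Polynomial.eval_pow, Polynomial.eval_X]
    exact Finset.sum_congr rfl fun j _ => mul_comm _ _
  calc _ = ((Finset.univ.filter fun c : Fin B => momentForm ((c : ℕ) : K) z = 0).image
        fun c : Fin B => ((c : ℕ) : K)).card := by
        rw [Finset.card_image_of_injective]
        intro c c' h
        exact Fin.ext (Nat.cast_injective h)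
    _ ≤ p.roots.toFinset.card := by
        refine Finset.card_le_card fun c hc => ?_
        obtain ⟨c', hc', rfl⟩ := Finset.mem_image.1 hc
        rw [Multiset.mem_toFinset, Polynomial.mem_roots hp, Polynomial.IsRoot, heval]
        exact (Finset.mem_filter.1 hc').2
    _ ≤ m := (Multiset.toFinset_card_le _).trans (p.card_roots'.trans hdeg)

/-- If a set meets all the hyperplanes outside the origin, then points on some of these hyperplanes
can be chosen successively so that no hyperplane contains a previous point; the
parameters of the hyperplanes are bounded independently of the set. -/
theorem exists_successive_points {Z : Set (Fin (m + 1) → K)}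
    (hZ : ∀ c : K, ∃ z ∈ Z, z ≠ 0 ∧ momentForm c z = 0) {B r : ℕ} (hr : r * m < B + m) :
    ∃ (c : Fin r → Fin B) (z : Fin r → Fin (m + 1) → K), ∀ j, z j ∈ Z ∧ z j ≠ 0 ∧
      momentForm ((c j : ℕ) : K) (z j) = 0 ∧
      ∀ i < j, momentForm ((c j : ℕ) : K) (z i) ≠ 0 := by
  classical
  induction r with
  | zero => exact ⟨Fin.elim0, Fin.elim0, fun j => j.elim0⟩
  | succ r ih =>
    obtain ⟨c, z, hcz⟩ := ih (by rw [Nat.succ_mul] at hr; omega)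
    let bad : Finset (Fin B) := Finset.univ.biUnion fun i : Fin r =>
      Finset.univ.filter fun c : Fin B => momentForm ((c : ℕ) : K) (z i) = 0
    have hbad : bad.card < B := by
      have h1 : bad.card ≤ (Finset.univ : Finset (Fin r)).card * m :=
        Finset.card_biUnion_le_card_mul _ _ _ fun i _ =>
          card_momentForm_eq_zero_le (hcz i).2.1 B
      rw [Finset.card_univ, Fintype.card_fin] at h1
      rw [Nat.succ_mul] at hr
      omega
    obtain ⟨c₁, hc₁⟩ : ∃ c₁, c₁ ∉ bad := by
      by_contra! h
      rw [Finset.eq_univ_iff_forall.2 h, Finset.card_univ, Fintype.card_fin] at hbad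
      omega
    have hc₁' : ∀ i, momentForm ((c₁ : ℕ) : K) (z i) ≠ 0 := by
      intro i h
      exact hc₁ (Finset.mem_biUnion.2 ⟨i, Finset.mem_univ i,
        Finset.mem_filter.2 ⟨Finset.mem_univ _, h⟩⟩)
    obtain ⟨z₁, hz₁, hz₁0, hz₁c⟩ := hZ ((c₁ : ℕ) : K)
    refine ⟨Fin.snoc (α := fun _ => Fin B) c c₁,
      Fin.snoc (α := fun _ => Fin (m + 1) → K) z z₁, fun j => ?_⟩
    refine Fin.lastCases ?_ (fun j => ?_) j
    · simp only [Fin.snoc_last]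
      refine ⟨hz₁, hz₁0, hz₁c, fun i => ?_⟩
      refine Fin.lastCases (fun h => absurd h (lt_irrefl _)) (fun i _ => ?_) i
      simpa only [Fin.snoc_castSucc] using hc₁' i
    · simp only [Fin.snoc_castSucc]
      refine ⟨(hcz j).1, (hcz j).2.1, (hcz j).2.2.1, fun i => ?_⟩
      refine Fin.lastCases (fun h => absurd h (by simp [Fin.le_last])) (fun i hi => ?_) i
      simpa only [Fin.snoc_castSucc] using (hcz j).2.2.2 i (by simpa using hi)

end Hyperplanes

/-! ### Singular points of restrictions to linear subspaces -/

section Finiteness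

variable {K : Type u} [Field K]

/-- The functionals which express that the points `z j` are singular points of the restriction of a
form to a linear subspace, written in terms of a graph. At the last point only the directions along
the hyperplane are used, which leaves one condition more than there are parameters. -/
theorem gradFunctional_linearIndependent [CharZero K] {n N q : ℕ}
    (e : Fin n ≃ Fin (N + 2) ⊕ Fin q) (A : Fin q → Fin (N + 2) → K)
    (c : Fin (N + 3) → K) (z : Fin (N + 3) → Fin (N + 2) → K) (hz0 : ∀ j, z j ≠ 0)
    (hz : ∀ j, momentForm (c j) (z j) = 0)
    (hne : ∀ j, ∀ i < j, momentForm (c j) (z i) ≠ 0)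
    (C : (Fin (N + 2) × Fin (N + 2)) ⊕ Fin (N + 1) → K)
    (hsum : ∀ g : MvPolynomial (Fin n) K, g.IsHomogeneous (2 * (N + 2)) →
      ∑ t, C t * (Sum.elim
        (fun p => gradFunctional (graphMap e A (z p.1.castSucc)) (graphMap e A (Pi.single p.2 1)))
        (fun b => gradFunctional (graphMap e A (z (Fin.last (N + 2))))
          (graphMap e A (momentMap (c (Fin.last (N + 2))) (Pi.single b 1))))
        t : MvPolynomial (Fin n) K →ₗ[K] K) g = 0) : C = 0 := by
  let E := graphMap e A
  -- the moment forms, extended to the ambient space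
  let H : K → (Fin n → K) →ₗ[K] K := fun c =>
    momentForm c ∘ₗ LinearMap.pi fun a => LinearMap.proj (e.symm (Sum.inl a))
  have hH : ∀ c w, H c (E w) = momentForm c w := by
    intro c w
    refine congrArg (momentForm c) (funext fun a => ?_)
    exact graphMap_inl e A w a
  have hE0 : ∀ j, E (z j) ≠ 0 := fun j h => hz0 j (graphMap_injective e A (by
    rw [map_zero]; exact h))
  let v : Fin (N + 2) → Fin (N + 2) → K := fun j a => C (Sum.inl (j, a))
  let v' : Fin (N + 1) → K := fun b => C (Sum.inr b)
  obtain ⟨h1, h2⟩ := eq_zero_of_sum_gradAt_eq_zero (r := N + 1)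
    (y := fun j : Fin (N + 2) => E (z j.castSucc)) (v := fun j => E (v j))
    (y' := E (z (Fin.last (N + 2)))) (v' := E (momentMap (c (Fin.last (N + 2))) v'))
    (H (c (Fin.last (N + 2))))
    (fun j => by rw [hH]; exact hne _ _ (Fin.castSucc_lt_last j)) (by rw [hH, hz]) (hE0 _)
    (fun i j hij => by
      rcases lt_or_gt_of_ne hij with h | h
      · have h3 := hne j.castSucc i.castSucc (by simpa using h)
        refine ⟨(momentForm (c j.castSucc) (z i.castSucc))⁻¹ • H (c j.castSucc), ?_, ?_⟩
        · simp [hH, hz]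
        · simp [hH, h3]
      · exact exists_dual (hE0 _) (H (c i.castSucc)) (by rw [hH, hz])
          (by rw [hH]; exact hne i.castSucc j.castSucc (by simpa using h)))
    (by rw [hH, momentForm_momentMap]) (fun g hg => by
      rw [← hsum g hg, Fintype.sum_sum_type, Fintype.sum_prod_type]
      congr 1
      · refine Finset.sum_congr rfl fun j _ => ?_
        rw [← LinearMap.comp_apply, ← sum_apply_single]
        exact Finset.sum_congr rfl fun a _ => mul_comm _ _
      · rw [← LinearMap.comp_apply, ← LinearMap.comp_apply, ← sum_apply_single]
        exact Finset.sum_congr rfl fun b _ => mul_comm _ _)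
  funext t
  match t with
  | Sum.inl (j, a) =>
    exact congrFun (graphMap_injective e A ((h1 j).trans (map_zero _).symm)) a
  | Sum.inr b =>
    exact congrFun (momentMap_injective _ (graphMap_injective e A
      (h2.trans ((congrArg E (map_zero (momentMap (c (Fin.last (N + 2)))))).trans
        (map_zero E)).symm))) b

theorem eval_aeval_linForm {n m : ℕ} (E : (Fin m → K) →ₗ[K] (Fin n → K))
    (f : MvPolynomial (Fin n) K) (z : Fin m → K) :
    MvPolynomial.eval z (MvPolynomial.aeval (fun j => linForm (LinearMap.proj j ∘ₗ E)) f) =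
      MvPolynomial.eval (E z) f := by
  rw [eval_aeval]
  congr 2
  funext j
  rw [eval_linForm]
  rfl

/-- If the restriction of `f` to a linear subspace has infinitely many singular points, then its
singular points meet every hyperplane. -/
theorem exists_mem_restrictionSingularLocus [IsAlgClosed K] {n m d : ℕ}
    {f : MvPolynomial (Fin n) K} (hf : f.IsHomogeneous d)
    (E : (Fin m → K) →ₗ[K] (Fin n → K)) (i : Fin n)
    (hinf : ¬ {x ∈ restrictionSingularLocus f (LinearMap.range E) | x i = 1}.Finite)
    (h : (Fin m → K) →ₗ[K] K) :
    ∃ z, (∀ u, gradAt f (E z) (E u) = 0) ∧ z ≠ 0 ∧ h z = 0 := by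
  by_contra! hcon
  let g : Fin m → MvPolynomial (Fin n) K := fun a => dirDeriv (E (Pi.single a 1)) f
  let γ : Fin n → MvPolynomial (Fin m) K := fun j => linForm (LinearMap.proj j ∘ₗ E)
  have hg : ∀ a, (MvPolynomial.aeval γ (g a)).IsHomogeneous (1 * (d - 1)) := fun a =>
    (isHomogeneous_dirDeriv hf _).aeval γ fun j => isHomogeneous_linForm _
  have hgz : ∀ z a, MvPolynomial.eval z (MvPolynomial.aeval γ (g a)) =
      gradAt f (E z) (E (Pi.single a 1)) := fun z a => eval_aeval_linForm E _ z
  have hall : ∀ z, (∀ a, MvPolynomial.eval z (MvPolynomial.aeval γ (g a)) = 0) →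
      ∀ u, gradAt f (E z) (E u) = 0 := by
    intro z hz u
    rw [← LinearMap.comp_apply, ← sum_apply_single]
    refine Finset.sum_eq_zero fun a _ => ?_
    rw [LinearMap.comp_apply, ← hgz, hz, zero_mul]
  have hfin := finite_of_forall_eq_zero hg h (LinearMap.proj i ∘ₗ E) fun z hz hhz => by
    by_contra hz0
    exact hcon z (hall z hz) hz0 hhz
  refine hinf ((hfin.image E).subset ?_)
  rintro _ ⟨⟨⟨z, rfl⟩, hz⟩, hzi⟩
  exact ⟨z, ⟨fun a => (hgz z a).trans (hz _ (LinearMap.mem_range_self _ _)), hzi⟩, rfl⟩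

/-- For a generic form the restrictions to the linear subspaces of codimension two have
only finitely many singular points. Otherwise there are `N + 3` singular points on hyperplanes
chosen from a finite set; these give `(N + 2) ^ 2 + (N + 1)` conditions on the form, which depend on
`2 * (N + 2) + (N + 3) * N` parameters, one less. -/
theorem holdsGenerically_finite_singularLocus [IsAlgClosed K] [CharZero K] (N : ℕ) :
    HoldsGenerically K (N + 4) (2 * (N + 2)) fun f => ∀ P : Submodule K (Fin (N + 4) → K),
      Module.finrank K P = N + 2 → ∀ i, {x ∈ restrictionSingularLocus f P | x i = 1}.Finite := by
  -- the parameters: the matrix of the subspace, and the affine coordinates of `N + 3` points, each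
  -- of them on a fixed hyperplane
  let σ : Type := (Fin 2 × Fin (N + 2)) ⊕ (Fin (N + 3) × Fin N)
  obtain ⟨B, hB⟩ : ∃ B, (N + 3) * (N + 1) < B + (N + 1) := ⟨(N + 2) * (N + 1) + 1, by nlinarith⟩
  let A : (σ → K) → Fin 2 → Fin (N + 2) → K := fun s b a => s (Sum.inl (b, a))
  let z : (Fin (N + 3) → Fin B) → (Fin (N + 3) → Fin (N + 1)) → (σ → K) → Fin (N + 3) →
      Fin (N + 2) → K := fun c k s j => momentMap ((c j : ℕ) : K)
    ((k j).insertNth (α := fun _ => K) 1 fun l => s (Sum.inr (j, l)))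
  let lam : (Fin (N + 4) ≃ Fin (N + 2) ⊕ Fin 2) → (Fin (N + 3) → Fin B) →
      (Fin (N + 3) → Fin (N + 1)) → (Fin (N + 2) × Fin (N + 2)) ⊕ Fin (N + 1) → (σ → K) →
      MvPolynomial (Fin (N + 4)) K →ₗ[K] K := fun e c k t s =>
    Sum.elim (fun p => gradFunctional (graphMap e (A s) (z c k s p.1.castSucc))
        (graphMap e (A s) (Pi.single p.2 1)))
      (fun b => gradFunctional (graphMap e (A s) (z c k s (Fin.last (N + 2))))
        (graphMap e (A s) (momentMap ((c (Fin.last (N + 2)) : ℕ) : K) (Pi.single b 1)))) t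
  have hA : ∀ b a, IsPolynomialFunction fun s => A s b a := fun b a =>
    IsPolynomialFunction.apply _
  have hx : ∀ (e : Fin (N + 4) ≃ Fin (N + 2) ⊕ Fin 2) c k j l,
      IsPolynomialFunction fun s => graphMap e (A s) (z c k s j) l := fun e c k j l =>
    IsPolynomialFunction.graphMap e hA (fun a => IsPolynomialFunction.momentMap _
      (fun a => IsPolynomialFunction.insertNth (k j) (IsPolynomialFunction.const 1)
        (fun l => IsPolynomialFunction.apply _) a) a) l
  have hconst : ∀ (e : Fin (N + 4) ≃ Fin (N + 2) ⊕ Fin 2) (w : Fin (N + 2) → K) l,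
      IsPolynomialFunction fun s => graphMap e (A s) w l := fun e w l =>
    IsPolynomialFunction.graphMap (z := fun _ => w) e hA
      (fun a => IsPolynomialFunction.const (w a)) l
  refine (HoldsGenerically.forall_of_finite fun e : Fin (N + 4) ≃ Fin (N + 2) ⊕ Fin 2 =>
    HoldsGenerically.forall_of_finite fun c : Fin (N + 3) → Fin B =>
    HoldsGenerically.forall_of_finite fun k : Fin (N + 3) → Fin (N + 1) =>
      holdsGenerically_of_functionals (d := 2 * (N + 2)) ?_ (lam e c k) ?_).mono ?_
  · simp only [σ, Fintype.card_sum, Fintype.card_prod, Fintype.card_fin]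
    nlinarith
  · intro t g
    match t with
    | Sum.inl (j, a) => exact IsPolynomialFunction.gradAt g (hx e c k _) (hconst e _)
    | Sum.inr b => exact IsPolynomialFunction.gradAt g (hx e c k _) (hconst e _)
  · intro f hf h P hP i
    obtain ⟨e, A₀, rfl⟩ := exists_range_graphMap P hP (q := 2) rfl
    by_contra hinf
    obtain ⟨c, w, hw⟩ := exists_successive_points
      (Z := {z | ∀ u, gradAt f (graphMap e A₀ z) (graphMap e A₀ u) = 0}) (B := B) (r := N + 3)
      (fun c => by
        obtain ⟨z, hz⟩ := exists_mem_restrictionSingularLocus hf (graphMap e A₀) i hinf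
          (momentForm c)
        exact ⟨z, hz⟩)
      hB
    have htail : ∀ j, ∃ k : Fin (N + 1), w j k.succ ≠ 0 := by
      intro j
      by_contra! h0
      apply (hw j).2.1
      rw [← momentMap_tail (hw j).2.2.1, show (fun k : Fin (N + 1) => w j k.succ) = 0 from
        funext h0, map_zero]
    choose k hk using htail
    -- the points in affine coordinates
    let y : Fin (N + 3) → Fin (N + 1) → K := fun j => (w j (k j).succ)⁻¹ • fun l => w j l.succ
    have hyk : ∀ j, y j (k j) = 1 := fun j => inv_mul_cancel₀ (hk j)
    let s : σ → K := Sum.elim (fun p => A₀ p.1 p.2) (fun p => (k p.1).removeNth (y p.1) p.2)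
    have hAs : A s = A₀ := rfl
    have hzs : ∀ j, z c k s j = (w j (k j).succ)⁻¹ • w j := by
      intro j
      have h1 : (k j).insertNth (α := fun _ => K) 1 ((k j).removeNth (y j)) = y j := by
        rw [← hyk j, Fin.insertNth_self_removeNth]
      change momentMap _ ((k j).insertNth (α := fun _ => K) 1 ((k j).removeNth (y j))) = _
      rw [h1, map_smul, momentMap_tail (hw j).2.2.1]
    have hinv : ∀ j, (w j (k j).succ)⁻¹ ≠ 0 := fun j => inv_ne_zero (hk j)
    obtain ⟨t, ht⟩ := h e c k s fun C hC =>
      gradFunctional_linearIndependent (n := N + 4) (q := 2) e (A s)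
        (fun j => ((c j : ℕ) : K)) (z c k s)
        (fun j => by rw [hzs]; exact smul_ne_zero (hinv j) (hw j).2.1)
        (fun j => by rw [hzs, map_smul, (hw j).2.2.1, smul_zero])
        (fun j i hij => by rw [hzs, map_smul]; exact smul_ne_zero (hinv i) ((hw j).2.2.2 i hij))
        C hC
    have hzero : ∀ j u, gradAt f (graphMap e (A s) (z c k s j)) (graphMap e (A s) u) = 0 := by
      intro j u
      rw [hAs, hzs, map_smul, gradAt_apply, eval_smul_of_isHomogeneous
        (isHomogeneous_dirDeriv hf _), ← gradAt_apply, (hw j).1 u, mul_zero]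
    match t with
    | Sum.inl (j, a) => exact ht (hzero _ _)
    | Sum.inr b => exact ht (hzero _ _)

end Finiteness

end FanoDouble

end

/-! ### Singular points for a generic hypersurface -/

theorem proposition0p6 (K : Type u) [Field K] [IsAlgClosed K] [CharZero K] (M : ℕ) (hM : 4 ≤ M) :
    FanoDouble.HoldsForGenericForm K (M + 1) (2 * (M - 1)) fun f =>
      FanoDouble.IsSmoothHypersurface f ∧
      ∀ P : Submodule K (Fin (M + 1) → K), Module.finrank K P + 2 = M + 1 →
        (6 ≤ M → ∀ i, FanoDouble.SingularPointsIsolatedQuadratic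
          (FanoDouble.blowUpChart f P i) 4) ∧
        (∀ i, FanoDouble.SingularPointsIsolatedQuadratic (FanoDouble.blowUpChart f P i) 3) ∧
        (6 ≤ M → ∀ i, FanoDouble.SingularPointsIsolatedQuadratic
          (FanoDouble.preimageChart f P i) 2) := by
  obtain ⟨N, rfl⟩ : ∃ N, M = N + 3 := ⟨M - 3, by omega⟩
  have hd : 2 * (N + 3 - 1) = 2 * (N + 2) := by omega
  rw [hd]
  have : Infinite K := IsAlgClosed.instInfinite
  have hess : 6 ≤ N + 3 → FanoDouble.HoldsGenerically K (N + 4) (2 * (N + 2)) fun f =>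
      ∀ P : Submodule K (Fin (N + 4) → K), Module.finrank K P = N + 2 →
        FanoDouble.HasNonzeroHessians f P := by
    intro h6
    refine FanoDouble.holdsGenerically_hasNonzeroHessians (m := N + 1) (by omega) ?_
    obtain ⟨k, rfl⟩ : ∃ k, N = k + 3 := ⟨N - 3, by omega⟩
    rw [show k + 3 + 1 + 2 = k + 6 by omega]
    rw [Nat.choose_two_right, Nat.lt_iff_add_one_le, Nat.le_div_iff_mul_le two_pos,
      show k + 6 - 1 = k + 5 by omega]
    nlinarith
  refine FanoDouble.HoldsGenerically.holdsForGenericForm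
    (((FanoDouble.holdsGenerically_isSmoothHypersurface (N + 3) _ (by omega)).and
      ((FanoDouble.holdsGenerically_finite_singularLocus N).and
        (FanoDouble.HoldsGenerically.imp hess))).mono ?_)
  rintro f hf ⟨hsm, hfin, hH⟩
  refine ⟨hsm, fun P hP => ?_⟩
  have hP' : Module.finrank K P = (N + 1) + 1 := by omega
  have hn : N + 1 + 3 = N + 3 + 1 := by omega
  refine ⟨fun h6 i => ?_, fun i => ?_, fun h6 i => ?_⟩
  · exact FanoDouble.singularPointsIsolatedQuadratic_blowUpChart hf hsm (Nat.succ_ne_zero N) hP' hn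
      (hfin P hP' i) fun b => b.hasQuadraticCriticalPoints_blowSlice_three hf hsm (hfin P hP' i)
        (hH h6 P hP')
  · exact FanoDouble.singularPointsIsolatedQuadratic_blowUpChart hf hsm (Nat.succ_ne_zero N) hP' hn
      (hfin P hP' i) fun b => b.hasQuadraticCriticalPoints_blowSlice_two hf hsm (hfin P hP' i)
  · exact FanoDouble.singularPointsIsolatedQuadratic_preimageChart hf (Nat.succ_ne_zero N) hP' hn
      (hfin P hP' i) (hH h6 P hP')
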